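/- Fix $\overline N>0$. Let $|k\rangle\in L^2(\mathbb R)$, $k\ge 0$, be the number vectors, that is, the normalized Hermite functions $$|k\rangle(x)=\Big(\frac2\pi\Big)^{1/4}\frac{1}{\sqrt{k!}}\,\mathrm{He}_k(2x)\,e^{-x^2}$$ ($\mathrm{He}_k$ the probabilists' Hermite polynomials; with the annihilation operator $a=x+\frac12\frac{d}{dx}$ the position operator is $Q=\frac{a+a^*}{2}$, the multiplication by $x$). For $\alpha\in\mathbb C$ let $$|\alpha\rangle=e^{-|\alpha|^2/2}\sum_{k\ge0}\frac{\alpha^k}{\sqrt{k!}}|k\rangle$$ be the coherent vector, and let $$\rho_\theta=\frac1{\pi\overline N}\int_{\mathbb C}|\alpha\rangle\langle\alpha|\,e^{-|\alpha-\theta|^2/\overline N}\,d^2\alpha,\qquad \theta\in\mathbb R,$$ be the one-parameter quantum Gaussian state family. A sequence of estimators $\vec M=(M^n)_n$ consists of positive operator valued measures $M^n$ on $L^2(\mathbb R)^{\otimes n}=L^2(\mathbb R^n)$ with outcomes in $\mathbb R$; write $\mathrm P^{M^n}_\theta(B)=\operatorname{Tr}\rho_\theta^{\otimes n}M^n(B)$,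 and $$\beta(\vec M,\theta,\epsilon)=\limsup_{n\to\infty}-\frac1n\log\mathrm P_\theta^{M^n}\{x:|x-\theta|>\epsilon\},\qquad \underline\beta(\vec M,\theta,\epsilon)=\liminf_{n\to\infty}-\frac1n\log\mathrm P_\theta^{M^n}\{x:|x-\theta|>\epsilon\},$$ $$\alpha(\vec M,\theta)=\limsup_{\epsilon\downarrow0}\frac{\beta(\vec M,\theta,\epsilon)}{\epsilon^2},\qquad \underline\alpha(\vec M,\theta)=\liminf_{\epsilon\downarrow0}\frac{\underline\beta(\vec M,\theta,\epsilon)}{\epsilon^2}.$$ The sequence $\vec M$ is strongly consistent if $\theta\mapsto\underline\alpha(\vec M,\theta)$ is finite and continuous and $\underline\beta(\vec M,\theta,\epsilon)/\epsilon^2\to\underline\alpha(\vec M,\theta)$ as $\epsilon\downarrow0$, uniformly in $\theta$. A symmetric logarithmic derivative (SLD) at $\theta$ is a (possibly unbounded) self-adjoint operator $L_\theta$ whose domain contains the ranges of $\rho_\theta$ and $\sqrt{\rho_\theta}$, with $L_\theta\rho_\theta$ bounded and $$\frac{d\rho_\theta}{d\theta}=\frac12(L_\theta\rho_\theta+\rho_\theta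 L_\theta)$$ in operator norm, where $\rho_\theta L_\theta$ stands for the adjoint $(L_\theta\rho_\theta)^*$. The SLD Fisher information is $J_\theta=\operatorname{Tr}L_\theta^2\rho_\theta$, that is, the squared Hilbert–Schmidt norm of $L_\theta\sqrt{\rho_\theta}$; to say that $J_\theta$ is the SLD Fisher information includes that an SLD exists and that the value is the same for each of them. Let $\vec M^s=(M^{s,n})_n$ be the sequence of estimators that measures the position (the spectral measure $E(Q)$ of $Q$) on each of the $n$ systems and takes as its estimate the arithmetic mean of the $n$ outcomes. **Theorem.** The sequence $\vec M^s$ is strongly consistent on $\Theta=\mathbb R$, and for every $\theta\in\mathbb R$ $$\alpha(\vec M^s,\theta)=\underline\alpha(\vec M^s,\theta)=\frac{J_\theta}{2}=\frac1{\overline N+\frac12}.$$ -/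

import Mathlib

open MeasureTheory Filter Topology
open scoped InnerProductSpace ENNReal

noncomputable section

/-! ## Measurements on a Hilbert space -/

/-- A positive operator valued measure on the measurable space `Ω`, with values in the bounded
operators on the Hilbert space `H`. Countable additivity is in the weak operator sense.
Only the values on measurable sets matter. -/
structure POVM (Ω : Type*) [MeasurableSpace Ω] (H : Type*) [NormedAddCommGroup H]
    [InnerProductSpace ℂ H] where
  op : Set Ω → H →L[ℂ] H
  isPositive : ∀ B, MeasurableSet B → (op B).IsPositive
  op_empty : op ∅ = 0
  op_univ : op Set.univ = ContinuousLinearMap.id ℂ H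
  hasSum_inner : ∀ f : ℕ → Set Ω, (∀ i, MeasurableSet (f i)) →
    Pairwise (Function.onFun Disjoint f) → ∀ φ ψ : H,
      HasSum (fun i => ⟪φ, op (f i) ψ⟫_ℂ) ⟪φ, op (⋃ i, f i) ψ⟫_ℂ

/-- The measurement `M ∘ T⁻¹`: measure `M` and process the outcome by `T`. -/
def POVM.map {Ω Ω' H : Type*} [MeasurableSpace Ω] [MeasurableSpace Ω'] [NormedAddCommGroup H]
    [InnerProductSpace ℂ H] (M : POVM Ω H) (T : Ω → Ω') (hT : Measurable T) : POVM Ω' H where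
  op B := M.op (T ⁻¹' B)
  isPositive B hB := M.isPositive _ (hT hB)
  op_empty := by simp [M.op_empty]
  op_univ := by simp [M.op_univ]
  hasSum_inner f hf hd φ ψ := by
    rw [Set.preimage_iUnion]
    exact M.hasSum_inner _ (fun i => hT (hf i)) (fun i j hij => (hd hij).preimage T) φ ψ

/-- The trace `∑ i, ⟪b i, A (b i)⟫` in a Hilbert basis; for a trace class operator the sum
converges absolutely and does not depend on the basis. -/
def opTrace {H : Type*} [NormedAddCommGroup H] [InnerProductSpace ℂ H] [CompleteSpace H]
    (A : H →L[ℂ] H) : ℂ :=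
  ∑' i, ⟪(exists_hilbertBasis ℂ H).choose_spec.choose i,
    A ((exists_hilbertBasis ℂ H).choose_spec.choose i)⟫_ℂ

/-- The probability `Tr ρ M(B)` that the measurement `M` on the state `ρ` gives a result in `B`. -/
def measureProb {Ω H : Type*} [MeasurableSpace Ω] [NormedAddCommGroup H] [InnerProductSpace ℂ H]
    [CompleteSpace H] (ρ : H →L[ℂ] H) (M : POVM Ω H) (B : Set Ω) : ℝ :=
  (opTrace (ρ ∘L M.op B)).re

/-! ## Symmetric logarithmic derivative -/

/-- `L` is a symmetric logarithmic derivative at `θ` of the family `ρ` of density operators: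
`L` is a (possibly unbounded) self-adjoint operator, the ranges of `√(ρ θ)` and of `ρ θ` lie in
its domain, and `d ρ / d θ = (L ρ + ρ L) / 2`, where `ρ L` is
understood as the adjoint of the bounded everywhere defined operator `L ρ`. -/
structure IsSLD {H : Type*} [NormedAddCommGroup H] [InnerProductSpace ℂ H] [CompleteSpace H]
    (ρ : ℝ → H →L[ℂ] H) (θ : ℝ) (L : H →ₗ.[ℂ] H) : Prop where
  isSelfAdjoint : IsSelfAdjoint L
  sqrt_mem : ∀ ψ, CFC.sqrt (ρ θ) ψ ∈ L.domain
  mem : ∀ ψ, ρ θ ψ ∈ L.domain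
  hasDerivAt : ∃ Lρ : H →L[ℂ] H, (∀ ψ, Lρ ψ = L ⟨ρ θ ψ, mem ψ⟩) ∧
    HasDerivAt ρ ((1 / 2 : ℂ) • (Lρ + ContinuousLinearMap.adjoint Lρ)) θ

/-- `Tr L² ρ` for a symmetric logarithmic derivative `L`, that is, the squared Hilbert-Schmidt norm
of `L √ρ`; it is independent of the Hilbert basis. -/
def IsSLD.fisherInformation {H : Type*} [NormedAddCommGroup H] [InnerProductSpace ℂ H]
    [CompleteSpace H] {ρ : ℝ → H →L[ℂ] H} {θ : ℝ} {L : H →ₗ.[ℂ] H} (h : IsSLD ρ θ L) : ℝ≥0∞ :=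
  ∑' i, ‖L ⟨CFC.sqrt (ρ θ) ((exists_hilbertBasis ℂ H).choose_spec.choose i), h.sqrt_mem _⟩‖ₑ ^ 2

/-- `J` is the SLD Fisher information of the family `ρ` at `θ`: a symmetric logarithmic derivative
exists, and `Tr L² ρ = J` for every choice `L` of it. -/
def HasSLDFisherInformation {H : Type*} [NormedAddCommGroup H] [InnerProductSpace ℂ H]
    [CompleteSpace H] (ρ : ℝ → H →L[ℂ] H) (θ J : ℝ) : Prop :=
  (∃ L, IsSLD ρ θ L) ∧
    ∀ (L : H →ₗ.[ℂ] H) (h : IsSLD ρ θ L), h.fisherInformation = ENNReal.ofReal J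

/-! ## The spaces `L²(ℝ)` and `L²(ℝ)^{⊗ n} = L²(ℝⁿ)` -/

/-- The Hilbert space of complex square integrable functions. -/
abbrev HilbertL2 (X : Type*) [MeasureSpace X] : Type _ := Lp ℂ 2 (volume : Measure X)

/-- Multiplication by the indicator function of `B`. -/
def mulIndicatorFun {X : Type*} [MeasureSpace X] (B : Set X) (hB : MeasurableSet B)
    (f : HilbertL2 X) : HilbertL2 X :=
  MemLp.toLp (B.indicator f) ((Lp.memLp f).indicator hB)

theorem mulIndicatorFun_coeFn {X : Type*} [MeasureSpace X] (B : Set X) (hB : MeasurableSet B)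
    (f : HilbertL2 X) : (mulIndicatorFun B hB f : X → ℂ) =ᵐ[volume] B.indicator (f : X → ℂ) := by
  unfold mulIndicatorFun
  exact MemLp.coeFn_toLp _

/-- Multiplication by the indicator function of `B`, as a bounded operator. -/
def mulIndicator {X : Type*} [MeasureSpace X] (B : Set X) (hB : MeasurableSet B) :
    HilbertL2 X →L[ℂ] HilbertL2 X :=
  LinearMap.mkContinuous
    { toFun := mulIndicatorFun B hB
      map_add' := fun f g => by
        refine Lp.ext ?_
        filter_upwards [mulIndicatorFun_coeFn B hB (f + g), mulIndicatorFun_coeFn B hB f,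
          mulIndicatorFun_coeFn B hB g, Lp.coeFn_add f g,
          Lp.coeFn_add (mulIndicatorFun B hB f) (mulIndicatorFun B hB g)] with x h1 h2 h3 h4 h5
        rw [h5, Pi.add_apply, h1, h2, h3]
        by_cases h : x ∈ B
        · rw [Set.indicator_of_mem h, Set.indicator_of_mem h, Set.indicator_of_mem h, h4,
            Pi.add_apply]
        · rw [Set.indicator_of_notMem h, Set.indicator_of_notMem h, Set.indicator_of_notMem h,
            add_zero]
      map_smul' := fun c f => by
        refine Lp.ext ?_
        filter_upwards [mulIndicatorFun_coeFn B hB (c • f), mulIndicatorFun_coeFn B hB f,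
          Lp.coeFn_smul c f, Lp.coeFn_smul c (mulIndicatorFun B hB f)] with x h1 h2 h3 h4
        rw [RingHom.id_apply, h4, Pi.smul_apply, h1, h2]
        by_cases h : x ∈ B
        · rw [Set.indicator_of_mem h, Set.indicator_of_mem h, h3, Pi.smul_apply]
        · rw [Set.indicator_of_notMem h, Set.indicator_of_notMem h, smul_zero] } 1 (fun f => by
    rw [one_mul]
    refine Lp.norm_le_norm_of_ae_le ?_
    filter_upwards [mulIndicatorFun_coeFn B hB f] with x hx
    rw [LinearMap.coe_mk, AddHom.coe_mk, hx]
    exact norm_indicator_le_norm_self _ _)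

theorem mulIndicator_coeFn {X : Type*} [MeasureSpace X] (B : Set X) (hB : MeasurableSet B)
    (f : HilbertL2 X) : mulIndicator B hB f =ᵐ[volume] B.indicator f :=
  mulIndicatorFun_coeFn B hB f

theorem inner_mulIndicator {X : Type*} [MeasureSpace X] (B : Set X) (hB : MeasurableSet B)
    (f g : HilbertL2 X) : ⟪f, mulIndicator B hB g⟫_ℂ = ∫ x in B, ⟪f x, g x⟫_ℂ := by
  rw [L2.inner_def, ← integral_indicator hB]
  refine integral_congr_ae ?_
  filter_upwards [mulIndicator_coeFn B hB g] with x hx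
  rw [hx]
  by_cases h : x ∈ B <;> simp [h]

open scoped Classical in
/-- The projection valued measure on `L²(X)` that sends `B` to multiplication by the indicator
function of `B`. -/
def indicatorPVM (X : Type*) [MeasureSpace X] : POVM X (HilbertL2 X) where
  op B := if hB : MeasurableSet B then mulIndicator B hB else 0
  isPositive B hB := by
    rw [dif_pos hB]
    rw [ContinuousLinearMap.isPositive_iff_complex]
    intro f
    rw [← inner_conj_symm, inner_mulIndicator]
    have h : ∫ x in B, ⟪f x, f x⟫_ℂ = ((∫ x in B, ‖f x‖ ^ 2 : ℝ) : ℂ) := by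
      rw [← integral_complex_ofReal]
      refine integral_congr_ae (ae_of_all _ fun x => ?_)
      simp [inner_self_eq_norm_sq_to_K]
    rw [h, Complex.conj_ofReal]
    rw [RCLike.re_to_complex, Complex.ofReal_re]
    exact ⟨rfl, by positivity⟩
  op_empty := by
    rw [dif_pos MeasurableSet.empty]
    refine ContinuousLinearMap.ext fun f => Lp.ext ?_
    filter_upwards [mulIndicator_coeFn ∅ MeasurableSet.empty f, Lp.coeFn_zero ℂ 2 volume]
      with x hx h0
    rw [hx, Set.indicator_empty, zero_apply, h0, Pi.zero_apply]
  op_univ := by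
    rw [dif_pos MeasurableSet.univ]
    refine ContinuousLinearMap.ext fun f => Lp.ext ?_
    filter_upwards [mulIndicator_coeFn Set.univ MeasurableSet.univ f] with x hx
    rw [hx]
    simp
  hasSum_inner B hB hd f g := by
    simp only [dif_pos (MeasurableSet.iUnion hB), dif_pos (hB _), inner_mulIndicator]
    exact hasSum_integral_iUnion hB hd (L2.integrable_inner f g).integrableOn

/-- The spectral measure `E(Q)` of the position operator `Q`, the operator of multiplication by the
coordinate `x` on `L²(ℝ)`. -/
def positionPVM : POVM ℝ (HilbertL2 ℝ) := indicatorPVM ℝ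

/-- The measurement of the position on each of `n` systems, with outcome in `ℝⁿ`. -/
def jointPositionPVM (n : ℕ) : POVM (Fin n → ℝ) (HilbertL2 (Fin n → ℝ)) := indicatorPVM (Fin n → ℝ)

theorem memLp_tensorVec {n : ℕ} (ψ : Fin n → HilbertL2 ℝ) :
    MemLp (fun x : Fin n → ℝ => ∏ i, ψ i (x i)) 2 volume := by
  have hm : AEStronglyMeasurable (fun x : Fin n → ℝ => ∏ i, ψ i (x i)) volume := by
    refine (Finset.stronglyMeasurable_fun_prod _ fun i _ => ?_).aestronglyMeasurable
    exact (Lp.stronglyMeasurable (ψ i)).comp_measurable (measurable_pi_apply i)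
  rw [memLp_two_iff_integrable_sq_norm hm]
  simp only [norm_prod, ← Finset.prod_pow]
  exact Integrable.fintype_prod (f := fun i x => ‖ψ i x‖ ^ 2) fun i =>
    (memLp_two_iff_integrable_sq_norm (Lp.aestronglyMeasurable (ψ i))).1 (Lp.memLp (ψ i))

/-- The product vector `ψ₁ ⊗ ⋯ ⊗ ψₙ`, as the function `∏ i, ψ i (x i)` in `L²(ℝⁿ)`. -/
def tensorVec {n : ℕ} (ψ : Fin n → HilbertL2 ℝ) : HilbertL2 (Fin n → ℝ) := (memLp_tensorVec ψ).toLp _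

theorem tensorVec_coeFn {n : ℕ} (ψ : Fin n → HilbertL2 ℝ) :
    tensorVec ψ =ᵐ[volume] fun x => ∏ i, ψ i (x i) := MemLp.coeFn_toLp (memLp_tensorVec ψ)

theorem inner_tensorVec {n : ℕ} (φ ψ : Fin n → HilbertL2 ℝ) :
    ⟪tensorVec φ, tensorVec ψ⟫_ℂ = ∏ i, ⟪φ i, ψ i⟫_ℂ := by
  simp only [L2.inner_def]
  rw [← integral_fintype_prod_volume_eq_prod (fun i x => ⟪φ i x, ψ i x⟫_ℂ)]
  refine integral_congr_ae ?_
  filter_upwards [tensorVec_coeFn φ, tensorVec_coeFn ψ] with x h1 h2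
  rw [h1, h2]
  simp [RCLike.inner_apply, Finset.prod_mul_distrib]

theorem ae_coord {n : ℕ} {p : Fin n → ℝ → Prop} (h : ∀ i, ∀ᵐ x, p i x) :
    ∀ᵐ x : Fin n → ℝ, ∀ i, p i (x i) :=
  ae_all_iff.2 fun i =>
    (Measure.quasiMeasurePreserving_eval (fun _ : Fin n => (volume : Measure ℝ)) i).ae (h i)

/-- The joint position measurement is the product of the individual position measurements. -/
theorem jointPositionPVM_box {n : ℕ} (B : Fin n → Set ℝ) (hB : ∀ i, MeasurableSet (B i))
    (ψ : Fin n → HilbertL2 ℝ) :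
    (jointPositionPVM n).op (Set.univ.pi B) (tensorVec ψ) =
      tensorVec fun i => positionPVM.op (B i) (ψ i) := by
  have hpi : MeasurableSet (Set.univ.pi B) := MeasurableSet.univ_pi hB
  have e1 : (jointPositionPVM n).op (Set.univ.pi B) = mulIndicator _ hpi := dif_pos hpi
  have e2 : ∀ i, positionPVM.op (B i) = mulIndicator _ (hB i) := fun i => dif_pos (hB i)
  simp only [e1, e2]
  refine Lp.ext ?_
  filter_upwards [mulIndicator_coeFn _ hpi (tensorVec ψ), tensorVec_coeFn ψ,
    tensorVec_coeFn (fun i => mulIndicator _ (hB i) (ψ i)),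
    ae_coord fun i => mulIndicator_coeFn _ (hB i) (ψ i)] with x h1 h2 h3 h4
  rw [h1, h3]
  simp only [h4]
  by_cases h : x ∈ Set.univ.pi B
  · rw [Set.indicator_of_mem h, h2]
    exact Finset.prod_congr rfl fun i _ => (Set.indicator_of_mem (h i trivial) _).symm
  · rw [Set.indicator_of_notMem h]
    obtain ⟨i, hi⟩ : ∃ i, x i ∉ B i := by simpa [Set.mem_pi] using h
    exact (Finset.prod_eq_zero (Finset.mem_univ i) (Set.indicator_of_notMem hi _)).symm

/-- Product vectors span a dense subspace of `L²(ℝⁿ)`: only `0` is orthogonal to all of them. -/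
theorem eq_zero_of_inner_tensorVec {n : ℕ} (f : HilbertL2 (Fin n → ℝ))
    (hf : ∀ ψ : Fin n → HilbertL2 ℝ, ⟪tensorVec ψ, f⟫_ℂ = 0) : f = 0 := by
  have hbox : ∀ B : Fin n → Set ℝ, (∀ i, MeasurableSet (B i)) → (∀ i, volume (B i) ≠ ⊤) →
      ∫ x in Set.univ.pi B, (f : (Fin n → ℝ) → ℂ) x = 0 := by
    intro B hB hv
    have h := hf fun i => indicatorConstLp 2 (hB i) (hv i) (1 : ℂ)
    rw [L2.inner_def] at h
    rw [← h, ← integral_indicator (MeasurableSet.univ_pi hB)]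
    refine integral_congr_ae ?_
    filter_upwards [tensorVec_coeFn fun i => indicatorConstLp 2 (hB i) (hv i) (1 : ℂ),
      ae_coord fun i => indicatorConstLp_coeFn (p := 2) (hs := hB i) (hμs := hv i) (c := (1 : ℂ))]
      with x h1 h2
    rw [h1]
    simp only [h2]
    by_cases hx : x ∈ Set.univ.pi B
    · rw [Set.indicator_of_mem hx, Finset.prod_congr rfl fun i _ =>
        Set.indicator_of_mem (hx i trivial) (fun _ => (1 : ℂ))]
      simp
    · obtain ⟨i, hi⟩ : ∃ i, x i ∉ B i := by simpa [Set.mem_pi] using hx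
      rw [Set.indicator_of_notMem hx, Finset.prod_eq_zero (Finset.mem_univ i)
        (Set.indicator_of_notMem hi _)]
      simp
  let C : ℕ → Set (Fin n → ℝ) := fun k => Set.univ.pi fun _ => Set.Icc (-(k : ℝ)) k
  have hC : ∀ k, MeasurableSet (C k) := fun k => MeasurableSet.univ_pi fun _ => measurableSet_Icc
  have hCf : ∀ k, volume (C k) ≠ ⊤ := fun k => by
    rw [volume_pi_pi]
    exact ENNReal.prod_ne_top fun _ _ => measure_Icc_lt_top.ne
  have hint : ∀ k, Integrable f (volume.restrict (C k)) := fun k => by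
    have : IsFiniteMeasure (volume.restrict (C k)) :=
      ⟨by simpa using (hCf k).lt_top⟩
    exact ((Lp.memLp f).restrict (C k)).integrable (by norm_num)
  have key : ∀ k, ∀ s, MeasurableSet s →
      ∫ x in s, (f : (Fin n → ℝ) → ℂ) x ∂(volume.restrict (C k)) = 0 := by
    intro k s hs
    have hbox' : ∀ B : Fin n → Set ℝ, (∀ i, MeasurableSet (B i)) →
        ∫ x in Set.univ.pi B, (f : (Fin n → ℝ) → ℂ) x ∂(volume.restrict (C k)) = 0 := by
      intro B hB
      rw [Measure.restrict_restrict (MeasurableSet.univ_pi hB), ← Set.pi_inter_distrib]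
      refine hbox _ (fun i => (hB i).inter measurableSet_Icc) fun i => ?_
      exact ne_top_of_le_ne_top measure_Icc_lt_top.ne (measure_mono Set.inter_subset_right)
    have huniv : ∫ x, (f : (Fin n → ℝ) → ℂ) x ∂(volume.restrict (C k)) = 0 := by
      have := hbox' (fun _ => Set.univ) fun _ => MeasurableSet.univ
      simpa using this
    induction s, hs using MeasurableSpace.induction_on_inter
      (generateFrom_pi (ι := Fin n) (α := fun _ => ℝ)).symm isPiSystem_pi with
    | empty => simp
    | basic t ht =>
      obtain ⟨B, hB, rfl⟩ := ht
      exact hbox' B fun i => hB i trivial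
    | compl t ht ih =>
      have := integral_add_compl ht (hint k)
      rw [ih, huniv, zero_add] at this
      exact this
    | iUnion t hd ht ih =>
      rw [integral_iUnion ht hd (hint k).integrableOn]
      simp [ih]
  have hae : ∀ k, ∀ᵐ x ∂(volume.restrict (C k)), (f : (Fin n → ℝ) → ℂ) x = 0 := fun k =>
    Integrable.ae_eq_zero_of_forall_setIntegral_eq_zero (hint k) fun s hs _ => key k s hs
  have hU : ⋃ k, C k = Set.univ := by
    refine Set.eq_univ_of_forall fun x => ?_
    obtain ⟨k, hk⟩ := exists_nat_ge ‖x‖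
    refine Set.mem_iUnion.2 ⟨k, fun i _ => ?_⟩
    exact abs_le.1 ((norm_le_pi_norm x i).trans hk)
  have : ∀ᵐ x, (f : (Fin n → ℝ) → ℂ) x = 0 := by
    have h := (ae_restrict_iUnion_iff C fun x => (f : (Fin n → ℝ) → ℂ) x = 0).2 hae
    rwa [hU, Measure.restrict_univ] at h
  refine Lp.ext ?_
  filter_upwards [this, Lp.coeFn_zero ℂ 2 (volume : Measure (Fin n → ℝ))] with x h1 h2
  rw [h1, h2, Pi.zero_apply]

theorem inner_sum_smul_sum_smul {H ι : Type*} [NormedAddCommGroup H] [InnerProductSpace ℂ H]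
    [Fintype ι] (x : ι → ℂ) (v : ι → H) :
    ⟪∑ j, x j • v j, ∑ k, x k • v k⟫_ℂ = ∑ j, ∑ k, star (x j) * ⟪v j, v k⟫_ℂ * x k := by
  rw [sum_inner]
  refine Finset.sum_congr rfl fun j _ => ?_
  rw [inner_sum]
  refine Finset.sum_congr rfl fun k _ => ?_
  rw [inner_smul_left, inner_smul_right]
  simp only [RCLike.star_def]
  ring

open scoped ComplexOrder in
theorem quadratic_nonneg {ι : Type*} [Fintype ι] {M : Matrix ι ι ℂ} (hM : M.PosSemidef)
    (x : ι → ℂ) : 0 ≤ ∑ j, ∑ k, star (x j) * M j k * x k := by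
  have h := hM.dotProduct_mulVec_nonneg x
  simpa [dotProduct, Matrix.mulVec, Finset.mul_sum, mul_assoc] using h

open scoped ComplexOrder in
theorem posSemidef_smul_gram_sub {H ι : Type*} [NormedAddCommGroup H] [InnerProductSpace ℂ H]
    [Fintype ι] (A : H →L[ℂ] H) (v : ι → H) :
    ((Matrix.of fun j k => ((‖A‖ ^ 2 : ℝ) : ℂ) * ⟪v j, v k⟫_ℂ) -
      Matrix.of fun j k => ⟪A (v j), A (v k)⟫_ℂ).PosSemidef := by
  refine Matrix.PosSemidef.of_dotProduct_mulVec_nonneg ?_ fun x => ?_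
  · ext j k
    simp [Matrix.conjTranspose_apply]
  · have e : star x ⬝ᵥ ((Matrix.of fun j k => ((‖A‖ ^ 2 : ℝ) : ℂ) * ⟪v j, v k⟫_ℂ) -
        Matrix.of fun j k => ⟪A (v j), A (v k)⟫_ℂ).mulVec x =
        ((‖A‖ ^ 2 * ‖∑ j, x j • v j‖ ^ 2 - ‖A (∑ j, x j • v j)‖ ^ 2 : ℝ) : ℂ) := by
      have h1 := inner_sum_smul_sum_smul x v
      have h2 := inner_sum_smul_sum_smul x fun j => A (v j)
      have h3 : A (∑ j, x j • v j) = ∑ j, x j • A (v j) := by simp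
      rw [inner_self_eq_norm_sq_to_K] at h1 h2
      rw [h3]
      push_cast
      simp only [Complex.coe_algebraMap] at h1 h2
      rw [h1, h2]
      simp only [dotProduct, Matrix.mulVec, Finset.mul_sum, Matrix.sub_apply, Matrix.of_apply,
        Pi.star_apply]
      rw [← Finset.sum_sub_distrib]
      refine Finset.sum_congr rfl fun j _ => ?_
      rw [← Finset.sum_sub_distrib]
      refine Finset.sum_congr rfl fun k _ => ?_
      ring
    rw [e]
    refine Complex.zero_le_real.2 (sub_nonneg.2 ?_)
    rw [← mul_pow]
    gcongr
    exact A.le_opNorm _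

open scoped ComplexOrder in
theorem posSemidef_prod {ι κ : Type*} [Fintype ι] (G B : κ → Matrix ι ι ℂ)
    (hB : ∀ i, (B i).PosSemidef) (hD : ∀ i, (G i - B i).PosSemidef) (S : Finset κ) :
    (Matrix.of fun j k => ∏ i ∈ S, G i j k).PosSemidef ∧
    (Matrix.of fun j k => ∏ i ∈ S, G i j k - ∏ i ∈ S, B i j k).PosSemidef := by
  classical
  induction S using Finset.induction_on with
  | empty =>
    simp only [Finset.prod_empty, sub_self]
    refine ⟨?_, Matrix.PosSemidef.zero⟩
    have := Matrix.posSemidef_vecMulVec_self_star (fun _ : ι => (1 : ℂ))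
    convert this using 1
    ext i j
    simp [Matrix.vecMulVec_apply]
  | insert a S ha ih =>
    have hG : (G a).PosSemidef := by simpa using (hD a).add (hB a)
    have e1 : (Matrix.of fun j k => ∏ i ∈ insert a S, G i j k) =
        (G a).hadamard (Matrix.of fun j k => ∏ i ∈ S, G i j k) := by
      ext j k
      simp [Finset.prod_insert ha]
    have e2 : (Matrix.of fun j k => ∏ i ∈ insert a S, G i j k - ∏ i ∈ insert a S, B i j k) =
        (G a - B a).hadamard (Matrix.of fun j k => ∏ i ∈ S, G i j k) +
          (B a).hadamard (Matrix.of fun j k => ∏ i ∈ S, G i j k - ∏ i ∈ S, B i j k) := by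
      ext j k
      simp only [Matrix.of_apply, Finset.prod_insert ha, Matrix.add_apply, Matrix.hadamard_apply,
        Matrix.sub_apply]
      ring
    rw [e1, e2]
    exact ⟨hG.hadamard ih.1, ((hD a).hadamard ih.1).add ((hB a).hadamard ih.2)⟩

theorem norm_sum_tensorVec_le {n : ℕ} (A : HilbertL2 ℝ →L[ℂ] HilbertL2 ℝ) {ι : Type*} [Fintype ι]
    (x : ι → ℂ) (v : ι → Fin n → HilbertL2 ℝ) :
    ‖∑ j, x j • tensorVec fun i => A (v j i)‖ ≤ ‖A‖ ^ n * ‖∑ j, x j • tensorVec (v j)‖ := by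
  have h := quadratic_nonneg (posSemidef_prod
    (fun i : Fin n => Matrix.of fun j k => ((‖A‖ ^ 2 : ℝ) : ℂ) * ⟪v j i, v k i⟫_ℂ)
    (fun i : Fin n => Matrix.of fun j k => ⟪A (v j i), A (v k i)⟫_ℂ)
    (fun i => Matrix.posSemidef_gram ℂ fun j => A (v j i))
    (fun i => posSemidef_smul_gram_sub A fun j => v j i) Finset.univ).2 x
  have h1 := inner_sum_smul_sum_smul x fun j => tensorVec (v j)
  have h2 := inner_sum_smul_sum_smul x fun j => tensorVec fun i => A (v j i)
  simp only [inner_tensorVec, inner_self_eq_norm_sq_to_K, Complex.coe_algebraMap] at h1 h2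
  have e : ∑ j, ∑ k, star (x j) * (Matrix.of fun j k =>
      ∏ i : Fin n, (Matrix.of fun j k => ((‖A‖ ^ 2 : ℝ) : ℂ) * ⟪v j i, v k i⟫_ℂ) j k -
      ∏ i : Fin n, (Matrix.of fun j k => ⟪A (v j i), A (v k i)⟫_ℂ) j k) j k * x k =
      (((‖A‖ ^ n * ‖∑ j, x j • tensorVec (v j)‖) ^ 2 -
        ‖∑ j, x j • tensorVec fun i => A (v j i)‖ ^ 2 : ℝ) : ℂ) := by
    push_cast
    rw [mul_pow, h1, h2, Finset.mul_sum, ← Finset.sum_sub_distrib]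
    refine Finset.sum_congr rfl fun j _ => ?_
    rw [Finset.mul_sum, ← Finset.sum_sub_distrib]
    refine Finset.sum_congr rfl fun k _ => ?_
    simp only [Matrix.of_apply, Finset.prod_mul_distrib, Finset.prod_const, Finset.card_univ,
      Fintype.card_fin]
    ring
  rw [e, Complex.zero_le_real, sub_nonneg] at h
  exact le_of_sq_le_sq h (by positivity)

/-- The tensor power `A^{⊗ n}` of a bounded operator `A` on `L²(ℝ)`, as the continuous extension to
`L²(ℝⁿ)` of the map `∑ cⱼ ψ₁ⱼ ⊗ ⋯ ⊗ ψₙⱼ ↦ ∑ cⱼ Aψ₁ⱼ ⊗ ⋯ ⊗ Aψₙⱼ`. -/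
def tensorPower (A : HilbertL2 ℝ →L[ℂ] HilbertL2 ℝ) (n : ℕ) :
    HilbertL2 (Fin n → ℝ) →L[ℂ] HilbertL2 (Fin n → ℝ) :=
  (Finsupp.linearCombination ℂ fun ψ : Fin n → HilbertL2 ℝ =>
      tensorVec fun i => A (ψ i)).extendOfNorm
    (Finsupp.linearCombination ℂ (tensorVec (n := n)))

theorem denseRange_linearCombination_tensorVec (n : ℕ) :
    DenseRange (Finsupp.linearCombination ℂ (tensorVec (n := n))) := by
  have h : (Submodule.span ℂ (Set.range (tensorVec (n := n)))).topologicalClosure = ⊤ := by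
    rw [Submodule.topologicalClosure_eq_top_iff, Submodule.eq_bot_iff]
    intro f hf
    refine eq_zero_of_inner_tensorVec f fun ψ => ?_
    exact (Submodule.mem_orthogonal _ _).1 hf _ (Submodule.subset_span ⟨ψ, rfl⟩)
  rw [DenseRange, ← LinearMap.coe_range, Finsupp.range_linearCombination]
  exact Submodule.dense_iff_topologicalClosure_eq_top.2 h

/-- `A^{⊗ n}` is well defined: it maps `ψ₁ ⊗ ⋯ ⊗ ψₙ` to `Aψ₁ ⊗ ⋯ ⊗ Aψₙ`. -/
theorem tensorPower_tensorVec (A : HilbertL2 ℝ →L[ℂ] HilbertL2 ℝ) {n : ℕ}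
    (ψ : Fin n → HilbertL2 ℝ) :
    tensorPower A n (tensorVec ψ) = tensorVec fun i => A (ψ i) := by
  have h := LinearMap.extendOfNorm_eq
    (f := Finsupp.linearCombination ℂ fun ψ : Fin n → HilbertL2 ℝ => tensorVec fun i => A (ψ i))
    (denseRange_linearCombination_tensorVec n)
    ⟨‖A‖ ^ n, fun x => by
      have := norm_sum_tensorVec_le A (fun j : x.support => x j) (fun j : x.support => (j : Fin n → HilbertL2 ℝ))
      rw [Finset.sum_coe_sort x.support fun ψ => x ψ • tensorVec fun i => A (ψ i),
        Finset.sum_coe_sort x.support fun ψ => x ψ • tensorVec ψ] at this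
      rwa [Finsupp.linearCombination_apply, Finsupp.linearCombination_apply]⟩
    (Finsupp.single ψ 1)
  rw [Finsupp.linearCombination_single, Finsupp.linearCombination_single, one_smul, one_smul] at h
  exact h

/-! ## Quantum Gaussian states -/

/-- The Hermite function `(2/π)^{1/4} (k!)^{-1/2} He_k(2x) e^{-x²}`, with `He_k` the probabilists'
Hermite polynomial. These are the normalized eigenfunctions of the number operator `a* a` for
`a = x + (1/2) d/dx`, so that the position is `x = (a + a*) / 2`. -/
def hermiteFun (k : ℕ) (x : ℝ) : ℂ :=
  (((2 / Real.pi) ^ (1 / 4 : ℝ) / √(k.factorial : ℝ) *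
    Polynomial.aeval (2 * x) (Polynomial.hermite k) * Real.exp (-x ^ 2) : ℝ) : ℂ)

theorem integrable_eval_mul_exp (p : Polynomial ℝ) :
    Integrable (fun x : ℝ => p.eval x * Real.exp (-2 * x ^ 2)) volume := by
  induction p using Polynomial.induction_on' with
  | add p q hp hq =>
    simp only [Polynomial.eval_add, add_mul]
    exact hp.add hq
  | monomial m c =>
    simp only [Polynomial.eval_monomial, mul_assoc]
    have h := integrable_rpow_mul_exp_neg_mul_sq (b := 2) (by norm_num) (s := (m : ℝ))
      (by have : (0 : ℝ) ≤ m := m.cast_nonneg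
          linarith)
    simp only [Real.rpow_natCast] at h
    exact h.const_mul c

theorem memLp_hermiteFun (k : ℕ) : MemLp (hermiteFun k) 2 volume := by
  have hc : Continuous (hermiteFun k) := by
    unfold hermiteFun
    simp only [Polynomial.aeval_def, Polynomial.eval₂_eq_eval_map]
    fun_prop
  rw [memLp_two_iff_integrable_sq_norm hc.aestronglyMeasurable]
  have h := integrable_eval_mul_exp
    ((Polynomial.C ((2 / Real.pi) ^ (1 / 4 : ℝ) / √(k.factorial : ℝ)) *
      ((Polynomial.hermite k).map (algebraMap ℤ ℝ)).comp
        (Polynomial.C 2 * Polynomial.X)) ^ 2)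
  refine h.congr (ae_of_all _ fun x => ?_)
  have e : Real.exp (-2 * x ^ 2) = Real.exp (-x ^ 2) ^ 2 := by
    rw [← Real.exp_nat_mul]
    congr 1
    push_cast
    ring
  simp only [hermiteFun, Complex.norm_real, Real.norm_eq_abs, sq_abs, e, Polynomial.eval_pow,
    Polynomial.eval_mul, Polynomial.eval_C, Polynomial.eval_comp, Polynomial.eval_X,
    Polynomial.aeval_def, Polynomial.eval₂_eq_eval_map]
  ring

/-- The number vector `|k⟩` in `L²(ℝ)`. -/
def numberVec (k : ℕ) : HilbertL2 ℝ := (memLp_hermiteFun k).toLp _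

/-- The coherent vector `|α⟩ = e^{-|α|²/2} ∑ₖ αᵏ / √(k!) |k⟩`. -/
def coherentVec (α : ℂ) : HilbertL2 ℝ :=
  (Real.exp (-‖α‖ ^ 2 / 2) : ℂ) • ∑' k : ℕ, (α ^ k / (√(k.factorial : ℝ) : ℂ)) • numberVec k

/-- The quantum Gaussian state
`ρ_θ = (1 / (π N)) ∫ |α⟩⟨α| e^{-|α - θ|² / N} d²α`, for `θ ∈ ℂ` and mean photon number `N`. -/
def gaussianState (N : ℝ) (θ : ℂ) : HilbertL2 ℝ →L[ℂ] HilbertL2 ℝ :=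
  ((1 / (Real.pi * N) : ℝ) : ℂ) • ∫ α : ℂ, (Real.exp (-‖α - θ‖ ^ 2 / N) : ℂ) •
    InnerProductSpace.rankOne ℂ (coherentVec α) (coherentVec α)

/-! ## Sequences of estimators and their large deviation rates -/

/-- A sequence of estimators for a family of states on `L²(ℝ)`: for each `n` a measurement on
`L²(ℝ)^{⊗ n}` whose outcome, the estimate, is a real number. -/
abbrev EstimatorSeq : Type := (n : ℕ) → POVM ℝ (HilbertL2 (Fin n → ℝ))

/-- The tail probability `P_θ^{Mⁿ} {|θ̂ - θ| > ε}` for `n` copies of the state `ρ θ`. -/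
def tailProb (ρ : ℝ → HilbertL2 ℝ →L[ℂ] HilbertL2 ℝ) (M : EstimatorSeq) (θ ε : ℝ) (n : ℕ) : ℝ :=
  measureProb (tensorPower (ρ θ) n) (M n) {x | ε < |x - θ|}

/-- The exponent `-(1/n) log P_θ^{Mⁿ} {|θ̂ - θ| > ε}`, with `log 0 = -∞`. -/
def tailExponent (ρ : ℝ → HilbertL2 ℝ →L[ℂ] HilbertL2 ℝ) (M : EstimatorSeq) (θ ε : ℝ) (n : ℕ) :
    EReal :=
  -ENNReal.log (ENNReal.ofReal (tailProb ρ M θ ε n)) / (n : EReal)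

/-- The rate `β`, with the upper limit over `n`. -/
def betaUpper (ρ : ℝ → HilbertL2 ℝ →L[ℂ] HilbertL2 ℝ) (M : EstimatorSeq) (θ ε : ℝ) : EReal :=
  limsup (fun n => tailExponent ρ M θ ε n) atTop

/-- The rate `β` with the lower limit over `n`. -/
def betaLower (ρ : ℝ → HilbertL2 ℝ →L[ℂ] HilbertL2 ℝ) (M : EstimatorSeq) (θ ε : ℝ) : EReal :=
  liminf (fun n => tailExponent ρ M θ ε n) atTop

/-- `α(M, θ) = limsup_{ε → 0} β(M, θ, ε) / ε²`. -/
def alphaUpper (ρ : ℝ → HilbertL2 ℝ →L[ℂ] HilbertL2 ℝ) (M : EstimatorSeq) (θ : ℝ) : EReal :=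
  limsup (fun ε : ℝ => betaUpper ρ M θ ε / ((ε ^ 2 : ℝ) : EReal)) (𝓝[>] 0)

/-- `α(M, θ)` with lower limits: `liminf_{ε → 0} β(M, θ, ε) / ε²`, with the lower `β`. -/
def alphaLower (ρ : ℝ → HilbertL2 ℝ →L[ℂ] HilbertL2 ℝ) (M : EstimatorSeq) (θ : ℝ) : EReal :=
  liminf (fun ε : ℝ => betaLower ρ M θ ε / ((ε ^ 2 : ℝ) : EReal)) (𝓝[>] 0)

/-- Strong consistency on the parameter set `Θ`: the lower rate `α` is a (finite) continuous
function of the parameter, and (lower) `β(M, θ, ε) / ε²` converges to it, uniformly in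
`θ ∈ Θ`, as `ε → 0`. -/
def StronglyConsistentOn (ρ : ℝ → HilbertL2 ℝ →L[ℂ] HilbertL2 ℝ) (M : EstimatorSeq) (Θ : Set ℝ) :
    Prop :=
  ∃ a : ℝ → ℝ, ContinuousOn a Θ ∧ (∀ θ ∈ Θ, alphaLower ρ M θ = (a θ : EReal)) ∧
    ∀ η > 0, ∃ δ > 0, ∀ ε : ℝ, 0 < ε → ε < δ → ∀ θ ∈ Θ,
      ((a θ - η : ℝ) : EReal) ≤ betaLower ρ M θ ε / ((ε ^ 2 : ℝ) : EReal) ∧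
        betaLower ρ M θ ε / ((ε ^ 2 : ℝ) : EReal) ≤ ((a θ + η : ℝ) : EReal)

/-- The arithmetic mean of the data. -/
def sampleMean (n : ℕ) (x : Fin n → ℝ) : ℝ := (∑ i, x i) / n

theorem measurable_sampleMean (n : ℕ) : Measurable (sampleMean n) :=
  (Finset.measurable_fun_sum _ fun i _ => measurable_pi_apply i).div_const _

/-- The estimator that measures the position of each of the `n` systems and estimates `θ` by the
mean of the `n` data. -/
def positionMeanEstimator : EstimatorSeq :=
  fun n => (jointPositionPVM n).map (sampleMean n) (measurable_sampleMean n)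

end

/-! A coherent state has Gaussian position density with mean `Re α` and variance 1/4. The state ρ_θ
mixes coherent states over a Gaussian amplitude whose real part has mean θ and variance N/2.
Position measured on ρ_θ is therefore normal with mean θ and variance (N + 1/2)/2, and the mean of n
independent outcomes is normal with that variance divided by n. Its tail exponent is exactly ε²/(N +
1/2), so β/ε² does not depend on ε or θ, and the limits, continuity and uniformity cost nothing.
This half rests on `lintegral_norm_coherentFun_sq`, `tensorPower_mixedState`,
`measureProb_jointPosition` and `tendsto_gaussianReal_tail_exponent`.

For the Fisher information, the operator L = κ(Q − θ) with κ = 2/(N + 1/2) is an SLD. Between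
coherent vectors both sides of the SLD equation become Gaussian integrals over the amplitude, and
their difference is the integral of a derivative in `Re α` (`integral_symmetrized_eq`). Then Tr L²ρ
is κ² times the position variance, that is κ, and J/2 is the rate found above.

Since Q is unbounded, three points need care. Self-adjointness is proved for multiplication
operators in general (`isSelfAdjoint_mulPMap`). The range of √ρ lies in the domain of Q because √ρ(Q
− θ) is bounded, which needs only ‖√ρ f‖² = ⟨f, ρ f⟩ and no formula for √ρ. Independence of the
choice of SLD follows from injectivity of ρ: for two SLDs, the difference of L√ρ and L'√ρ
anticommutes with ρ, hence commutes with ρ² and with its root ρ, and so vanishes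
(`eq_zero_of_mul_sqrt_add`). -/

noncomputable section

/-! ## Number vectors -/

/-- The probabilists' Hermite polynomial with the argument `2 x`. -/
def hermiteTwo (k : ℕ) : Polynomial ℝ :=
  ((Polynomial.hermite k).map (algebraMap ℤ ℝ)).comp (Polynomial.C 2 * Polynomial.X)

theorem eval_hermiteTwo (k : ℕ) (x : ℝ) :
    (hermiteTwo k).eval x = Polynomial.aeval (2 * x) (Polynomial.hermite k) := by
  simp [hermiteTwo, Polynomial.aeval_def, Polynomial.eval₂_eq_eval_map]

/-- This is He_{k+1} = X He_k − He_k' after the substitution; the factor 1/2 undoes the 2 from the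
chain rule. -/
theorem hermiteTwo_succ (k : ℕ) :
    hermiteTwo (k + 1) = Polynomial.C 2 * Polynomial.X * hermiteTwo k -
      Polynomial.C (1 / 2) * Polynomial.derivative (hermiteTwo k) := by
  have h : Polynomial.C (1 / 2 : ℝ) * Polynomial.C 2 = 1 := by
    rw [← Polynomial.C_mul]; norm_num
  rw [hermiteTwo, hermiteTwo, Polynomial.hermite_succ, Polynomial.derivative_comp]
  simp only [Polynomial.map_sub, Polynomial.map_mul, Polynomial.map_X, Polynomial.sub_comp,
    Polynomial.mul_comp, Polynomial.X_comp, Polynomial.derivative_mul, Polynomial.derivative_C,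
    Polynomial.derivative_X, Polynomial.derivative_map]
  linear_combination (((Polynomial.map (algebraMap ℤ ℝ)
    (Polynomial.derivative (Polynomial.hermite k))).comp (Polynomial.C 2 * Polynomial.X))) * h

theorem coeff_hermiteTwo_self (k : ℕ) : (hermiteTwo k).coeff k = 2 ^ k := by
  simp [hermiteTwo, Polynomial.comp_C_mul_X_coeff]

theorem natDegree_hermiteTwo_le (k : ℕ) : (hermiteTwo k).natDegree ≤ k := by
  refine Polynomial.natDegree_comp_le.trans ?_
  have h1 : (Polynomial.C (2 : ℝ) * Polynomial.X).natDegree ≤ 1 := by compute_degree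
  have h2 : ((Polynomial.hermite k).map (algebraMap ℤ ℝ)).natDegree ≤ k :=
    Polynomial.natDegree_map_le.trans Polynomial.natDegree_hermite.le
  calc _ ≤ k * 1 := Nat.mul_le_mul h2 h1
    _ = k := mul_one k

theorem iterate_derivative_hermiteTwo_self (k : ℕ) :
    Polynomial.derivative^[k] (hermiteTwo k) = Polynomial.C ((k.factorial : ℝ) * 2 ^ k) := by
  have h : (Polynomial.derivative^[k] (hermiteTwo k)).natDegree ≤ 0 := by
    have := Polynomial.natDegree_iterate_derivative (hermiteTwo k) k
    have := natDegree_hermiteTwo_le k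
    omega
  rw [Polynomial.eq_C_of_natDegree_le_zero h, Polynomial.coeff_iterate_derivative]
  simp [coeff_hermiteTwo_self, Nat.descFactorial_self]

/-- The weight contributes −4x, which together with the recurrence raises the index: the Rodrigues
formula in one-step form. -/
theorem hasDerivAt_hermiteTwo_mul_exp (k : ℕ) (x : ℝ) :
    HasDerivAt (fun x : ℝ => (hermiteTwo k).eval x * Real.exp (-2 * x ^ 2))
      (-2 * ((hermiteTwo (k + 1)).eval x * Real.exp (-2 * x ^ 2))) x := by
  have h1 := (hermiteTwo k).hasDerivAt x
  have h2 : HasDerivAt (fun x : ℝ => Real.exp (-2 * x ^ 2))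
      (Real.exp (-2 * x ^ 2) * (-2 * (2 * x))) x := by
    have := ((hasDerivAt_pow 2 x).const_mul (-2)).exp
    simpa using this
  refine (h1.mul h2).congr_deriv ?_
  rw [hermiteTwo_succ]
  simp only [Polynomial.eval_sub, Polynomial.eval_mul, Polynomial.eval_C, Polynomial.eval_X]
  ring

theorem integral_mul_hermiteTwo_succ (p : Polynomial ℝ) (k : ℕ) :
    ∫ x : ℝ, p.eval x * ((hermiteTwo (k + 1)).eval x * Real.exp (-2 * x ^ 2)) =
      1 / 2 * ∫ x : ℝ, (Polynomial.derivative p).eval x *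
        ((hermiteTwo k).eval x * Real.exp (-2 * x ^ 2)) := by
  have hint : ∀ q r : Polynomial ℝ,
      Integrable (fun x : ℝ => q.eval x * (r.eval x * Real.exp (-2 * x ^ 2))) := fun q r => by
    simpa [mul_assoc] using integrable_eval_mul_exp (q * r)
  have h := integral_mul_deriv_eq_deriv_mul_of_integrable
    (u := fun x : ℝ => p.eval x) (u' := fun x => (Polynomial.derivative p).eval x)
    (v := fun x : ℝ => (hermiteTwo k).eval x * Real.exp (-2 * x ^ 2))
    (v' := fun x => -2 * ((hermiteTwo (k + 1)).eval x * Real.exp (-2 * x ^ 2)))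
    (fun x _ => p.hasDerivAt x) (fun x _ => hasDerivAt_hermiteTwo_mul_exp k x)
    (((hint p (hermiteTwo (k + 1))).const_mul (-2)).congr
      (ae_of_all _ fun x => by simp only [Pi.mul_apply]; ring))
    (hint _ _) (hint _ _)
  have e : ∀ x : ℝ, p.eval x * (-2 * ((hermiteTwo (k + 1)).eval x * Real.exp (-2 * x ^ 2))) =
      -2 * (p.eval x * ((hermiteTwo (k + 1)).eval x * Real.exp (-2 * x ^ 2))) := fun x => by ring
  simp only [e] at h
  rw [integral_const_mul] at h
  linarith

/-- Integration by parts k times moves every derivative onto `p`. Orthogonality then follows by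
comparing degrees, and the norm from the leading coefficient. -/
theorem integral_mul_hermiteTwo (p : Polynomial ℝ) (k : ℕ) :
    ∫ x : ℝ, p.eval x * ((hermiteTwo k).eval x * Real.exp (-2 * x ^ 2)) =
      (1 / 2) ^ k * ∫ x : ℝ, (Polynomial.derivative^[k] p).eval x * Real.exp (-2 * x ^ 2) := by
  induction k generalizing p with
  | zero => simp [hermiteTwo]
  | succ k ih =>
    rw [integral_mul_hermiteTwo_succ, ih, Function.iterate_succ_apply, pow_succ]
    ring

theorem integral_hermiteTwo_mul_hermiteTwo_of_lt {j k : ℕ} (h : j < k) :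
    ∫ x : ℝ, (hermiteTwo j).eval x * ((hermiteTwo k).eval x * Real.exp (-2 * x ^ 2)) = 0 := by
  rw [integral_mul_hermiteTwo,
    Polynomial.iterate_derivative_eq_zero ((natDegree_hermiteTwo_le j).trans_lt h)]
  simp

theorem integral_hermiteTwo_mul_self (k : ℕ) :
    ∫ x : ℝ, (hermiteTwo k).eval x * ((hermiteTwo k).eval x * Real.exp (-2 * x ^ 2)) =
      k.factorial * √(Real.pi / 2) := by
  rw [integral_mul_hermiteTwo, iterate_derivative_hermiteTwo_self]
  simp only [Polynomial.eval_C]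
  have h : (1 / 2 : ℝ) ^ k * 2 ^ k = 1 := by rw [← mul_pow]; norm_num
  rw [integral_const_mul, integral_gaussian]
  linear_combination (k.factorial * √(Real.pi / 2)) * h

theorem hermiteFun_mul_hermiteFun (j k : ℕ) (x : ℝ) :
    starRingEnd ℂ (hermiteFun j x) * hermiteFun k x =
      ((√(2 / Real.pi) / (√(j.factorial : ℝ) * √(k.factorial : ℝ)) *
        ((hermiteTwo j).eval x * ((hermiteTwo k).eval x * Real.exp (-2 * x ^ 2))) : ℝ) : ℂ) := by
  have e : Real.exp (-2 * x ^ 2) = Real.exp (-x ^ 2) * Real.exp (-x ^ 2) := by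
    rw [← Real.exp_add]; congr 1; ring
  have e2 : √(2 / Real.pi) = (2 / Real.pi) ^ (1 / 4 : ℝ) * (2 / Real.pi) ^ (1 / 4 : ℝ) := by
    rw [← Real.rpow_add (by positivity), Real.sqrt_eq_rpow]; norm_num
  rw [hermiteFun, hermiteFun, Complex.conj_ofReal, ← Complex.ofReal_mul, e, e2]
  simp only [eval_hermiteTwo]
  congr 1
  field_simp

theorem orthonormal_numberVec : Orthonormal ℂ numberVec := by
  have key : ∀ j k, ⟪numberVec j, numberVec k⟫_ℂ =
      ((√(2 / Real.pi) / (√(j.factorial : ℝ) * √(k.factorial : ℝ)) *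
        ∫ x : ℝ, (hermiteTwo j).eval x * ((hermiteTwo k).eval x *
          Real.exp (-2 * x ^ 2)) : ℝ) : ℂ) := by
    intro j k
    rw [L2.inner_def, ← integral_const_mul, ← integral_complex_ofReal]
    refine integral_congr_ae ?_
    filter_upwards [(memLp_hermiteFun j).coeFn_toLp, (memLp_hermiteFun k).coeFn_toLp] with x h1 h2
    rw [numberVec, numberVec, h1, h2, RCLike.inner_apply', hermiteFun_mul_hermiteFun]
  rw [orthonormal_iff_ite]
  intro j k
  rw [key]
  rcases lt_trichotomy j k with h | rfl | h
  · rw [integral_hermiteTwo_mul_hermiteTwo_of_lt h, if_neg h.ne]; simp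
  · have : √(2 / Real.pi) * √(Real.pi / 2) = 1 := by
      rw [← Real.sqrt_mul (by positivity)]
      have : 2 / Real.pi * (Real.pi / 2) = 1 := by field_simp
      rw [this, Real.sqrt_one]
    have hj : (j.factorial : ℝ) ≠ 0 := by positivity
    rw [integral_hermiteTwo_mul_self, if_pos rfl, Real.mul_self_sqrt (by positivity),
      mul_left_comm, ← mul_assoc, mul_div_cancel₀ _ hj, this, Complex.ofReal_one]
  · have e : ∀ x : ℝ, (hermiteTwo j).eval x * ((hermiteTwo k).eval x * Real.exp (-2 * x ^ 2)) =
        (hermiteTwo k).eval x * ((hermiteTwo j).eval x * Real.exp (-2 * x ^ 2)) := fun x => by ring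
    simp only [e]
    rw [integral_hermiteTwo_mul_hermiteTwo_of_lt h, if_neg h.ne']; simp

/-! ## Coherent vectors -/

theorem iteratedDeriv_gaussian_eq_hermite_mul (n : ℕ) :
    iteratedDeriv n (fun z : ℂ => Complex.exp (-(z ^ 2 / 2))) = fun z =>
      (-1) ^ n * Polynomial.aeval z (Polynomial.hermite n) * Complex.exp (-(z ^ 2 / 2)) := by
  induction n with
  | zero =>
    funext z
    simp [iteratedDeriv_zero]
  | succ n ih =>
    rw [iteratedDeriv_succ, ih]
    funext z
    have h1 : HasDerivAt (fun z : ℂ => Complex.exp (-(z ^ 2 / 2)))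
        (Complex.exp (-(z ^ 2 / 2)) * -z) z := by
      refine ((((hasDerivAt_pow 2 z).div_const 2).fun_neg).cexp).congr_deriv ?_
      push_cast
      ring
    have h2 := (((Polynomial.hermite n).hasDerivAt_aeval z).const_mul ((-1 : ℂ) ^ n)).mul h1
    refine h2.deriv.trans ?_
    rw [Polynomial.hermite_succ, map_sub, map_mul, Polynomial.aeval_X, pow_succ]
    ring

/-- The generating function is the Taylor series of the entire function e^{-z²/2} about `y`,
evaluated at `y - t` and multiplied by e^{y²/2}. The signs of the Rodrigues formula and of (−t)ⁿ
cancel. -/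
theorem hasSum_hermite (t : ℂ) (y : ℂ) :
    HasSum (fun n : ℕ => t ^ n / n.factorial * Polynomial.aeval y (Polynomial.hermite n))
      (Complex.exp (t * y - t ^ 2 / 2)) := by
  have hd : Differentiable ℂ fun z : ℂ => Complex.exp (-(z ^ 2 / 2)) := by fun_prop
  have h := (Complex.hasSum_taylorSeries_of_entire hd y (y - t)).mul_right
    (Complex.exp (y ^ 2 / 2))
  rw [← Complex.exp_add] at h
  convert! h using 1
  · funext n
    rw [iteratedDeriv_gaussian_eq_hermite_mul, smul_eq_mul, smul_eq_mul, sub_sub_cancel_left,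
      neg_pow t]
    have e : Complex.exp (-(y ^ 2 / 2)) * Complex.exp (y ^ 2 / 2) = 1 := by
      rw [← Complex.exp_add]; simp
    have e2 : ((-1 : ℂ) ^ n) * (-1) ^ n = 1 := by rw [← mul_pow]; simp
    linear_combination (-(t ^ n / n.factorial * Polynomial.aeval y (Polynomial.hermite n))) *
      (e2 * Complex.exp (-(y ^ 2 / 2)) * Complex.exp (y ^ 2 / 2) + e)
  · congr 1; ring

/-- The coherent wave function `(2/π)^{1/4} e^{-|α|²/2 + 2αx - α²/2 - x²}`. -/
def coherentFun (α : ℂ) (x : ℝ) : ℂ :=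
  ((2 / Real.pi) ^ (1 / 4 : ℝ) : ℝ) *
    Complex.exp (-(‖α‖ ^ 2 : ℝ) / 2 + 2 * α * x - α ^ 2 / 2 - x ^ 2)

theorem hasSum_hermiteFun (α : ℂ) (x : ℝ) :
    HasSum (fun k : ℕ => (α ^ k / (√(k.factorial : ℝ) : ℂ)) * hermiteFun k x)
      (((2 / Real.pi) ^ (1 / 4 : ℝ) : ℝ) * Complex.exp (2 * α * x - α ^ 2 / 2 - x ^ 2)) := by
  have h := ((hasSum_hermite α (2 * x)).mul_left
    ((((2 / Real.pi) ^ (1 / 4 : ℝ) : ℝ) : ℂ) * Complex.exp (-x ^ 2)))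
  convert! h using 1
  · funext k
    have e : (√(k.factorial : ℝ) : ℂ) * (√(k.factorial : ℝ) : ℂ) = k.factorial := by
      rw [← Complex.ofReal_mul, Real.mul_self_sqrt (by positivity)]; simp
    have e0 : (√(k.factorial : ℝ) : ℂ) ≠ 0 := by
      have : 0 < √(k.factorial : ℝ) := by positivity
      exact_mod_cast this.ne'
    have e3 : (Polynomial.aeval (2 * (x : ℂ)) (Polynomial.hermite k) : ℂ) =
        ((Polynomial.aeval (2 * x) (Polynomial.hermite k) : ℝ) : ℂ) := by
      have := Polynomial.aeval_algebraMap_apply ℂ (2 * x) (Polynomial.hermite k)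
      simpa using this
    rw [hermiteFun, e3, ← e]
    push_cast
    field_simp
  · rw [mul_assoc (_ : ℂ) (Complex.exp _), ← Complex.exp_add]
    congr 2; ring

/-- For an orthonormal family it is enough that the squared coefficients |α|^{2k}/k! are summable.
-/
theorem summable_coherent (α : ℂ) :
    Summable fun k : ℕ => (α ^ k / (√(k.factorial : ℝ) : ℂ)) • numberVec k := by
  have h := (orthonormal_numberVec.orthogonalFamily.summable_iff_norm_sq_summable
    (fun k : ℕ => α ^ k / (√(k.factorial : ℝ) : ℂ))).2 (by
      refine (Real.summable_pow_div_factorial (‖α‖ ^ 2)).congr fun k => ?_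
      rw [norm_div, norm_pow, Complex.norm_real, div_pow, Real.norm_eq_abs, sq_abs,
        Real.sq_sqrt (by positivity)]
      ring)
  simpa using h

/-- Convergence in L² gives convergence in measure, hence a.e. convergence along a subsequence,
where the pointwise limit must agree. This identifies the abstract sum defining `coherentVec` with
the closed form `coherentFun`. -/
theorem ae_eq_of_hasSum_L2 {X : Type*} [MeasureSpace X] {f : ℕ → HilbertL2 X} {F : HilbertL2 X}
    (hF : HasSum f F) {g : ℕ → X → ℂ} (hg : ∀ k, f k =ᵐ[volume] g k) {G : X → ℂ}
    (hG : ∀ x, HasSum (fun k => g k x) (G x)) : F =ᵐ[volume] G := by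
  have h1 : Tendsto (fun n => ∑ k ∈ Finset.range n, f k) atTop (𝓝 F) := hF.tendsto_sum_nat
  obtain ⟨ns, hns, hae⟩ := (tendstoInMeasure_of_tendsto_Lp h1).exists_seq_tendsto_ae
  have h2 : ∀ᵐ x, ∀ n, (∑ k ∈ Finset.range n, f k : HilbertL2 X) x =
      ∑ k ∈ Finset.range n, g k x := by
    rw [ae_all_iff]
    intro n
    filter_upwards [Lp.coeFn_fun_finsetSum (Finset.range n) f, ae_all_iff.2 hg] with x h3 h4
    rw [h3]
    exact Finset.sum_congr rfl fun k _ => h4 k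
  filter_upwards [hae, h2] with x h3 h4
  refine tendsto_nhds_unique h3 ?_
  simp only [h4]
  exact (hG x).tendsto_sum_nat.comp hns.tendsto_atTop

theorem coherentVec_coeFn (α : ℂ) : coherentVec α =ᵐ[volume] coherentFun α := by
  have h := ae_eq_of_hasSum_L2 (summable_coherent α).hasSum
    (g := fun k x => (α ^ k / (√(k.factorial : ℝ) : ℂ)) * hermiteFun k x)
    (fun k => by
      filter_upwards [Lp.coeFn_smul (α ^ k / (√(k.factorial : ℝ) : ℂ)) (numberVec k),
        (memLp_hermiteFun k).coeFn_toLp] with x h1 h2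
      rw [h1, Pi.smul_apply, smul_eq_mul, numberVec, h2])
    (hasSum_hermiteFun α)
  filter_upwards [h, Lp.coeFn_smul (Real.exp (-‖α‖ ^ 2 / 2) : ℂ)
    (∑' k : ℕ, (α ^ k / (√(k.factorial : ℝ) : ℂ)) • numberVec k)] with x h1 h2
  rw [coherentVec, h2, Pi.smul_apply, h1, coherentFun, smul_eq_mul, mul_left_comm,
    Complex.ofReal_exp, ← Complex.exp_add]
  congr 2
  push_cast
  ring

theorem continuous_coherentFun (α : ℂ) : Continuous (coherentFun α) := by
  unfold coherentFun
  fun_prop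

theorem conj_coherentFun_mul (α β : ℂ) (x : ℝ) :
    starRingEnd ℂ (coherentFun β x) * coherentFun α x = √(2 / Real.pi) *
      Complex.exp (-2 * x ^ 2 + 2 * (starRingEnd ℂ β + α) * x +
        (-(‖α‖ ^ 2 : ℝ) / 2 - (‖β‖ ^ 2 : ℝ) / 2 - (starRingEnd ℂ β ^ 2 + α ^ 2) / 2)) := by
  have e2 : √(2 / Real.pi) = (2 / Real.pi) ^ (1 / 4 : ℝ) * (2 / Real.pi) ^ (1 / 4 : ℝ) := by
    rw [← Real.rpow_add (by positivity), Real.sqrt_eq_rpow]; norm_num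
  rw [coherentFun, coherentFun, map_mul, ← Complex.exp_conj, Complex.conj_ofReal, e2,
    mul_mul_mul_comm, ← Complex.exp_add, Complex.ofReal_mul]
  congr 2
  simp only [map_sub, map_add, map_mul, map_div₀, map_neg, map_pow, Complex.conj_ofReal, map_ofNat]
  ring

theorem inner_coherentVec (β α : ℂ) : ⟪coherentVec β, coherentVec α⟫_ℂ =
    Complex.exp (-(‖α‖ ^ 2 : ℝ) / 2 - (‖β‖ ^ 2 : ℝ) / 2 + starRingEnd ℂ β * α) := by
  have h : ⟪coherentVec β, coherentVec α⟫_ℂ =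
      ∫ x : ℝ, starRingEnd ℂ (coherentFun β x) * coherentFun α x := by
    rw [L2.inner_def]
    refine integral_congr_ae ?_
    filter_upwards [coherentVec_coeFn β, coherentVec_coeFn α] with x h1 h2
    rw [h1, h2, RCLike.inner_apply']
  have h3 : (√(2 / Real.pi) : ℂ) * (Real.pi / - -2) ^ (1 / 2 : ℂ) = 1 := by
    have e1 : (Real.pi / - -2 : ℂ) = ((Real.pi / 2 : ℝ) : ℂ) := by push_cast; ring
    have e2 : (1 / 2 : ℂ) = ((1 / 2 : ℝ) : ℂ) := by push_cast; ring
    rw [e1, e2, ← Complex.ofReal_cpow (by positivity), ← Real.sqrt_eq_rpow, ← Complex.ofReal_mul,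
      ← Real.sqrt_mul (by positivity)]
    have : 2 / Real.pi * (Real.pi / 2) = 1 := by field_simp
    rw [this, Real.sqrt_one, Complex.ofReal_one]
  rw [h]
  simp only [conj_coherentFun_mul]
  rw [integral_const_mul, integral_cexp_quadratic (by norm_num), ← mul_assoc, h3, one_mul]
  congr 1
  ring

theorem norm_coherentVec (α : ℂ) : ‖coherentVec α‖ = 1 := by
  have h := inner_self_eq_norm_sq_to_K (𝕜 := ℂ) (coherentVec α)
  rw [inner_coherentVec, mul_comm (starRingEnd ℂ α), Complex.mul_conj, Complex.normSq_eq_norm_sq]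
    at h
  have e : (-(‖α‖ ^ 2 : ℝ) / 2 - (‖α‖ ^ 2 : ℝ) / 2 + (‖α‖ ^ 2 : ℝ) : ℂ) = 0 := by ring
  rw [e, Complex.exp_zero] at h
  have h2 : ‖coherentVec α‖ ^ 2 = 1 := Complex.ofReal_injective (by simpa using h.symm)
  exact (pow_eq_one_iff_of_nonneg (norm_nonneg _) two_ne_zero).1 h2

/-- For unit vectors ‖β − α‖² = 2 − 2 Re⟨β, α⟩, so norm continuity follows from continuity of the
explicit overlap. -/
theorem continuous_coherentVec : Continuous coherentVec := by
  rw [continuous_iff_continuousAt]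
  intro α
  have h : Tendsto (fun β => ‖coherentVec β - coherentVec α‖ ^ 2) (𝓝 α) (𝓝 0) := by
    have e : ∀ β, ‖coherentVec β - coherentVec α‖ ^ 2 =
        2 - 2 * (Complex.exp (-(‖α‖ ^ 2 : ℝ) / 2 - (‖β‖ ^ 2 : ℝ) / 2 + starRingEnd ℂ β * α)).re := by
      intro β
      rw [norm_sub_sq (𝕜 := ℂ), norm_coherentVec, norm_coherentVec, inner_coherentVec]
      simp only [RCLike.re_to_complex]
      ring
    simp only [e]
    have hc : Continuous fun β : ℂ => 2 - 2 * (Complex.exp (-(‖α‖ ^ 2 : ℝ) / 2 -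
        (‖β‖ ^ 2 : ℝ) / 2 + starRingEnd ℂ β * α)).re := by
      have := Complex.continuous_conj
      fun_prop
    refine (hc.tendsto α).trans_eq ?_
    rw [← e]
    simp
  rw [ContinuousAt, tendsto_iff_norm_sub_tendsto_zero]
  have := h.sqrt
  simpa using this

/-! ## Completeness of the coherent vectors -/

/-- Each smooth compactly supported `g` is the Fourier transform of a Schwartz function `K`. Moving
the transform across the pairing gives ∫ g f = ∫ K f̂ = 0, and such `g` detect `f`. -/
theorem ae_eq_zero_of_fourier_eq_zero {f : ℝ → ℂ} (hf : Integrable f)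
    (h : ∀ v : ℝ, ∫ x : ℝ, Complex.exp (v * x * Complex.I) * f x = 0) : ∀ᵐ x, f x = 0 := by
  have h0 : ∀ v : ℝ, FourierTransform.fourier f v = 0 := by
    intro v
    rw [Real.fourier_eq']
    have := h (-2 * Real.pi * v)
    rw [← this]
    congr 1
    funext x
    rw [smul_eq_mul]
    congr 2
    simp
    ring
  refine ae_eq_zero_of_integral_contDiff_smul_eq_zero hf.locallyIntegrable fun g hg hgc => ?_
  have hg1 : HasCompactSupport (Complex.ofRealCLM ∘ g) := hgc.comp_left rfl
  have hg2 : ContDiff ℝ (⊤ : ℕ∞) (Complex.ofRealCLM ∘ g) := by fun_prop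
  let G : SchwartzMap ℝ ℂ := hg1.toSchwartzMap hg2
  let K : SchwartzMap ℝ ℂ := FourierTransformInv.fourierInv G
  have hK : ∀ x, FourierTransform.fourier (K : ℝ → ℂ) x = g x := fun x => by
    rw [← SchwartzMap.fourier_coe, FourierTransform.fourier_fourierInv_eq]
    simp [G]
  have h1 := VectorFourier.integral_fourierIntegral_smul_eq_flip (L := innerₗ ℝ) (μ := volume)
    (ν := volume) Real.continuous_fourierChar continuous_inner K.integrable hf
  have h2 : ∀ v : ℝ, VectorFourier.fourierIntegral Real.fourierChar volume (innerₗ ℝ).flip f v =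
      0 := fun v => by
    rw [flip_innerₗ]
    exact h0 v
  simp only [h2, smul_zero, integral_zero] at h1
  rw [← h1]
  congr 1
  funext x
  have h3 : VectorFourier.fourierIntegral Real.fourierChar volume (innerₗ ℝ) (K : ℝ → ℂ) x = g x :=
    hK x
  rw [h3, smul_eq_mul, Complex.real_smul]

theorem eq_zero_of_inner_coherentVec {ψ : HilbertL2 ℝ}
    (h : ∀ α, ⟪coherentVec α, ψ⟫_ℂ = 0) : ψ = 0 := by
  have hint : Integrable fun x : ℝ => Complex.exp (-x ^ 2) * ψ x := by
    have h1 := L2.integrable_inner (𝕜 := ℂ) (coherentVec 0) ψ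
    have hp : (((2 / Real.pi) ^ (1 / 4 : ℝ) : ℝ) : ℂ) ≠ 0 := by
      have : 0 < (2 / Real.pi) ^ (1 / 4 : ℝ) := by positivity
      exact_mod_cast this.ne'
    refine (h1.const_mul (((2 / Real.pi) ^ (1 / 4 : ℝ) : ℝ) : ℂ)⁻¹).congr ?_
    filter_upwards [coherentVec_coeFn 0] with x hx
    rw [hx, RCLike.inner_apply', coherentFun, map_mul, Complex.conj_ofReal, ← Complex.exp_conj,
      mul_assoc, inv_mul_cancel_left₀ hp]
    simp
  have h0 := ae_eq_zero_of_fourier_eq_zero hint fun v => by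
    -- Purely imaginary amplitudes suffice. For α = −iv/2 the terms −|α|²/2 and −α²/2 cancel, and
    -- the conjugate wave function is a constant times e^{ivx − x²}; the overlaps are thus the
    -- Fourier integrals of e^{-x²} ψ.
    have h1 := h ((-v / 2 : ℝ) * Complex.I)
    rw [L2.inner_def] at h1
    have e : ∀ᵐ x : ℝ, ⟪coherentVec ((-v / 2 : ℝ) * Complex.I) x, ψ x⟫_ℂ =
        ((2 / Real.pi) ^ (1 / 4 : ℝ) : ℝ) *
          (Complex.exp (v * x * Complex.I) * (Complex.exp (-x ^ 2) * ψ x)) := by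
      filter_upwards [coherentVec_coeFn ((-v / 2 : ℝ) * Complex.I)] with x hx
      rw [hx, RCLike.inner_apply', coherentFun, map_mul, Complex.conj_ofReal, ← Complex.exp_conj,
        mul_assoc, ← mul_assoc (Complex.exp _) (Complex.exp _), ← Complex.exp_add]
      congr 3
      simp only [map_sub, map_add, map_mul, map_div₀, map_neg, map_pow, Complex.conj_ofReal,
        map_ofNat, Complex.conj_I, norm_mul, Complex.norm_I, Complex.norm_real, mul_one,
        Real.norm_eq_abs, sq_abs]
      push_cast
      linear_combination (-(v : ℂ) ^ 2 / 8) * Complex.I_sq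
    rw [integral_congr_ae e, integral_const_mul] at h1
    refine (mul_eq_zero.1 h1).resolve_left ?_
    have : 0 < (2 / Real.pi) ^ (1 / 4 : ℝ) := by positivity
    exact_mod_cast this.ne'
  refine Lp.ext ?_
  filter_upwards [h0, Lp.coeFn_zero ℂ 2 (volume : Measure ℝ)] with x h1 h2
  rw [h2, Pi.zero_apply]
  exact (mul_eq_zero.1 h1).resolve_left (Complex.exp_ne_zero _)

/-- Coherent vectors are convergent series of number vectors, so their totality passes to the number
vectors. -/
theorem eq_zero_of_inner_numberVec {ψ : HilbertL2 ℝ} (h : ∀ k, ⟪numberVec k, ψ⟫_ℂ = 0) :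
    ψ = 0 := by
  refine eq_zero_of_inner_coherentVec fun α => ?_
  have h1 : ⟪ψ, coherentVec α⟫_ℂ = 0 := by
    rw [coherentVec, inner_smul_right, ← innerSL_apply_apply, (innerSL ℂ ψ).map_tsum
      (summable_coherent α)]
    simp only [innerSL_apply_apply, inner_smul_right]
    have : ∀ k, ⟪ψ, numberVec k⟫_ℂ = 0 := fun k => by rw [← inner_conj_symm, h k, map_zero]
    simp [this]
  rw [← inner_conj_symm, h1, map_zero]

/-- The number vectors as a Hilbert basis. -/
def numberBasis : HilbertBasis ℕ ℂ (HilbertL2 ℝ) :=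
  HilbertBasis.mkOfOrthogonalEqBot orthonormal_numberVec (by
    rw [Submodule.eq_bot_iff]
    intro ψ hψ
    exact eq_zero_of_inner_numberVec fun k =>
      (Submodule.mem_orthogonal _ _).1 hψ _ (Submodule.subset_span ⟨k, rfl⟩))

theorem numberBasis_apply (k : ℕ) : numberBasis k = numberVec k := by
  simp [numberBasis]

/-! ## Mixtures of pure states -/

section Mixture

variable {A H : Type*} [MeasurableSpace A] [NormedAddCommGroup H] [InnerProductSpace ℂ H]

/-- Distinct basis vectors are √2 apart, so the balls of radius 1/2 are disjoint. The trace uses an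
unspecified basis, and exchanging its sum with an integral needs a countable index. -/
theorem HilbertBasis.countable_index [TopologicalSpace.SeparableSpace H] {ι : Type*}
    (b : HilbertBasis ι ℂ H) : Countable ι := by
  refine Pairwise.countable_of_isOpen_disjoint (s := fun i => Metric.ball (b i) (1 / 2)) ?_
    (fun i => Metric.isOpen_ball) fun i => ⟨b i, Metric.mem_ball_self (by norm_num)⟩
  intro i j hij
  refine Metric.ball_disjoint_ball ?_
  have h : ‖b i - b j‖ ^ 2 = 2 := by
    rw [norm_sub_sq (𝕜 := ℂ), b.orthonormal.norm_eq_one, b.orthonormal.norm_eq_one,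
      b.orthonormal.inner_eq_zero hij]
    norm_num
  rw [dist_eq_norm]
  nlinarith [norm_nonneg (b i - b j)]

theorem HilbertBasis.hasSum_norm_inner_sq {ι : Type*} (b : HilbertBasis ι ℂ H) (x : H) :
    HasSum (fun i => ‖⟪b i, x⟫_ℂ‖ ^ 2) (‖x‖ ^ 2) := by
  have h := b.hasSum_inner_mul_inner x x
  rw [inner_self_eq_norm_sq_to_K] at h
  have h2 : ∀ i, ⟪x, b i⟫_ℂ * ⟪b i, x⟫_ℂ = ((‖⟪b i, x⟫_ℂ‖ ^ 2 : ℝ) : ℂ) := fun i => by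
    rw [← inner_conj_symm x, mul_comm, Complex.mul_conj, Complex.normSq_eq_norm_sq]
  simp only [h2] at h
  exact Complex.hasSum_ofReal.1 (by simpa using h)

theorem integrable_inner_mul_inner {μ : Measure A} [IsFiniteMeasure μ] {v : A → H}
    (hv : AEStronglyMeasurable v μ) (h1 : ∀ a, ‖v a‖ = 1)
    (f g : H) :
    Integrable (fun a => ⟪f, v a⟫_ℂ * ⟪v a, g⟫_ℂ) μ := by
  refine Integrable.of_bound ((hv.const_inner).mul (hv.inner_const)) (‖f‖ * ‖g‖)
    (ae_of_all _ fun a => ?_)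
  have h2 := norm_inner_le_norm (𝕜 := ℂ) f (v a)
  have h3 := norm_inner_le_norm (𝕜 := ℂ) (v a) g
  rw [h1] at h2 h3
  rw [norm_mul]
  calc _ ≤ (‖f‖ * 1) * (1 * ‖g‖) := by gcongr
    _ = _ := by ring

/-- The mixture `∫ |v a⟩⟨v a| dμ(a)` of pure states. -/
def mixedState (μ : Measure A) (v : A → H) : H →L[ℂ] H :=
  ∫ a, InnerProductSpace.rankOne ℂ (v a) (v a) ∂μ

theorem continuous_rankOne_self :
    Continuous fun x : H => InnerProductSpace.rankOne ℂ x x := by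
  have : (fun x : H => InnerProductSpace.rankOne ℂ x x) =
      fun x => (innerSL ℂ x).smulRight x := rfl
  rw [this]
  have h1 : Continuous fun x : H => innerSL ℂ x := (innerSL ℂ).continuous
  have h2 := (ContinuousLinearMap.smulRightL ℂ H H).continuous₂
  exact h2.comp (h1.prodMk continuous_id)

variable {μ : Measure A} {v : A → H}

theorem integrable_rankOne_self [IsFiniteMeasure μ] (hv : AEStronglyMeasurable v μ)
    (h1 : ∀ a, ‖v a‖ = 1) : Integrable (fun a => InnerProductSpace.rankOne ℂ (v a) (v a)) μ := by
  refine Integrable.of_bound (continuous_rankOne_self.comp_aestronglyMeasurable hv) 1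
    (ae_of_all _ fun a => ?_)
  simp [h1]

variable [CompleteSpace H] [IsFiniteMeasure μ]

theorem inner_mixedState (hv : AEStronglyMeasurable v μ) (h1 : ∀ a, ‖v a‖ = 1) (f g : H) :
    ⟪f, mixedState μ v g⟫_ℂ = ∫ a, ⟪f, v a⟫_ℂ * ⟪v a, g⟫_ℂ ∂μ := by
  have hi := integrable_rankOne_self hv h1
  rw [mixedState, ContinuousLinearMap.integral_apply hi, ← integral_inner (hi.apply_continuousLinearMap g)]
  refine integral_congr_ae (ae_of_all _ fun a => ?_)
  simp only [InnerProductSpace.rankOne_apply, inner_smul_right]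
  ring

theorem inner_mixedState_self (hv : AEStronglyMeasurable v μ) (h1 : ∀ a, ‖v a‖ = 1) (f : H) :
    ⟪f, mixedState μ v f⟫_ℂ = ((∫ a, ‖⟪v a, f⟫_ℂ‖ ^ 2 ∂μ : ℝ) : ℂ) := by
  rw [inner_mixedState hv h1, ← integral_complex_ofReal]
  refine integral_congr_ae (ae_of_all _ fun a => ?_)
  simp only
  rw [← inner_conj_symm f (v a), mul_comm, Complex.mul_conj, Complex.normSq_eq_norm_sq]

theorem isPositive_mixedState (hv : AEStronglyMeasurable v μ) (h1 : ∀ a, ‖v a‖ = 1) :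
    (mixedState μ v).IsPositive := by
  rw [ContinuousLinearMap.isPositive_iff_complex]
  intro f
  rw [← inner_conj_symm, inner_mixedState_self hv h1, Complex.conj_ofReal]
  rw [RCLike.re_to_complex, Complex.ofReal_re]
  exact ⟨rfl, by positivity⟩

theorem mixedState_nonneg (hv : AEStronglyMeasurable v μ) (h1 : ∀ a, ‖v a‖ = 1) :
    0 ≤ mixedState μ v :=
  ContinuousLinearMap.nonneg_iff_isPositive _ |>.2 (isPositive_mixedState hv h1)

/-- For each fixed `a` this is Parseval for ⟨E* v, v⟩. Sum and integral are exchanged by dominated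
convergence: AM-GM bounds each term by half the sum of two squared coefficients, and these add up to
(‖v‖² + ‖E* v‖²)/2, which is bounded in `a`. -/
theorem hasSum_inner_mixedState_comp {ι : Type*} [Countable ι] (b : HilbertBasis ι ℂ H)
    (hv : AEStronglyMeasurable v μ) (h1 : ∀ a, ‖v a‖ = 1) (E : H →L[ℂ] H) :
    HasSum (fun i => ⟪b i, (mixedState μ v ∘L E) (b i)⟫_ℂ) (∫ a, ⟪v a, E (v a)⟫_ℂ ∂μ) := by
  have hE : ∀ a i, ⟪v a, E (b i)⟫_ℂ = ⟪ContinuousLinearMap.adjoint E (v a), b i⟫_ℂ := fun a i =>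
    (ContinuousLinearMap.adjoint_inner_left E _ _).symm
  have e : ∀ i, ⟪b i, (mixedState μ v ∘L E) (b i)⟫_ℂ =
      ∫ a, ⟪b i, v a⟫_ℂ * ⟪ContinuousLinearMap.adjoint E (v a), b i⟫_ℂ ∂μ := fun i => by
    rw [ContinuousLinearMap.comp_apply, inner_mixedState hv h1]
    simp only [hE]
  have hps := b.hasSum_norm_inner_sq
  have hvE : AEStronglyMeasurable (fun a => ContinuousLinearMap.adjoint E (v a)) μ :=
    (ContinuousLinearMap.adjoint E).continuous.comp_aestronglyMeasurable hv
  simp only [e]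
  have hsum : ∀ a, HasSum (fun i => 1 / 2 * (‖⟪b i, v a⟫_ℂ‖ ^ 2 +
      ‖⟪b i, ContinuousLinearMap.adjoint E (v a)⟫_ℂ‖ ^ 2))
      (1 / 2 * (‖v a‖ ^ 2 + ‖ContinuousLinearMap.adjoint E (v a)‖ ^ 2)) := fun a =>
    ((hps _).add (hps _)).mul_left _
  refine hasSum_integral_of_dominated_convergence (fun i a => 1 / 2 * (‖⟪b i, v a⟫_ℂ‖ ^ 2 +
      ‖⟪b i, ContinuousLinearMap.adjoint E (v a)⟫_ℂ‖ ^ 2)) (fun i => hv.const_inner.mul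
        hvE.inner_const) (fun i => ae_of_all _ fun a => ?_) (ae_of_all _ fun a => (hsum a).summable)
        ?_ (ae_of_all _ fun a => ?_)
  · rw [norm_mul, norm_inner_symm (ContinuousLinearMap.adjoint E (v a))]
    nlinarith [sq_nonneg (‖⟪b i, v a⟫_ℂ‖ - ‖⟪b i, ContinuousLinearMap.adjoint E (v a)⟫_ℂ‖)]
  · simp only [fun a => (hsum a).tsum_eq]
    refine Integrable.of_bound (((hv.norm.pow 2).add (hvE.norm.pow 2)).const_mul _)
      (1 / 2 * (1 + ‖ContinuousLinearMap.adjoint E‖ ^ 2)) (ae_of_all _ fun a => ?_)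
    have h2 := (ContinuousLinearMap.adjoint E).le_opNorm (v a)
    rw [h1, mul_one] at h2
    rw [Real.norm_of_nonneg (by positivity), h1, one_pow]
    gcongr
  · have h := b.hasSum_inner_mul_inner (ContinuousLinearMap.adjoint E (v a)) (v a)
    rw [ContinuousLinearMap.adjoint_inner_left] at h
    refine h.congr_fun fun i => ?_
    ring

theorem opTrace_mixedState_comp [TopologicalSpace.SeparableSpace H]
    (hv : AEStronglyMeasurable v μ) (h1 : ∀ a, ‖v a‖ = 1) (E : H →L[ℂ] H) :
    opTrace (mixedState μ v ∘L E) = ∫ a, ⟪v a, E (v a)⟫_ℂ ∂μ := by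
  have := (exists_hilbertBasis ℂ H).choose_spec.choose.countable_index
  exact (hasSum_inner_mixedState_comp _ hv h1 E).tsum_eq

end Mixture

/-! ## The Gaussian state as a mixture of coherent states -/

/-- The Gaussian density of the amplitude. -/
def amplitudeDensity (N : ℝ) (θ α : ℂ) : ℝ :=
  1 / (Real.pi * N) * Real.exp (-‖α - θ‖ ^ 2 / N)

/-- The Gaussian distribution of the amplitude. -/
def amplitudeMeasure (N : ℝ) (θ : ℂ) : Measure ℂ :=
  volume.withDensity fun α => ENNReal.ofReal (amplitudeDensity N θ α)

theorem continuous_amplitudeDensity (N : ℝ) (θ : ℂ) : Continuous (amplitudeDensity N θ) := by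
  unfold amplitudeDensity
  fun_prop

theorem amplitudeDensity_nonneg {N : ℝ} (hN : 0 < N) (θ α : ℂ) : 0 ≤ amplitudeDensity N θ α := by
  unfold amplitudeDensity
  positivity

theorem integrable_amplitudeDensity {N : ℝ} (hN : 0 < N) (θ : ℂ) :
    Integrable (amplitudeDensity N θ) := by
  have h := GaussianFourier.integrable_cexp_neg_mul_sq_norm_add (V := ℂ) (b := ((1 / N : ℝ) : ℂ))
    (by rw [Complex.ofReal_re]; positivity) 0 0
  have h2 := ((h.norm.comp_sub_right θ).const_mul (1 / (Real.pi * N)))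
  refine h2.congr (ae_of_all _ fun α => ?_)
  simp only [amplitudeDensity, zero_mul, add_zero, Complex.norm_exp]
  congr 2
  rw [← Complex.ofReal_pow, ← Complex.ofReal_neg, ← Complex.ofReal_mul, Complex.ofReal_re]
  ring

theorem integral_amplitudeMeasure {E : Type*} [NormedAddCommGroup E] [NormedSpace ℝ E] {N : ℝ}
    (hN : 0 < N) (θ : ℂ) (f : ℂ → E) :
    ∫ α, f α ∂(amplitudeMeasure N θ) = ∫ α, amplitudeDensity N θ α • f α := by
  rw [amplitudeMeasure, integral_withDensity_eq_integral_toReal_smul₀]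
  · simp only [ENNReal.toReal_ofReal (amplitudeDensity_nonneg hN θ _)]
  · exact (continuous_amplitudeDensity N θ).measurable.ennreal_ofReal.aemeasurable
  · exact ae_of_all _ fun _ => ENNReal.ofReal_lt_top

/-- Finiteness is enough for the mixture lemmas; the normalization enters through the explicit
constants of the position density. -/
theorem isFiniteMeasure_amplitudeMeasure {N : ℝ} (hN : 0 < N) (θ : ℂ) :
    IsFiniteMeasure (amplitudeMeasure N θ) :=
  isFiniteMeasure_withDensity_ofReal (integrable_amplitudeDensity hN θ).2

theorem gaussianState_eq_mixedState {N : ℝ} (hN : 0 < N) (θ : ℂ) :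
    gaussianState N θ = mixedState (amplitudeMeasure N θ) coherentVec := by
  rw [mixedState, integral_amplitudeMeasure hN, gaussianState, ← integral_smul]
  refine integral_congr_ae (ae_of_all _ fun α => ?_)
  simp only [amplitudeDensity]
  rw [smul_smul, ← Complex.ofReal_mul, ← Complex.coe_smul]

theorem aestronglyMeasurable_coherentVec (μ : Measure ℂ) : AEStronglyMeasurable coherentVec μ :=
  continuous_coherentVec.aestronglyMeasurable

/-! ## The position density -/

/-- `Im α` only contributes a phase; what remains is the normal density with mean `Re α` and
variance 1/4. -/
theorem norm_coherentFun_sq (α : ℂ) (x : ℝ) :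
    ‖coherentFun α x‖ ^ 2 = √(2 / Real.pi) * Real.exp (-2 * (x - α.re) ^ 2) := by
  have h := conj_coherentFun_mul α α x
  rw [mul_comm, Complex.mul_conj, Complex.normSq_eq_norm_sq] at h
  apply Complex.ofReal_injective
  rw [h, Complex.ofReal_mul, Complex.ofReal_exp]
  congr 2
  have h1 : (‖α‖ ^ 2 : ℝ) = α.re ^ 2 + α.im ^ 2 := by
    rw [← Complex.normSq_eq_norm_sq, Complex.normSq_apply]; ring
  have h2 : α = α.re + α.im * Complex.I := (Complex.re_add_im α).symm
  have h3 : starRingEnd ℂ α = α.re - α.im * Complex.I := by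
    apply Complex.ext <;> simp
  rw [h1, h3]
  conv_lhs => rw [h2]
  simp only [Complex.add_re, Complex.add_im, Complex.ofReal_re, Complex.ofReal_im, Complex.mul_re,
    Complex.mul_im, Complex.I_re, Complex.I_im]
  push_cast
  linear_combination (-(α.im : ℂ) ^ 2) * Complex.I_sq

/-- The variance of the position. -/
def positionVar (N : ℝ) : NNReal := Real.toNNReal ((N + 1 / 2) / 2)

theorem coe_positionVar {N : ℝ} (hN : 0 < N) : (positionVar N : ℝ) = (N + 1 / 2) / 2 :=
  Real.coe_toNNReal _ (by positivity)

theorem positionVar_ne_zero {N : ℝ} (hN : 0 < N) : positionVar N ≠ 0 := by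
  rw [← NNReal.coe_ne_zero, coe_positionVar hN]
  positivity

theorem integrable_complex_mul {𝕜 : Type*} [RCLike 𝕜] {f g : ℝ → 𝕜} (hf : Integrable f)
    (hg : Integrable g) : Integrable fun z : ℂ => f z.re * g z.im :=
  (Complex.volume_preserving_equiv_real_prod.integrable_comp_emb
    Complex.measurableEquivRealProd.measurableEmbedding).2 (hf.mul_prod hg)

theorem integral_complex_mul {𝕜 : Type*} [RCLike 𝕜] (f g : ℝ → 𝕜) :
    ∫ z : ℂ, f z.re * g z.im = (∫ u, f u) * ∫ v, g v := by
  rw [← integral_prod_mul]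
  exact Complex.volume_preserving_equiv_real_prod.integral_comp
    Complex.measurableEquivRealProd.measurableEmbedding fun p => f p.1 * g p.2

/-- `Im α` integrates out, and in `Re α` this is the convolution of normal laws of variances N/2 and
1/4. -/
theorem lintegral_norm_coherentFun_sq {N : ℝ} (hN : 0 < N) (θ x : ℝ) :
    ∫⁻ α, ENNReal.ofReal (‖coherentFun α x‖ ^ 2) ∂(amplitudeMeasure N θ) =
      ProbabilityTheory.gaussianPDF θ (positionVar N) x := by
  -- `m` completes the square in u = `Re α`: (u − θ)²/N + 2(x − u)² = (1/N + 2)(u − m)² + 2(x −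
  -- θ)²/(1 + 2N).
  set m : ℝ := (θ / N + 2 * x) / (1 / N + 2) with hm
  have e : ∀ α : ℂ, amplitudeDensity N θ α * ‖coherentFun α x‖ ^ 2 =
      (1 / (Real.pi * N) * √(2 / Real.pi) * Real.exp (-(2 * (x - θ) ^ 2 / (1 + 2 * N)))) *
        (Real.exp (-(1 / N + 2) * (α.re - m) ^ 2) * Real.exp (-(1 / N) * α.im ^ 2)) := by
    intro α
    have h1 : ‖α - θ‖ ^ 2 = (α.re - θ) ^ 2 + α.im ^ 2 := by
      rw [← Complex.normSq_eq_norm_sq, Complex.normSq_apply]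
      simp
      ring
    rw [norm_coherentFun_sq, amplitudeDensity, h1]
    have h2 : Real.exp (-((α.re - θ) ^ 2 + α.im ^ 2) / N) * Real.exp (-2 * (x - α.re) ^ 2) =
        Real.exp (-(2 * (x - θ) ^ 2 / (1 + 2 * N))) * (Real.exp (-(1 / N + 2) * (α.re - m) ^ 2) *
          Real.exp (-(1 / N) * α.im ^ 2)) := by
      rw [← Real.exp_add, ← Real.exp_add, ← Real.exp_add]
      congr 1
      have : 1 + 2 * N ≠ 0 := by positivity
      rw [hm]
      have h3 : 1 / N + 2 = (1 + 2 * N) / N := by field_simp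
      rw [h3]
      field_simp
      ring
    linear_combination (1 / (Real.pi * N) * √(2 / Real.pi)) * h2
  have hi1 : Integrable fun u : ℝ => Real.exp (-(1 / N + 2) * (u - m) ^ 2) :=
    (integrable_exp_neg_mul_sq (by positivity)).comp_sub_right m
  have hi2 : Integrable fun v : ℝ => Real.exp (-(1 / N) * v ^ 2) :=
    integrable_exp_neg_mul_sq (by positivity)
  have hint : Integrable fun α : ℂ => amplitudeDensity N θ α * ‖coherentFun α x‖ ^ 2 := by
    simp only [e]
    exact (integrable_complex_mul hi1 hi2).const_mul _
  have hmeas : Measurable fun α : ℂ => ENNReal.ofReal (‖coherentFun α x‖ ^ 2) := by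
    simp only [norm_coherentFun_sq]
    fun_prop
  rw [amplitudeMeasure, lintegral_withDensity_eq_lintegral_mul _
    (continuous_amplitudeDensity N θ).measurable.ennreal_ofReal hmeas]
  simp only [Pi.mul_apply]
  have e2 : ∀ α : ℂ, ENNReal.ofReal (amplitudeDensity N θ α) *
      ENNReal.ofReal (‖coherentFun α x‖ ^ 2) =
      ENNReal.ofReal (amplitudeDensity N θ α * ‖coherentFun α x‖ ^ 2) := fun α =>
    (ENNReal.ofReal_mul (amplitudeDensity_nonneg hN _ _)).symm
  simp only [e2]
  rw [← ofReal_integral_eq_lintegral_ofReal hint (ae_of_all _ fun α =>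
    mul_nonneg (amplitudeDensity_nonneg hN _ _) (by positivity)), ProbabilityTheory.gaussianPDF]
  congr 1
  simp only [e]
  rw [integral_const_mul, integral_complex_mul (fun u : ℝ => Real.exp (-(1 / N + 2) * (u - m) ^ 2))
    (fun v : ℝ => Real.exp (-(1 / N) * v ^ 2)),
    integral_sub_right_eq_self (fun u : ℝ => Real.exp (-(1 / N + 2) * u ^ 2)) m, integral_gaussian,
    integral_gaussian, ProbabilityTheory.gaussianPDFReal, coe_positionVar hN]
  have h4 : -(x - θ) ^ 2 / (2 * ((N + 1 / 2) / 2)) = -(2 * (x - θ) ^ 2 / (1 + 2 * N)) := by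
    field_simp
    ring
  rw [h4]
  have h5 : 1 / (Real.pi * N) * √(2 / Real.pi) * (√(Real.pi / (1 / N + 2)) * √(Real.pi / (1 / N))) =
      (√(2 * Real.pi * ((N + 1 / 2) / 2)))⁻¹ := by
    rw [← Real.sqrt_mul (by positivity), mul_assoc, ← Real.sqrt_mul (by positivity),
      ← Real.sqrt_inv]
    have : 1 / (Real.pi * N) = √((1 / (Real.pi * N)) ^ 2) := (Real.sqrt_sq (by positivity)).symm
    rw [this, ← Real.sqrt_mul (by positivity)]
    congr 1
    field_simp
    ring
  linear_combination Real.exp (-(2 * (x - θ) ^ 2 / (1 + 2 * N))) * h5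

/-! ## Tensor powers of mixtures -/

theorem norm_tensorVec {n : ℕ} (ψ : Fin n → HilbertL2 ℝ) : ‖tensorVec ψ‖ = ∏ i, ‖ψ i‖ := by
  have h := inner_tensorVec ψ ψ
  simp only [inner_self_eq_norm_sq_to_K] at h
  rw [Finset.prod_pow] at h
  have h2 : ‖tensorVec ψ‖ ^ 2 = (∏ i, ‖ψ i‖) ^ 2 := Complex.ofReal_injective (by simpa using h)
  exact (pow_left_inj₀ (norm_nonneg _) (by positivity) two_ne_zero).1 h2

theorem continuous_tensorVec {n : ℕ} :
    Continuous (tensorVec : (Fin n → HilbertL2 ℝ) → HilbertL2 (Fin n → ℝ)) := by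
  rw [continuous_iff_continuousAt]
  intro φ
  have h : Tendsto (fun ψ => ‖tensorVec ψ - tensorVec φ‖ ^ 2) (𝓝 φ) (𝓝 0) := by
    have e : ∀ ψ : Fin n → HilbertL2 ℝ, ‖tensorVec ψ - tensorVec φ‖ ^ 2 =
        (∏ i, ‖ψ i‖) ^ 2 - 2 * (∏ i, ⟪ψ i, φ i⟫_ℂ).re + (∏ i, ‖φ i‖) ^ 2 := by
      intro ψ
      rw [norm_sub_sq (𝕜 := ℂ), norm_tensorVec, norm_tensorVec, inner_tensorVec]
      simp only [RCLike.re_to_complex]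
    simp only [e]
    have hc : Continuous fun ψ : Fin n → HilbertL2 ℝ =>
        (∏ i, ‖ψ i‖) ^ 2 - 2 * (∏ i, ⟪ψ i, φ i⟫_ℂ).re + (∏ i, ‖φ i‖) ^ 2 := by
      fun_prop
    refine (hc.tendsto φ).trans_eq ?_
    rw [← e]
    simp
  rw [ContinuousAt, tendsto_iff_norm_sub_tendsto_zero]
  have := h.sqrt
  simpa using this

/-- Between product vectors, a product of integrals is an integral over the product measure. Product
vectors span a dense subspace and both operators are bounded, so they agree: n copies are a mixture
of product states with independent amplitudes. -/
theorem tensorPower_mixedState {A : Type*} [TopologicalSpace A] [SecondCountableTopology A]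
    [MeasurableSpace A] [OpensMeasurableSpace A] {μ : Measure A} [IsFiniteMeasure μ]
    {v : A → HilbertL2 ℝ} (hv : Continuous v) (h1 : ∀ a, ‖v a‖ = 1) (n : ℕ) :
    tensorPower (mixedState μ v) n =
      mixedState (Measure.pi fun _ : Fin n => μ) fun a => tensorVec fun i => v (a i) := by
  have hv' : AEStronglyMeasurable (fun a : Fin n → A => tensorVec fun i => v (a i))
      (Measure.pi fun _ : Fin n => μ) :=
    Continuous.aestronglyMeasurable (continuous_tensorVec.comp (by fun_prop))
  have h1' : ∀ a : Fin n → A, ‖tensorVec fun i => v (a i)‖ = 1 := fun a => by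
    rw [norm_tensorVec]; simp [h1]
  have key : ∀ ψ : Fin n → HilbertL2 ℝ, tensorPower (mixedState μ v) n (tensorVec ψ) =
      mixedState (Measure.pi fun _ : Fin n => μ) (fun a => tensorVec fun i => v (a i))
        (tensorVec ψ) := by
    intro ψ
    rw [← sub_eq_zero]
    refine eq_zero_of_inner_tensorVec _ fun φ => ?_
    rw [inner_sub_right, sub_eq_zero, tensorPower_tensorVec, inner_tensorVec,
      inner_mixedState hv' h1']
    simp only [inner_tensorVec, inner_mixedState hv.aestronglyMeasurable h1,
      ← Finset.prod_mul_distrib]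
    rw [← integral_fintype_prod_eq_prod (μ := fun _ : Fin n => μ)
      (fun i a => ⟪φ i, v a⟫_ℂ * ⟪v a, ψ i⟫_ℂ)]
  have hlin : (tensorPower (mixedState μ v) n).toLinearMap ∘ₗ
      Finsupp.linearCombination ℂ (tensorVec (n := n)) =
      (mixedState (Measure.pi fun _ : Fin n => μ)
        (fun a => tensorVec fun i => v (a i))).toLinearMap ∘ₗ
        Finsupp.linearCombination ℂ (tensorVec (n := n)) := by
    refine Finsupp.lhom_ext' fun ψ => LinearMap.ext_ring ?_
    simpa using key ψ
  refine ContinuousLinearMap.ext fun f => ?_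
  refine congrFun ((denseRange_linearCombination_tensorVec n).equalizer
    (ContinuousLinearMap.continuous _) (ContinuousLinearMap.continuous _) ?_) f
  funext x
  exact congrArg (fun T => T x) hlin

/-! ### The joint law of the position outcomes and the law of their mean -/

theorem lintegral_fin_prod_eq_prod {X : Type*} [MeasurableSpace X] (μ : Measure X) [SigmaFinite μ]
    {n : ℕ} {f : Fin n → X → ℝ≥0∞} (hf : ∀ i, Measurable (f i)) :
    ∫⁻ x, ∏ i, f i (x i) ∂(Measure.pi fun _ : Fin n => μ) = ∏ i, ∫⁻ x, f i x ∂μ := by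
  induction n with
  | zero => simp
  | succ n ih =>
    rw [← ((measurePreserving_piFinSuccAbove (fun _ : Fin (n + 1) => μ) 0).symm).lintegral_comp_emb
      (MeasurableEquiv.measurableEmbedding _), Fin.prod_univ_succ, ← ih fun i => hf i.succ]
    have hm : Measurable fun x : Fin n → X => ∏ i : Fin n, f i.succ (x i) :=
      Finset.measurable_fun_prod _ fun i _ => (hf i.succ).comp (measurable_pi_apply i)
    rw [← lintegral_prod_mul (hf 0).aemeasurable hm.aemeasurable]
    refine lintegral_congr fun p => ?_
    rw [Fin.prod_univ_succ]
    rfl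

theorem pi_gaussianReal (θ : ℝ) {v : NNReal} (hv : v ≠ 0) (n : ℕ) :
    (Measure.pi fun _ : Fin n => ProbabilityTheory.gaussianReal θ v) =
      volume.withDensity fun x => ∏ i, ProbabilityTheory.gaussianPDF θ v (x i) := by
  refine Measure.pi_eq fun s hs => ?_
  rw [withDensity_apply _ (MeasurableSet.univ_pi hs), ← lintegral_indicator
    (MeasurableSet.univ_pi hs)]
  have e : ∀ x : Fin n → ℝ, (Set.univ.pi s).indicator
      (fun x => ∏ i, ProbabilityTheory.gaussianPDF θ v (x i)) x =
      ∏ i, (s i).indicator (ProbabilityTheory.gaussianPDF θ v) (x i) := by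
    intro x
    by_cases h : x ∈ Set.univ.pi s
    · rw [Set.indicator_of_mem h]
      exact Finset.prod_congr rfl fun i _ => (Set.indicator_of_mem (h i trivial) _).symm
    · rw [Set.indicator_of_notMem h]
      obtain ⟨i, hi⟩ : ∃ i, x i ∉ s i := by simpa [Set.mem_pi] using h
      exact (Finset.prod_eq_zero (Finset.mem_univ i) (Set.indicator_of_notMem hi _)).symm
  simp only [e]
  rw [volume_pi, lintegral_fin_prod_eq_prod volume fun i =>
    (ProbabilityTheory.measurable_gaussianPDF θ v).indicator (hs i)]
  refine Finset.prod_congr rfl fun i _ => ?_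
  rw [lintegral_indicator (hs i), ProbabilityTheory.gaussianReal_apply _ hv]

theorem measurable_norm_coherentFun_sq (x : ℝ) :
    Measurable fun α : ℂ => ENNReal.ofReal (‖coherentFun α x‖ ^ 2) := by
  simp only [norm_coherentFun_sq]
  fun_prop

/-- By Tonelli the amplitudes are integrated first; they are independent, so each coordinate
separately becomes a Gaussian density. -/
theorem lintegral_lintegral_prod_norm_coherentFun_sq {N : ℝ} (hN : 0 < N) (θ : ℝ) (n : ℕ)
    {B : Set (Fin n → ℝ)} (hB : MeasurableSet B) :
    ∫⁻ a : Fin n → ℂ, (∫⁻ x in B, ∏ i, ENNReal.ofReal (‖coherentFun (a i) (x i)‖ ^ 2))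
        ∂(Measure.pi fun _ : Fin n => amplitudeMeasure N θ) =
      Measure.pi (fun _ : Fin n => ProbabilityTheory.gaussianReal θ (positionVar N)) B := by
  have := isFiniteMeasure_amplitudeMeasure hN θ
  have hm : Measurable fun p : (Fin n → ℂ) × (Fin n → ℝ) =>
      ∏ i, ENNReal.ofReal (‖coherentFun (p.1 i) (p.2 i)‖ ^ 2) := by
    have h2 : ∀ i, Measurable fun p : (Fin n → ℂ) × (Fin n → ℝ) =>
        ENNReal.ofReal (‖coherentFun (p.1 i) (p.2 i)‖ ^ 2) := fun i => by
      simp only [norm_coherentFun_sq]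
      fun_prop
    exact Finset.measurable_fun_prod _ fun i _ => h2 i
  have e : ∀ x : Fin n → ℝ, ∫⁻ a, ∏ i, ENNReal.ofReal (‖coherentFun (a i) (x i)‖ ^ 2)
      ∂(Measure.pi fun _ : Fin n => amplitudeMeasure N θ) =
      ∏ i, ProbabilityTheory.gaussianPDF θ (positionVar N) (x i) := by
    intro x
    rw [lintegral_fin_prod_eq_prod (f := fun i α => ENNReal.ofReal (‖coherentFun α (x i)‖ ^ 2))
      (amplitudeMeasure N θ) fun i => measurable_norm_coherentFun_sq (x i)]
    simp only [lintegral_norm_coherentFun_sq hN]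
  rw [lintegral_lintegral_swap hm.aemeasurable, pi_gaussianReal θ (positionVar_ne_zero hN),
    withDensity_apply _ hB]
  simp only [e]

theorem measureProb_jointPosition {N : ℝ} (hN : 0 < N) (θ : ℝ) (n : ℕ) {B : Set (Fin n → ℝ)}
    (hB : MeasurableSet B) :
    (opTrace (tensorPower (gaussianState N θ) n ∘L (jointPositionPVM n).op B)).re =
      (Measure.pi (fun _ : Fin n => ProbabilityTheory.gaussianReal θ (positionVar N)) B).toReal := by
  have := isFiniteMeasure_amplitudeMeasure hN θ
  -- Separability of L²(ℝⁿ), required by the trace formula, is inferred from finiteness of the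
  -- exponent.
  have : Fact ((2 : ℝ≥0∞) ≠ ∞) := ⟨by norm_num⟩
  set μ := Measure.pi fun _ : Fin n => amplitudeMeasure N θ with hμ
  have hc : Continuous fun a : Fin n → ℂ => tensorVec fun i => coherentVec (a i) :=
    continuous_tensorVec.comp
      (continuous_pi fun i => continuous_coherentVec.comp (continuous_apply i))
  have h1 : ∀ a : Fin n → ℂ, ‖tensorVec fun i => coherentVec (a i)‖ = 1 := fun a => by
    rw [norm_tensorVec]; simp [norm_coherentVec]
  have e1 : (jointPositionPVM n).op B = mulIndicator B hB := dif_pos hB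
  rw [e1, gaussianState_eq_mixedState hN,
    tensorPower_mixedState continuous_coherentVec norm_coherentVec, ← hμ,
    opTrace_mixedState_comp hc.aestronglyMeasurable h1]
  -- `r a` is the probability of `B` in the pure product state with amplitudes `a`. Its continuity
  -- serves only measurability, when the integral is turned into a lower integral for Tonelli.
  let r : (Fin n → ℂ) → ℝ := fun a =>
    ∫ x in B, ‖tensorVec (fun i => coherentVec (a i)) x‖ ^ 2
  have hr : ∀ a : Fin n → ℂ, ⟪tensorVec fun i => coherentVec (a i),
      mulIndicator B hB (tensorVec fun i => coherentVec (a i))⟫_ℂ = (r a : ℂ) := by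
    intro a
    rw [inner_mulIndicator, ← integral_complex_ofReal]
    refine integral_congr_ae (ae_of_all _ fun x => ?_)
    simp [inner_self_eq_norm_sq_to_K]
  have hrc : Continuous r := by
    have : r = fun a => (⟪tensorVec fun i => coherentVec (a i),
      mulIndicator B hB (tensorVec fun i => coherentVec (a i))⟫_ℂ).re := by
      funext a
      rw [hr, Complex.ofReal_re]
    rw [this]
    exact Complex.continuous_re.comp (hc.inner ((mulIndicator B hB).continuous.comp hc))
  have hr0 : ∀ a, 0 ≤ r a := fun a => integral_nonneg fun x => by positivity
  simp only [hr]
  rw [integral_complex_ofReal, Complex.ofReal_re, integral_eq_lintegral_of_nonneg_ae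
    (ae_of_all _ hr0) hrc.aestronglyMeasurable]
  congr 1
  have hr2 : ∀ a : Fin n → ℂ, ENNReal.ofReal (r a) =
      ∫⁻ x in B, ∏ i, ENNReal.ofReal (‖coherentFun (a i) (x i)‖ ^ 2) := by
    intro a
    have hi : Integrable (fun x => ‖tensorVec (fun i => coherentVec (a i)) x‖ ^ 2) :=
      (memLp_two_iff_integrable_sq_norm (Lp.aestronglyMeasurable _)).1 (Lp.memLp _)
    rw [ofReal_integral_eq_lintegral_ofReal hi.integrableOn (ae_of_all _ fun x => by positivity)]
    refine lintegral_congr_ae (ae_restrict_of_ae ?_)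
    filter_upwards [tensorVec_coeFn fun i => coherentVec (a i),
      ae_coord fun i => coherentVec_coeFn (a i)] with x h2 h3
    rw [h2]
    simp only [h3]
    rw [norm_prod, ← Finset.prod_pow, ENNReal.ofReal_prod_of_nonneg fun i _ => by positivity]
  simp only [hr2]
  exact lintegral_lintegral_prod_norm_coherentFun_sq hN θ n hB

/-- The characteristic function of the mean at t is the n-th power of the single one at t/n, with
exponent n(iθt/n − vt²/(2n²)). -/
theorem map_sampleMean_gaussianReal (θ : ℝ) (v : NNReal) {n : ℕ} (hn : n ≠ 0) :
    (Measure.pi fun _ : Fin n => ProbabilityTheory.gaussianReal θ v).map (sampleMean n) =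
      ProbabilityTheory.gaussianReal θ (v / n) := by
  have hn' : (n : ℂ) ≠ 0 := by exact_mod_cast hn
  have := Measure.isProbabilityMeasure_map (μ := Measure.pi fun _ : Fin n =>
    ProbabilityTheory.gaussianReal θ v) (measurable_sampleMean n).aemeasurable
  refine Measure.ext_of_charFun (funext fun t => ?_)
  rw [charFun_apply_real, integral_map (measurable_sampleMean n).aemeasurable (by fun_prop)]
  have e : ∀ x : Fin n → ℝ, Complex.exp (t * (sampleMean n x : ℝ) * Complex.I) =
      ∏ i, Complex.exp ((t / n : ℝ) * (x i) * Complex.I) := by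
    intro x
    rw [← Complex.exp_sum, sampleMean]
    congr 1
    push_cast
    rw [Finset.sum_div, Finset.mul_sum, Finset.sum_mul]
    refine Finset.sum_congr rfl fun i _ => ?_
    ring
  simp only [e]
  rw [integral_fintype_prod_eq_prod (fun (_ : Fin n) (x : ℝ) =>
    Complex.exp ((t / n : ℝ) * x * Complex.I)), ← charFun_apply_real,
    ProbabilityTheory.charFun_gaussianReal, ProbabilityTheory.charFun_gaussianReal,
    Finset.prod_const, Finset.card_univ, Fintype.card_fin, ← Complex.exp_nat_mul]
  congr 1
  push_cast
  field_simp

theorem tailProb_positionMeanEstimator {N : ℝ} (hN : 0 < N) (θ ε : ℝ) {n : ℕ} (hn : n ≠ 0) :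
    tailProb (fun t : ℝ => gaussianState N (t : ℂ)) positionMeanEstimator θ ε n =
      (ProbabilityTheory.gaussianReal θ (positionVar N / n) {x | ε < |x - θ|}).toReal := by
  have hm : MeasurableSet {x : ℝ | ε < |x - θ|} := measurableSet_lt (by fun_prop) (by fun_prop)
  rw [tailProb, measureProb, positionMeanEstimator, POVM.map,
    measureProb_jointPosition hN θ n (measurable_sampleMean n hm),
    ← Measure.map_apply (measurable_sampleMean n) hm, map_sampleMean_gaussianReal θ _ hn]

/-! ## Gaussian large deviations -/

/-- Beyond the endpoint m = θ ± ε one has (x − θ)² ≥ ε² + (x − m)². The density is thus at most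
e^{-ε²/(2v)} times the Gaussian density centred at m, whose mass is at most 1. The two half-lines
give the factor 2. -/
theorem gaussianReal_tail_le (θ : ℝ) {v : NNReal} (hv : v ≠ 0) {ε : ℝ} (hε : 0 ≤ ε) :
    ProbabilityTheory.gaussianReal θ v {x | ε < |x - θ|} ≤
      ENNReal.ofReal (2 * Real.exp (-ε ^ 2 / (2 * v))) := by
  have hv0 : (0 : ℝ) < v := by positivity
  have key : ∀ (s : Set ℝ) (m : ℝ), MeasurableSet s →
      (∀ x ∈ s, ε ^ 2 + (x - m) ^ 2 ≤ (x - θ) ^ 2) →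
      ProbabilityTheory.gaussianReal θ v s ≤ ENNReal.ofReal (Real.exp (-ε ^ 2 / (2 * v))) := by
    intro s m hs h
    calc ProbabilityTheory.gaussianReal θ v s
        = ∫⁻ x in s, ProbabilityTheory.gaussianPDF θ v x :=
          ProbabilityTheory.gaussianReal_apply _ hv _
      _ ≤ ∫⁻ x in s, ENNReal.ofReal (Real.exp (-ε ^ 2 / (2 * v))) *
            ProbabilityTheory.gaussianPDF m v x := by
          refine setLIntegral_mono' hs fun x hx => ?_
          rw [ProbabilityTheory.gaussianPDF, ProbabilityTheory.gaussianPDF,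
            ← ENNReal.ofReal_mul (by positivity)]
          refine ENNReal.ofReal_le_ofReal ?_
          rw [ProbabilityTheory.gaussianPDFReal, ProbabilityTheory.gaussianPDFReal,
            mul_left_comm, ← Real.exp_add, ← add_div]
          gcongr
          linarith [h x hx]
      _ = ENNReal.ofReal (Real.exp (-ε ^ 2 / (2 * v))) *
            ProbabilityTheory.gaussianReal m v s := by
          rw [lintegral_const_mul _ (ProbabilityTheory.measurable_gaussianPDF _ _),
            ProbabilityTheory.gaussianReal_apply _ hv]
      _ ≤ ENNReal.ofReal (Real.exp (-ε ^ 2 / (2 * v))) * 1 := by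
          gcongr
          exact prob_le_one
      _ = _ := mul_one _
  have hsub : {x : ℝ | ε < |x - θ|} ⊆ Set.Ioi (θ + ε) ∪ Set.Iio (θ - ε) := by
    intro x hx
    rcases lt_abs.1 (show ε < |x - θ| from hx) with h | h
    · exact Or.inl (by simp only [Set.mem_Ioi]; linarith)
    · exact Or.inr (by simp only [Set.mem_Iio]; linarith)
  refine (measure_mono hsub).trans ((measure_union_le _ _).trans ?_)
  rw [two_mul, ENNReal.ofReal_add (by positivity) (by positivity)]
  refine add_le_add (key _ (θ + ε) measurableSet_Ioi fun x hx => ?_)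
    (key _ (θ - ε) measurableSet_Iio fun x hx => ?_)
  · simp only [Set.mem_Ioi] at hx
    nlinarith
  · simp only [Set.mem_Iio] at hx
    nlinarith

/-- Only an interval of length `δ` just beyond θ + ε is kept, with the density bounded below by its
value at the far end. -/
theorem le_gaussianReal_tail (θ : ℝ) {v : NNReal} (hv : v ≠ 0) {ε δ : ℝ} (hε : 0 ≤ ε)
    (hδ : 0 ≤ δ) :
    ENNReal.ofReal (δ * ((√(2 * Real.pi * v))⁻¹ * Real.exp (-(ε + δ) ^ 2 / (2 * v)))) ≤
      ProbabilityTheory.gaussianReal θ v {x | ε < |x - θ|} := by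
  have hv0 : (0 : ℝ) < v := by positivity
  have hsub : Set.Ioc (θ + ε) (θ + ε + δ) ⊆ {x : ℝ | ε < |x - θ|} := fun x hx =>
    show ε < |x - θ| from lt_abs.2 (Or.inl (by linarith [hx.1]))
  refine le_trans ?_ (measure_mono hsub)
  rw [ProbabilityTheory.gaussianReal_apply _ hv]
  calc _ = ∫⁻ _ in Set.Ioc (θ + ε) (θ + ε + δ),
        ENNReal.ofReal ((√(2 * Real.pi * v))⁻¹ * Real.exp (-(ε + δ) ^ 2 / (2 * v))) := by
        rw [setLIntegral_const, Real.volume_Ioc, add_sub_cancel_left, ENNReal.ofReal_mul hδ,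
          mul_comm]
    _ ≤ _ := by
        refine setLIntegral_mono' measurableSet_Ioc fun x hx => ?_
        rw [ProbabilityTheory.gaussianPDF, ProbabilityTheory.gaussianPDFReal]
        refine ENNReal.ofReal_le_ofReal ?_
        have h : (x - θ) ^ 2 ≤ (ε + δ) ^ 2 :=
          pow_le_pow_left₀ (by linarith [hx.1]) (by linarith [hx.2]) 2
        gcongr

theorem tendsto_gaussianReal_tail_exponent (θ : ℝ) {v : NNReal} (hv : v ≠ 0) {ε : ℝ}
    (hε : 0 ≤ ε) :
    (∀ᶠ n : ℕ in atTop, 0 < (ProbabilityTheory.gaussianReal θ (v / n) {x | ε < |x - θ|}).toReal) ∧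
    Tendsto (fun n : ℕ =>
      -Real.log (ProbabilityTheory.gaussianReal θ (v / n) {x | ε < |x - θ|}).toReal / n)
      atTop (𝓝 (ε ^ 2 / (2 * v))) := by
  have hv0 : (0 : ℝ) < v := by positivity
  set p : ℕ → ℝ := fun n =>
    (ProbabilityTheory.gaussianReal θ (v / n) {x | ε < |x - θ|}).toReal with hp
  -- The interval length is δ = 1/n: it shifts ε by a vanishing amount and costs only (log n)/n in
  -- the exponent. The factor (2πv/n)^{-1/2} is at least 1 once n ≥ 2πv and is dropped.
  have hlow : ∀ᶠ n : ℕ in atTop,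
      1 / (n : ℝ) * Real.exp (-(n * (ε + 1 / n) ^ 2 / (2 * v))) ≤ p n := by
    filter_upwards [eventually_ge_atTop 1, (tendsto_natCast_atTop_atTop (R := ℝ)).eventually_ge_atTop
      (2 * Real.pi * v)] with n hn hn2
    have hn0 : (0 : ℝ) < n := by exact_mod_cast hn
    have hvn : v / n ≠ 0 := div_ne_zero hv (by exact_mod_cast (by omega : n ≠ 0))
    have h := le_gaussianReal_tail θ hvn hε (δ := 1 / n) (by positivity)
    have h2 := (ENNReal.ofReal_le_iff_le_toReal (measure_ne_top _ _)).1 h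
    refine le_trans ?_ h2
    have h3 : 1 ≤ (√(2 * Real.pi * (v / n : NNReal)))⁻¹ := by
      refine (one_le_inv₀ ?_).2 ?_
      · push_cast
        positivity
      · rw [Real.sqrt_le_one]
        push_cast
        rw [← mul_div_assoc, div_le_one hn0]
        exact hn2
    have h4 : -(ε + 1 / (n : ℝ)) ^ 2 / (2 * (v / n : NNReal)) =
        -(n * (ε + 1 / n) ^ 2 / (2 * v)) := by
      push_cast
      field_simp
    rw [h4]
    gcongr
    exact le_mul_of_one_le_left (Real.exp_pos _).le h3
  have hpos : ∀ᶠ n : ℕ in atTop, 0 < p n := by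
    filter_upwards [hlow, eventually_ge_atTop 1] with n hn hn1
    have hn0 : (0 : ℝ) < n := by exact_mod_cast hn1
    exact lt_of_lt_of_le (by positivity) hn
  refine ⟨hpos, ?_⟩
  have hlogn : Tendsto (fun n : ℕ => Real.log n / n) atTop (𝓝 0) :=
    Real.isLittleO_log_id_atTop.tendsto_div_nhds_zero.comp tendsto_natCast_atTop_atTop
  have hinv : Tendsto (fun n : ℕ => 1 / (n : ℝ)) atTop (𝓝 0) := tendsto_one_div_atTop_nhds_zero_nat
  have hL : Tendsto (fun n : ℕ => ε ^ 2 / (2 * v) - Real.log 2 * (1 / (n : ℝ))) atTop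
      (𝓝 (ε ^ 2 / (2 * v))) := by
    simpa using (tendsto_const_nhds (x := ε ^ 2 / (2 * (v : ℝ)))).sub (hinv.const_mul (Real.log 2))
  have hU : Tendsto (fun n : ℕ => Real.log n / n + (ε + 1 / (n : ℝ)) ^ 2 / (2 * v)) atTop
      (𝓝 (ε ^ 2 / (2 * v))) := by
    simpa using hlogn.add (((hinv.const_add ε).pow 2).div_const (2 * (v : ℝ)))
  refine tendsto_of_tendsto_of_tendsto_of_le_of_le' hL hU ?_ ?_
  · filter_upwards [hpos, eventually_ge_atTop 1] with n hn hn1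
    have hn0 : (0 : ℝ) < n := by exact_mod_cast hn1
    have hvn : v / n ≠ 0 := div_ne_zero hv (by exact_mod_cast (by omega : n ≠ 0))
    have h := ENNReal.toReal_le_of_le_ofReal (by positivity) (gaussianReal_tail_le θ hvn hε)
    have h2 := Real.log_le_log hn h
    rw [Real.log_mul two_ne_zero (Real.exp_pos _).ne', Real.log_exp] at h2
    rw [le_div_iff₀ hn0]
    have h3 : -ε ^ 2 / (2 * (v / n : NNReal)) = -(ε ^ 2 / (2 * v) * n) := by
      push_cast
      field_simp
    rw [h3] at h2
    have h4 : (ε ^ 2 / (2 * v) - Real.log 2 * (1 / (n : ℝ))) * n =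
        ε ^ 2 / (2 * v) * n - Real.log 2 := by
      field_simp
    linarith
  · filter_upwards [hlow, eventually_ge_atTop 1] with n hn hn1
    have hn0 : (0 : ℝ) < n := by exact_mod_cast hn1
    have h2 := Real.log_le_log (by positivity) hn
    rw [Real.log_mul (by positivity) (Real.exp_pos _).ne', Real.log_exp, one_div, Real.log_inv]
      at h2
    rw [div_le_iff₀ hn0]
    have h4 : (Real.log n / n + (ε + 1 / (n : ℝ)) ^ 2 / (2 * v)) * n =
        Real.log n + n * (ε + (n : ℝ)⁻¹) ^ 2 / (2 * v) := by
      field_simp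
    linarith

theorem tendsto_tailExponent {N : ℝ} (hN : 0 < N) (θ : ℝ) {ε : ℝ} (hε : 0 < ε) :
    Tendsto (tailExponent (fun t : ℝ => gaussianState N (t : ℂ)) positionMeanEstimator θ ε) atTop
      (𝓝 ((ε ^ 2 / (N + 1 / 2) : ℝ) : EReal)) := by
  obtain ⟨h1, h2⟩ := tendsto_gaussianReal_tail_exponent θ (positionVar_ne_zero hN) hε.le
  have e : ε ^ 2 / (2 * (positionVar N : ℝ)) = ε ^ 2 / (N + 1 / 2) := by
    rw [coe_positionVar hN]; congr 1; ring
  rw [e] at h2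
  refine (EReal.tendsto_coe.2 h2).congr' ?_
  filter_upwards [h1, eventually_ge_atTop 1] with n hn hn1
  rw [tailExponent, tailProb_positionMeanEstimator hN θ ε (by omega), ENNReal.log_ofReal_of_pos hn,
    EReal.coe_div, EReal.coe_neg]
  rfl

/-- The exponent is exactly quadratic in `ε`, so the quotient is constant; the limit ε ↓ 0 and its
uniformity in θ are then immediate. -/
theorem betaLower_div_sq {N : ℝ} (hN : 0 < N) (θ : ℝ) {ε : ℝ} (hε : 0 < ε) :
    betaLower (fun t : ℝ => gaussianState N (t : ℂ)) positionMeanEstimator θ ε /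
      ((ε ^ 2 : ℝ) : EReal) = ((1 / (N + 1 / 2) : ℝ) : EReal) := by
  rw [betaLower, (tendsto_tailExponent hN θ hε).liminf_eq, ← EReal.coe_div]
  congr 1
  field_simp

theorem betaUpper_div_sq {N : ℝ} (hN : 0 < N) (θ : ℝ) {ε : ℝ} (hε : 0 < ε) :
    betaUpper (fun t : ℝ => gaussianState N (t : ℂ)) positionMeanEstimator θ ε /
      ((ε ^ 2 : ℝ) : EReal) = ((1 / (N + 1 / 2) : ℝ) : EReal) := by
  rw [betaUpper, (tendsto_tailExponent hN θ hε).limsup_eq, ← EReal.coe_div]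
  congr 1
  field_simp

theorem alphaLower_positionMeanEstimator {N : ℝ} (hN : 0 < N) (θ : ℝ) :
    alphaLower (fun t : ℝ => gaussianState N (t : ℂ)) positionMeanEstimator θ =
      ((1 / (N + 1 / 2) : ℝ) : EReal) := by
  refine Tendsto.liminf_eq (tendsto_const_nhds.congr' ?_)
  filter_upwards [self_mem_nhdsWithin] with ε hε
  exact (betaLower_div_sq hN θ hε).symm

theorem alphaUpper_positionMeanEstimator {N : ℝ} (hN : 0 < N) (θ : ℝ) :
    alphaUpper (fun t : ℝ => gaussianState N (t : ℂ)) positionMeanEstimator θ =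
      ((1 / (N + 1 / 2) : ℝ) : EReal) := by
  refine Tendsto.limsup_eq (tendsto_const_nhds.congr' ?_)
  filter_upwards [self_mem_nhdsWithin] with ε hε
  exact (betaUpper_div_sq hN θ hε).symm

theorem stronglyConsistentOn_positionMeanEstimator {N : ℝ} (hN : 0 < N) :
    StronglyConsistentOn (fun t : ℝ => gaussianState N (t : ℂ)) positionMeanEstimator
      Set.univ := by
  refine ⟨fun _ => 1 / (N + 1 / 2), continuousOn_const, fun θ _ =>
    alphaLower_positionMeanEstimator hN θ, fun η hη => ⟨1, one_pos, fun ε hε _ θ _ => ?_⟩⟩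
  rw [betaLower_div_sq hN θ hε, EReal.coe_le_coe_iff, EReal.coe_le_coe_iff]
  constructor <;> linarith

/-! ## Uniqueness of the symmetric logarithmic derivative on the range of `√ρ` -/

section SLD

variable {H : Type*} [NormedAddCommGroup H] [InnerProductSpace ℂ H]

theorem HilbertBasis.tsum_enorm_inner_sq {ι : Type*} (b : HilbertBasis ι ℂ H) (x : H) :
    ∑' i, ‖⟪b i, x⟫_ℂ‖ₑ ^ 2 = ‖x‖ₑ ^ 2 := by
  have h3 := b.hasSum_norm_inner_sq x
  have h4 : ∀ z : ℂ, ‖z‖ₑ ^ 2 = ENNReal.ofReal (‖z‖ ^ 2) := fun z => by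
    rw [← ofReal_norm, ENNReal.ofReal_pow (norm_nonneg _)]
  simp only [h4]
  rw [← ENNReal.ofReal_tsum_of_nonneg (fun i => by positivity) h3.summable, h3.tsum_eq,
    ← ofReal_norm, ENNReal.ofReal_pow (norm_nonneg _)]

variable [CompleteSpace H]

theorem LinearPMap.inner_apply_of_isSelfAdjoint {L : H →ₗ.[ℂ] H} (hL : IsSelfAdjoint L)
    (x y : L.domain) : ⟪L x, (y : H)⟫_ℂ = ⟪(x : H), L y⟫_ℂ := by
  have h := LinearPMap.adjoint_isFormalAdjoint hL.dense_domain
  rw [LinearPMap.isSelfAdjoint_def.1 hL] at h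
  exact h x y

/-- The composition of a closed operator with a bounded operator whose range lies in the domain is
bounded. -/
theorem LinearPMap.IsClosed.exists_comp_eq {L : H →ₗ.[ℂ] H} (hL : L.IsClosed) (R : H →L[ℂ] H)
    (hR : ∀ ψ, R ψ ∈ L.domain) : ∃ X : H →L[ℂ] H, ∀ ψ, X ψ = L ⟨R ψ, hR ψ⟩ := by
  let T : H →ₗ[ℂ] H := L.toFun ∘ₗ R.toLinearMap.codRestrict L.domain hR
  have hT : ∀ ψ, T ψ = L ⟨R ψ, hR ψ⟩ := fun ψ => rfl
  refine ⟨ContinuousLinearMap.ofSeqClosedGraph (g := T) fun u x y hu hy => ?_, fun ψ => rfl⟩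
  have h1 : Tendsto (fun k => (R (u k), T (u k))) atTop (𝓝 (R x, y)) :=
    ((R.continuous.tendsto x).comp hu).prodMk_nhds hy
  have h2 : (R x, y) ∈ L.graph := hL.mem_of_tendsto h1 (Eventually.of_forall fun k => by
    rw [hT]
    exact L.mem_graph ⟨R (u k), hR (u k)⟩)
  obtain ⟨z, hz1, hz2⟩ := (LinearPMap.mem_graph_iff L).1 h2
  exact hz2.symm.trans (congrArg L (Subtype.ext hz1))

/-- The square root of an operator on a Hilbert space. -/
abbrev opSqrt (A : H →L[ℂ] H) : H →L[ℂ] H := CFC.sqrt A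

theorem CFC.isSelfAdjoint_sqrt_clm (A : H →L[ℂ] H) : IsSelfAdjoint (CFC.sqrt A) :=
  (CFC.sqrt_nonneg A).isSelfAdjoint

theorem inner_sqrt_left (A : H →L[ℂ] H) (φ ψ : H) :
    ⟪opSqrt A φ, ψ⟫_ℂ = ⟪φ, opSqrt A ψ⟫_ℂ := by
  have h := CFC.isSelfAdjoint_sqrt_clm A
  rw [← ContinuousLinearMap.adjoint_inner_right, ← ContinuousLinearMap.star_eq_adjoint, h.star_eq]

theorem sqrt_sqrt_apply {A : H →L[ℂ] H} (hA : 0 ≤ A) (ψ : H) :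
    opSqrt A (opSqrt A ψ) = A ψ := by
  conv_rhs => rw [← CFC.sqrt_mul_sqrt_self A hA]
  rfl

/-- A bounded solution `D` of `D r + r D* = 0`, with `r = √A` and `r D` self-adjoint, vanishes. -/
theorem eq_zero_of_mul_sqrt_add {A D : H →L[ℂ] H} (hA : 0 ≤ A) (hinj : ∀ ψ, A ψ = 0 → ψ = 0)
    (h1 : D * CFC.sqrt A + CFC.sqrt A * star D = 0)
    (h2 : star D * CFC.sqrt A = CFC.sqrt A * D) : D = 0 := by
  set r := CFC.sqrt A with hr
  have hrr : r * r = A := CFC.sqrt_mul_sqrt_self A hA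
  -- With r = √A: D A = (D r) r = −r (D* r) = −r (r D) = −A D.
  have h3 : D * A = -(A * D) := by
    have h4 : D * r = -(r * star D) := eq_neg_of_add_eq_zero_left h1
    rw [← hrr, ← mul_assoc, h4, neg_mul, mul_assoc, h2, ← mul_assoc]
  have h5 : Commute (A * A) D := by
    change A * A * D = D * (A * A)
    rw [← mul_assoc, h3, neg_mul, mul_assoc A D A, h3, mul_neg, neg_neg, mul_assoc]
  -- Anticommuting with A means commuting with A², hence by functional calculus with √(A²) = A. Both
  -- relations together force A D = 0.
  have h6 : Commute A D := by
    have := h5.cfcₙ_nnreal NNReal.sqrt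
    rwa [← CFC.sqrt, CFC.sqrt_mul_self A hA] at this
  have h7 : A * D = 0 := by
    have h8 : A * D = -(A * D) := h6.eq.trans h3
    have h9 : (2 : ℂ) • (A * D) = 0 := by rw [two_smul, ← eq_neg_iff_add_eq_zero]; exact h8
    exact (smul_eq_zero.1 h9).resolve_left two_ne_zero
  refine ContinuousLinearMap.ext fun ψ => hinj _ ?_
  exact congrArg (fun T : H →L[ℂ] H => T ψ) h7

/-- The closed graph theorem makes X = L√ρ bounded. Symmetry of L turns into X*√ρ = √ρ X, and Lρ =
X√ρ, so the unbounded equation becomes one between bounded operators. -/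
theorem IsSLD.exists_clm {ρ : ℝ → H →L[ℂ] H} {θ : ℝ} {L : H →ₗ.[ℂ] H} (h : IsSLD ρ θ L)
    (hpos : 0 ≤ ρ θ) : ∃ X : H →L[ℂ] H, (∀ ψ, X ψ = L ⟨CFC.sqrt (ρ θ) ψ, h.sqrt_mem ψ⟩) ∧
      star X * CFC.sqrt (ρ θ) = CFC.sqrt (ρ θ) * X ∧
      HasDerivAt ρ ((1 / 2 : ℂ) • (X * CFC.sqrt (ρ θ) + CFC.sqrt (ρ θ) * star X)) θ := by
  obtain ⟨X, hX⟩ := h.isSelfAdjoint.isClosed.exists_comp_eq (CFC.sqrt (ρ θ)) h.sqrt_mem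
  refine ⟨X, hX, ?_, ?_⟩
  · refine ContinuousLinearMap.ext fun ψ => ext_inner_right ℂ fun φ => ?_
    change ⟪star X (CFC.sqrt (ρ θ) ψ), φ⟫_ℂ = ⟪CFC.sqrt (ρ θ) (X ψ), φ⟫_ℂ
    rw [ContinuousLinearMap.star_eq_adjoint, ContinuousLinearMap.adjoint_inner_left,
      inner_sqrt_left (ρ θ) (X ψ), hX, hX]
    exact (LinearPMap.inner_apply_of_isSelfAdjoint h.isSelfAdjoint
      ⟨_, h.sqrt_mem ψ⟩ ⟨_, h.sqrt_mem φ⟩).symm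
  · obtain ⟨Y, hY, hd⟩ := h.hasDerivAt
    have e : Y = X * CFC.sqrt (ρ θ) := by
      refine ContinuousLinearMap.ext fun ψ => ?_
      change Y ψ = X (CFC.sqrt (ρ θ) ψ)
      rw [hY, hX]
      exact congrArg L (Subtype.ext (sqrt_sqrt_apply hpos ψ).symm)
    rw [e, ← ContinuousLinearMap.star_eq_adjoint, star_mul,
      (CFC.isSelfAdjoint_sqrt_clm (ρ θ)).star_eq] at hd
    exact hd

/-- The difference of the two bounded operators L√ρ solves the homogeneous equation, hence vanishes.
The Fisher information sees `L` only on the range of √ρ, so this agreement is all it needs. -/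
theorem IsSLD.apply_sqrt_eq {ρ : ℝ → H →L[ℂ] H} {θ : ℝ} (hpos : 0 ≤ ρ θ)
    (hinj : ∀ ψ, ρ θ ψ = 0 → ψ = 0) {L L' : H →ₗ.[ℂ] H} (h : IsSLD ρ θ L) (h' : IsSLD ρ θ L')
    (ψ : H) : L ⟨CFC.sqrt (ρ θ) ψ, h.sqrt_mem ψ⟩ = L' ⟨CFC.sqrt (ρ θ) ψ, h'.sqrt_mem ψ⟩ := by
  obtain ⟨X, hX, hs, hd⟩ := h.exists_clm hpos
  obtain ⟨X', hX', hs', hd'⟩ := h'.exists_clm hpos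
  have h1 := smul_right_injective _ (by norm_num : (1 / 2 : ℂ) ≠ 0) (hd.unique hd')
  have h2 : X - X' = 0 := by
    refine eq_zero_of_mul_sqrt_add hpos hinj ?_ ?_
    · rw [sub_mul, star_sub, mul_sub, sub_add_sub_comm, sub_eq_zero]
      exact h1
    · rw [star_sub, sub_mul, mul_sub, hs, hs']
  rw [← hX, ← hX', sub_eq_zero.1 h2]

theorem IsSLD.fisherInformation_eq {ρ : ℝ → H →L[ℂ] H} {θ : ℝ} (hpos : 0 ≤ ρ θ)
    (hinj : ∀ ψ, ρ θ ψ = 0 → ψ = 0) {L L' : H →ₗ.[ℂ] H} (h : IsSLD ρ θ L) (h' : IsSLD ρ θ L') :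
    h.fisherInformation = h'.fisherInformation := by
  simp only [IsSLD.fisherInformation, IsSLD.apply_sqrt_eq hpos hinj h h']

/-- The Hilbert-Schmidt norm of the adjoint. -/
theorem HilbertBasis.tsum_enorm_apply_sq {ι κ : Type*} (b : HilbertBasis ι ℂ H)
    (e : HilbertBasis κ ℂ H) (X : H →L[ℂ] H) :
    ∑' i, ‖X (b i)‖ₑ ^ 2 = ∑' j, ‖ContinuousLinearMap.adjoint X (e j)‖ₑ ^ 2 := by
  simp only [← fun i => e.tsum_enorm_inner_sq (X (b i)),
    ← fun j => b.tsum_enorm_inner_sq (ContinuousLinearMap.adjoint X (e j))]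
  rw [ENNReal.tsum_comm]
  refine tsum_congr fun j => tsum_congr fun i => ?_
  rw [ContinuousLinearMap.adjoint_inner_right, ← ofReal_norm, norm_inner_symm,
    ofReal_norm]

variable {A : Type*} [MeasurableSpace A] {μ : Measure A} [IsFiniteMeasure μ] {v : A → H}

/-- Both sides equal ⟨f, ρ f⟩. This replaces any explicit description of √ρ. -/
theorem enorm_sqrt_mixedState_sq (hv : AEStronglyMeasurable v μ) (h1 : ∀ a, ‖v a‖ = 1) (f : H) :
    ‖opSqrt (mixedState μ v) f‖ₑ ^ 2 = ∫⁻ a, ‖⟪v a, f⟫_ℂ‖ₑ ^ 2 ∂μ := by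
  have h2 : ‖CFC.sqrt (mixedState μ v) f‖ ^ 2 = ∫ a, ‖⟪v a, f⟫_ℂ‖ ^ 2 ∂μ := by
    apply Complex.ofReal_injective
    rw [← inner_mixedState_self hv h1, ← sqrt_sqrt_apply (mixedState_nonneg hv h1),
      ← inner_sqrt_left, inner_self_eq_norm_sq_to_K]
    simp
  have hi : Integrable (fun a => ‖⟪v a, f⟫_ℂ‖ ^ 2) μ := by
    refine (integrable_inner_mul_inner hv h1 f f).norm.congr (ae_of_all _ fun a => ?_)
    simp only
    rw [norm_mul, norm_inner_symm f, sq]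
  rw [← ofReal_norm, ← ENNReal.ofReal_pow (norm_nonneg _), h2,
    ofReal_integral_eq_lintegral_ofReal hi (ae_of_all _ fun a => by positivity)]
  refine lintegral_congr fun a => ?_
  rw [← ofReal_norm, ENNReal.ofReal_pow (norm_nonneg _)]

end SLD

/-! ## Multiplication operators -/

section Multiplication

variable {X : Type*} [MeasureSpace X]

/-- The operator of multiplication by a real function, on its maximal domain. -/
def mulPMap (m : X → ℝ) : HilbertL2 X →ₗ.[ℂ] HilbertL2 X where
  domain :=
    { carrier := {f | MemLp (fun x => (m x : ℂ) * f x) 2 volume}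
      add_mem' := fun {f g} hf hg => by
        refine (memLp_congr_ae ?_).1 (MemLp.add hf hg)
        filter_upwards [Lp.coeFn_add f g] with x hx
        rw [hx, Pi.add_apply, Pi.add_apply, mul_add]
      zero_mem' := by
        refine (memLp_congr_ae ?_).1 (MemLp.zero (ε := ℂ) (p := 2) (μ := volume))
        filter_upwards [Lp.coeFn_zero ℂ 2 (volume : Measure X)] with x hx
        simp only [hx, Pi.zero_apply, mul_zero]
      smul_mem' := fun c f hf => by
        refine (memLp_congr_ae ?_).1 (MemLp.const_smul hf c)
        filter_upwards [Lp.coeFn_smul c f] with x hx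
        rw [hx, Pi.smul_apply, Pi.smul_apply, smul_eq_mul, smul_eq_mul, mul_left_comm] }
  toFun :=
    { toFun := fun f => MemLp.toLp _ f.2
      map_add' := fun f g => by
        refine Lp.ext ?_
        refine (MemLp.coeFn_toLp _).trans ?_
        filter_upwards [Lp.coeFn_add (f : HilbertL2 X) g, MemLp.coeFn_toLp f.2,
          MemLp.coeFn_toLp g.2, Lp.coeFn_add (MemLp.toLp _ f.2) (MemLp.toLp _ g.2)]
          with x h1 h2 h3 h4
        rw [h4, Pi.add_apply, h2, h3, Submodule.coe_add, h1, Pi.add_apply, mul_add]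
      map_smul' := fun c f => by
        refine Lp.ext ?_
        refine (MemLp.coeFn_toLp _).trans ?_
        filter_upwards [Lp.coeFn_smul c (f : HilbertL2 X), MemLp.coeFn_toLp f.2,
          Lp.coeFn_smul c (MemLp.toLp _ f.2)] with x h1 h2 h3
        rw [RingHom.id_apply, h3, Pi.smul_apply, h2, Submodule.coe_smul, h1, Pi.smul_apply,
          smul_eq_mul, smul_eq_mul, mul_left_comm] }

theorem mem_mulPMap_domain {m : X → ℝ} {f : HilbertL2 X} :
    f ∈ (mulPMap m).domain ↔ MemLp (fun x => (m x : ℂ) * f x) 2 volume := Iff.rfl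

theorem mulPMap_coeFn (m : X → ℝ) (f : (mulPMap m).domain) :
    mulPMap m f =ᵐ[volume] fun x => (m x : ℂ) * (f : HilbertL2 X) x :=
  MemLp.coeFn_toLp (mem_mulPMap_domain.1 f.2)

theorem inner_mulPMap_right (m : X → ℝ) (g : HilbertL2 X) (f : (mulPMap m).domain) :
    ⟪g, mulPMap m f⟫_ℂ = ∫ x, starRingEnd ℂ (m x * g x) * (f : HilbertL2 X) x := by
  rw [L2.inner_def]
  refine integral_congr_ae ?_
  filter_upwards [mulPMap_coeFn m f] with x hx
  rw [hx, RCLike.inner_apply', map_mul, Complex.conj_ofReal]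
  ring

theorem mulPMap_isFormalAdjoint (m : X → ℝ) : (mulPMap m).IsFormalAdjoint (mulPMap m) := by
  intro f g
  rw [inner_mulPMap_right, L2.inner_def]
  refine integral_congr_ae ?_
  filter_upwards [mulPMap_coeFn m f] with x hx
  rw [hx, RCLike.inner_apply']

/-- The function z − m g cut off to {|m| ≤ n} lies in the domain; testing against it shows that its
norm is 0, and these sets exhaust the space. Density of the domain (with g = 0) and self-adjointness
both follow. -/
theorem ae_eq_mul_of_inner_mulPMap {m : X → ℝ} (hm : Measurable m) {z g : HilbertL2 X}
    (h : ∀ f : (mulPMap m).domain, ⟪z, (f : HilbertL2 X)⟫_ℂ = ⟪g, mulPMap m f⟫_ℂ) :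
    z =ᵐ[volume] fun x => (m x : ℂ) * g x := by
  have key : ∀ n : ℕ, ∀ᵐ x, |m x| ≤ n → z x = m x * g x := by
    intro n
    have hS : MeasurableSet {x | |m x| ≤ n} := measurableSet_le hm.abs measurable_const
    set S := {x | |m x| ≤ n} with hSdef
    set k : X → ℂ := S.indicator fun x => z x - m x * g x with hk
    have hmeas : AEStronglyMeasurable k volume := by
      refine ((Lp.aestronglyMeasurable z).sub ?_).indicator hS
      exact (Complex.measurable_ofReal.comp hm).aestronglyMeasurable.mul (Lp.aestronglyMeasurable g)
    have hkL : MemLp k 2 volume := by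
      refine MemLp.of_le ((Lp.memLp z).norm.add ((Lp.memLp g).norm.const_mul (n : ℝ))) hmeas
        (ae_of_all _ fun x => ?_)
      refine le_trans ?_ (le_abs_self _)
      by_cases hx : x ∈ S
      · rw [hk, Set.indicator_of_mem hx]
        refine (norm_sub_le _ _).trans ?_
        rw [norm_mul, Complex.norm_real, Real.norm_eq_abs]
        have hx' : |m x| ≤ n := hx
        simp only [Pi.add_apply]
        gcongr
      · rw [hk, Set.indicator_of_notMem hx, norm_zero]
        simp only [Pi.add_apply]
        positivity
    have hmk : MemLp (fun x => (m x : ℂ) * hkL.toLp k x) 2 volume := by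
      refine MemLp.of_le (hkL.norm.const_mul (n : ℝ))
        ((Complex.measurable_ofReal.comp hm).aestronglyMeasurable.mul
          (Lp.aestronglyMeasurable _)) ?_
      filter_upwards [hkL.coeFn_toLp] with x hx
      rw [hx, norm_mul, Complex.norm_real, Real.norm_eq_abs,
        Real.norm_of_nonneg (by positivity)]
      by_cases hxS : x ∈ S
      · have hx' : |m x| ≤ n := hxS
        gcongr
      · rw [hk, Set.indicator_of_notMem hxS, norm_zero, mul_zero, mul_zero]
    let f : (mulPMap m).domain := ⟨hkL.toLp k, hmk⟩
    have h1 : ⟪(f : HilbertL2 X), (f : HilbertL2 X)⟫_ℂ = 0 := by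
      have h2 := h f
      have hi1 : Integrable (fun x => ⟪z x, (f : HilbertL2 X) x⟫_ℂ) := L2.integrable_inner z f
      have hi2 : Integrable (fun x => starRingEnd ℂ (m x * g x) * (f : HilbertL2 X) x) := by
        refine (L2.integrable_inner (𝕜 := ℂ) g (mulPMap m f)).congr ?_
        filter_upwards [mulPMap_coeFn m f] with x hx
        rw [hx, RCLike.inner_apply', map_mul, Complex.conj_ofReal]
        ring
      rw [inner_mulPMap_right, L2.inner_def, ← sub_eq_zero, ← integral_sub hi1 hi2] at h2
      rw [L2.inner_def, ← h2]
      refine integral_congr_ae ?_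
      filter_upwards [hkL.coeFn_toLp] with x hx
      have hfx : (f : HilbertL2 X) x = k x := hx
      rw [hfx, RCLike.inner_apply', RCLike.inner_apply', ← sub_mul, ← map_sub]
      by_cases hxS : x ∈ S
      · rw [hk, Set.indicator_of_mem hxS]
      · rw [hk, Set.indicator_of_notMem hxS, mul_zero, mul_zero]
    have h3 : hkL.toLp k = 0 := inner_self_eq_zero.1 h1
    have h4 := hkL.coeFn_toLp
    rw [h3] at h4
    filter_upwards [h4, Lp.coeFn_zero ℂ 2 (volume : Measure X)] with x hx h0 hxS
    rw [h0, Pi.zero_apply, hk, Set.indicator_of_mem (show x ∈ S from hxS)] at hx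
    exact sub_eq_zero.1 hx.symm
  filter_upwards [ae_all_iff.2 key] with x hx
  obtain ⟨n, hn⟩ := exists_nat_ge |m x|
  exact hx n hn

theorem dense_mulPMap_domain {m : X → ℝ} (hm : Measurable m) :
    Dense ((mulPMap m).domain : Set (HilbertL2 X)) := by
  rw [Submodule.dense_iff_topologicalClosure_eq_top, Submodule.topologicalClosure_eq_top_iff,
    Submodule.eq_bot_iff]
  intro g hg
  have h := ae_eq_mul_of_inner_mulPMap hm (z := g) (g := 0) fun f => by
    rw [inner_zero_left, ← inner_conj_symm, (Submodule.mem_orthogonal _ _).1 hg _ f.2, map_zero]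
  refine Lp.ext ?_
  filter_upwards [h, Lp.coeFn_zero ℂ 2 (volume : Measure X)] with x h1 h2
  rw [h1, h2, Pi.zero_apply, mul_zero]

/-- By symmetry the adjoint is an extension. On a vector y of its domain it can only be
multiplication by `m`, so m y is in L² and y is already in the original domain. -/
theorem isSelfAdjoint_mulPMap {m : X → ℝ} (hm : Measurable m) : IsSelfAdjoint (mulPMap m) := by
  have hd := dense_mulPMap_domain hm
  rw [LinearPMap.isSelfAdjoint_def]
  refine (LinearPMap.eq_of_le_of_domain_eq ((mulPMap_isFormalAdjoint m).le_adjoint hd) ?_).symm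
  refine le_antisymm ((mulPMap_isFormalAdjoint m).le_adjoint hd).1 fun y hy => ?_
  have h := ae_eq_mul_of_inner_mulPMap hm
    (fun f => LinearPMap.adjoint_isFormalAdjoint hd ⟨y, hy⟩ f)
  exact mem_mulPMap_domain.2 ((memLp_congr_ae h).1 (Lp.memLp _))

end Multiplication

/-! ## Affine functions of the position -/

/-- The operator `κ (Q - θ)`. -/
abbrev positionPMap (κ θ : ℝ) : HilbertL2 ℝ →ₗ.[ℂ] HilbertL2 ℝ := mulPMap fun x => κ * (x - θ)

theorem isSelfAdjoint_positionPMap (κ θ : ℝ) : IsSelfAdjoint (positionPMap κ θ) :=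
  isSelfAdjoint_mulPMap (by fun_prop)

theorem memLp_two_of_norm_sq_eq {f : ℝ → ℂ} (hf : Continuous f) (p : Polynomial ℝ) (c : ℝ)
    (h : ∀ x, ‖f x‖ ^ 2 = p.eval (x - c) * Real.exp (-2 * (x - c) ^ 2)) : MemLp f 2 volume := by
  rw [memLp_two_iff_integrable_sq_norm hf.aestronglyMeasurable]
  simp only [h]
  exact (integrable_eval_mul_exp p).comp_sub_right c

theorem coherentVec_mem_domain (κ θ : ℝ) (α : ℂ) : coherentVec α ∈ (positionPMap κ θ).domain := by
  rw [mem_mulPMap_domain]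
  have e : (fun x => ((κ * (x - θ) : ℝ) : ℂ) * coherentVec α x) =ᵐ[volume]
      fun x => ((κ * (x - θ) : ℝ) : ℂ) * coherentFun α x := by
    filter_upwards [coherentVec_coeFn α] with x hx
    rw [hx]
  rw [memLp_congr_ae e]
  -- The polynomial is in the centred variable x − `Re α`, in which x − θ becomes X + (`Re α` − θ).
  refine memLp_two_of_norm_sq_eq ?_ (Polynomial.C (κ ^ 2 * √(2 / Real.pi)) *
    (Polynomial.X + Polynomial.C (α.re - θ)) ^ 2) α.re fun x => ?_
  · have := continuous_coherentFun α
    fun_prop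
  · rw [norm_mul, mul_pow, norm_coherentFun_sq, Complex.norm_real, Real.norm_eq_abs, sq_abs]
    simp only [Polynomial.eval_mul, Polynomial.eval_C, Polynomial.eval_pow, Polynomial.eval_add,
      Polynomial.eval_X]
    ring

theorem continuous_hermiteFun (k : ℕ) : Continuous (hermiteFun k) := by
  unfold hermiteFun
  simp only [Polynomial.aeval_def, Polynomial.eval₂_eq_eval_map]
  fun_prop

theorem numberVec_mem_domain (κ θ : ℝ) (k : ℕ) : numberVec k ∈ (positionPMap κ θ).domain := by
  rw [mem_mulPMap_domain]
  have e : (fun x => ((κ * (x - θ) : ℝ) : ℂ) * numberVec k x) =ᵐ[volume]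
      fun x => ((κ * (x - θ) : ℝ) : ℂ) * hermiteFun k x := by
    filter_upwards [(memLp_hermiteFun k).coeFn_toLp] with x hx
    rw [numberVec, hx]
  rw [memLp_congr_ae e]
  refine memLp_two_of_norm_sq_eq ?_ (Polynomial.C (κ ^ 2 * (√(2 / Real.pi) /
    (√(k.factorial : ℝ) * √(k.factorial : ℝ)))) * (Polynomial.X - Polynomial.C θ) ^ 2 *
    (hermiteTwo k * hermiteTwo k)) 0 fun x => ?_
  · have := continuous_hermiteFun k
    fun_prop
  · have h := hermiteFun_mul_hermiteFun k k x
    rw [mul_comm, Complex.mul_conj, Complex.normSq_eq_norm_sq] at h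
    rw [norm_mul, mul_pow, Complex.norm_real, Real.norm_eq_abs, sq_abs,
      Complex.ofReal_injective h]
    simp only [Polynomial.eval_mul, Polynomial.eval_C, Polynomial.eval_pow, Polynomial.eval_sub,
      Polynomial.eval_X, sub_zero]
    ring

theorem inner_positionPMap_right (κ θ : ℝ) (β α : ℂ) :
    ⟪coherentVec β, positionPMap κ θ ⟨coherentVec α, coherentVec_mem_domain κ θ α⟩⟫_ℂ =
      ∫ x : ℝ, ((κ * (x - θ) : ℝ) : ℂ) * (starRingEnd ℂ (coherentFun β x) * coherentFun α x) := by
  rw [inner_mulPMap_right]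
  refine integral_congr_ae ?_
  filter_upwards [coherentVec_coeFn β, coherentVec_coeFn α] with x h1 h2
  rw [h1, h2, map_mul, Complex.conj_ofReal, mul_assoc]

theorem integrable_mul_conj_coherentFun (κ θ : ℝ) (β α : ℂ) : Integrable fun x : ℝ =>
    ((κ * (x - θ) : ℝ) : ℂ) * (starRingEnd ℂ (coherentFun β x) * coherentFun α x) := by
  refine (L2.integrable_inner (𝕜 := ℂ) (coherentVec β)
    (positionPMap κ θ ⟨coherentVec α, coherentVec_mem_domain κ θ α⟩)).congr ?_
  filter_upwards [coherentVec_coeFn β, coherentVec_coeFn α,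
    mulPMap_coeFn _ ⟨coherentVec α, coherentVec_mem_domain κ θ α⟩] with x h1 h2 h3
  rw [h3, h1, h2, RCLike.inner_apply']
  ring

theorem integrable_conj_coherentFun_mul (β α : ℂ) : Integrable fun x : ℝ =>
    starRingEnd ℂ (coherentFun β x) * coherentFun α x := by
  refine (L2.integrable_inner (𝕜 := ℂ) (coherentVec β) (coherentVec α)).congr ?_
  filter_upwards [coherentVec_coeFn β, coherentVec_coeFn α] with x h1 h2
  rw [h1, h2, RCLike.inner_apply']

theorem inner_coherentVec_eq_integral (β α : ℂ) : ⟪coherentVec β, coherentVec α⟫_ℂ =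
    ∫ x : ℝ, starRingEnd ℂ (coherentFun β x) * coherentFun α x := by
  rw [L2.inner_def]
  refine integral_congr_ae ?_
  filter_upwards [coherentVec_coeFn β, coherentVec_coeFn α] with x h1 h2
  rw [h1, h2, RCLike.inner_apply']

/-- The product f of the two wave functions satisfies f' = (−4x + 2(β̄ + α)) f, and f' integrates to
0. -/
theorem integral_mul_conj_coherentFun (β α : ℂ) :
    ∫ x : ℝ, (x : ℂ) * (starRingEnd ℂ (coherentFun β x) * coherentFun α x) =
      (starRingEnd ℂ β + α) / 2 * ∫ x : ℝ, starRingEnd ℂ (coherentFun β x) * coherentFun α x := by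
  have hi := integrable_conj_coherentFun_mul β α
  have hi1 : Integrable fun x : ℝ =>
      (x : ℂ) * (starRingEnd ℂ (coherentFun β x) * coherentFun α x) := by
    simpa using integrable_mul_conj_coherentFun 1 0 β α
  have hd : ∀ x : ℝ, HasDerivAt (fun x : ℝ => starRingEnd ℂ (coherentFun β x) * coherentFun α x)
      (-4 * ((x : ℂ) * (starRingEnd ℂ (coherentFun β x) * coherentFun α x)) +
        2 * (starRingEnd ℂ β + α) * (starRingEnd ℂ (coherentFun β x) * coherentFun α x)) x := by
    intro x
    simp only [conj_coherentFun_mul]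
    set d : ℂ := -(‖α‖ ^ 2 : ℝ) / 2 - (‖β‖ ^ 2 : ℝ) / 2 - (starRingEnd ℂ β ^ 2 + α ^ 2) / 2
    set s : ℂ := starRingEnd ℂ β + α
    have h1 : HasDerivAt (fun x : ℝ => (x : ℂ)) 1 x := Complex.ofRealCLM.hasDerivAt
    have h2 := ((((h1.pow 2).const_mul (-2)).add (h1.const_mul (2 * s))).add_const d).cexp.const_mul
      (√(2 / Real.pi) : ℂ)
    refine (h2.congr_deriv ?_)
    simp only [Pi.add_apply, Pi.pow_apply]
    push_cast
    ring
  have h := integral_eq_zero_of_hasDerivAt_of_integrable hd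
    ((hi1.const_mul _).add (hi.const_mul _)) hi
  rw [integral_add (hi1.const_mul _) (hi.const_mul _), integral_const_mul, integral_const_mul] at h
  linear_combination (-1 / 4 : ℂ) * h

/-- This reflects Q = (a + a*)/2 and a|α⟩ = α|α⟩. It reduces the SLD equation to scalar Gaussian
integrals. -/
theorem inner_positionPMap_coherentVec (κ θ : ℝ) (β α : ℂ) :
    ⟪coherentVec β, positionPMap κ θ ⟨coherentVec α, coherentVec_mem_domain κ θ α⟩⟫_ℂ =
      κ * ((starRingEnd ℂ β + α) / 2 - θ) * ⟪coherentVec β, coherentVec α⟫_ℂ := by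
  have hi := integrable_conj_coherentFun_mul β α
  have hi1 : Integrable fun x : ℝ =>
      (x : ℂ) * (starRingEnd ℂ (coherentFun β x) * coherentFun α x) := by
    simpa using integrable_mul_conj_coherentFun 1 0 β α
  rw [inner_positionPMap_right, inner_coherentVec_eq_integral]
  have e : ∀ x : ℝ, ((κ * (x - θ) : ℝ) : ℂ) *
      (starRingEnd ℂ (coherentFun β x) * coherentFun α x) =
      κ * ((x : ℂ) * (starRingEnd ℂ (coherentFun β x) * coherentFun α x)) -
        κ * θ * (starRingEnd ℂ (coherentFun β x) * coherentFun α x) := fun x => by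
    push_cast; ring
  simp only [e]
  rw [integral_sub (hi1.const_mul _) (hi.const_mul _), integral_const_mul, integral_const_mul,
    integral_mul_conj_coherentFun]
  ring

/-! ## The second moment of the position -/

theorem enorm_sq_eq_lintegral {X : Type*} [MeasureSpace X] (f : HilbertL2 X) :
    ‖f‖ₑ ^ 2 = ∫⁻ x, ‖f x‖ₑ ^ 2 := by
  have h := eLpNorm_nnreal_pow_eq_lintegral (f := f) (p := 2) (μ := volume) two_ne_zero
  rw [Lp.enorm_def]
  simpa using h

theorem enorm_positionPMap_coherentVec_sq (κ θ : ℝ) (α : ℂ) :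
    ‖positionPMap κ θ ⟨coherentVec α, coherentVec_mem_domain κ θ α⟩‖ₑ ^ 2 =
      ∫⁻ x : ℝ, ENNReal.ofReal ((κ * (x - θ)) ^ 2) *
        ENNReal.ofReal (‖coherentFun α x‖ ^ 2) := by
  rw [enorm_sq_eq_lintegral]
  refine lintegral_congr_ae ?_
  filter_upwards [coherentVec_coeFn α,
    mulPMap_coeFn _ ⟨coherentVec α, coherentVec_mem_domain κ θ α⟩] with x h1 h2
  rw [h2, h1, ← ofReal_norm, ← ENNReal.ofReal_pow (norm_nonneg _), norm_mul, mul_pow,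
    Complex.norm_real, Real.norm_eq_abs, sq_abs, ENNReal.ofReal_mul (by positivity)]

theorem lintegral_sq_gaussianReal (κ θ : ℝ) (v : NNReal) :
    ∫⁻ x, ENNReal.ofReal ((κ * (x - θ)) ^ 2) ∂(ProbabilityTheory.gaussianReal θ v) =
      ENNReal.ofReal (κ ^ 2 * v) := by
  have hi : Integrable (fun x : ℝ => (κ * (x - θ)) ^ 2) (ProbabilityTheory.gaussianReal θ v) := by
    have h1 : MemLp (fun x : ℝ => x) 2 (ProbabilityTheory.gaussianReal θ v) :=
      ProbabilityTheory.memLp_id_gaussianReal 2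
    exact ((h1.sub (memLp_const θ)).const_mul κ).integrable_sq
  rw [← ofReal_integral_eq_lintegral_ofReal hi (ae_of_all _ fun x => by positivity)]
  congr 1
  have h := ProbabilityTheory.variance_fun_id_gaussianReal (μ := θ) (v := v)
  rw [ProbabilityTheory.variance_eq_integral measurable_id'.aemeasurable,
    ProbabilityTheory.integral_id_gaussianReal] at h
  simp only [mul_pow]
  rw [integral_const_mul, h]

/-- Averaging over the amplitude first, by Tonelli, turns the squared wave functions into the
position law, so the result is κ² times the variance. -/
theorem lintegral_enorm_positionPMap_coherentVec_sq {N : ℝ} (hN : 0 < N) (κ θ : ℝ) :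
    ∫⁻ α, ‖positionPMap κ θ ⟨coherentVec α, coherentVec_mem_domain κ θ α⟩‖ₑ ^ 2
      ∂(amplitudeMeasure N θ) = ENNReal.ofReal (κ ^ 2 * ((N + 1 / 2) / 2)) := by
  have := isFiniteMeasure_amplitudeMeasure hN θ
  have hm : Measurable fun p : ℂ × ℝ => ENNReal.ofReal ((κ * (p.2 - θ)) ^ 2) *
      ENNReal.ofReal (‖coherentFun p.1 p.2‖ ^ 2) := by
    simp only [norm_coherentFun_sq]
    fun_prop
  simp only [enorm_positionPMap_coherentVec_sq]
  rw [lintegral_lintegral_swap hm.aemeasurable, ← coe_positionVar hN, ← lintegral_sq_gaussianReal κ θ,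
    ProbabilityTheory.gaussianReal_of_var_ne_zero _ (positionVar_ne_zero hN),
    lintegral_withDensity_eq_lintegral_mul _ (ProbabilityTheory.measurable_gaussianPDF _ _)
      (by fun_prop)]
  refine lintegral_congr fun x => ?_
  rw [lintegral_const_mul _ (measurable_norm_coherentFun_sq x), lintegral_norm_coherentFun_sq hN,
    Pi.mul_apply, mul_comm]

/-! ### The operator κ(Q − θ) on the range of √ρ, and injectivity of ρ -/

theorem enorm_sqrt_gaussianState_sq {N : ℝ} (hN : 0 < N) (θ : ℝ) (f : HilbertL2 ℝ) :
    ‖opSqrt (gaussianState N θ) f‖ₑ ^ 2 =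
      ∫⁻ α, ‖⟪coherentVec α, f⟫_ℂ‖ₑ ^ 2 ∂(amplitudeMeasure N θ) := by
  have := isFiniteMeasure_amplitudeMeasure hN θ
  rw [gaussianState_eq_mixedState hN]
  exact enorm_sqrt_mixedState_sq (aestronglyMeasurable_coherentVec _) norm_coherentVec f

theorem inner_coherentVec_positionPMap (κ θ : ℝ) (α : ℂ) (φ : (positionPMap κ θ).domain) :
    ⟪coherentVec α, positionPMap κ θ φ⟫_ℂ =
      ⟪positionPMap κ θ ⟨coherentVec α, coherentVec_mem_domain κ θ α⟩, (φ : HilbertL2 ℝ)⟫_ℂ :=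
  (LinearPMap.inner_apply_of_isSelfAdjoint (isSelfAdjoint_positionPMap κ θ)
    ⟨coherentVec α, coherentVec_mem_domain κ θ α⟩ φ).symm

theorem enorm_inner_le {H : Type*} [NormedAddCommGroup H] [InnerProductSpace ℂ H] (x y : H) :
    ‖⟪x, y⟫_ℂ‖ₑ ≤ ‖x‖ₑ * ‖y‖ₑ := by
  simp only [← ofReal_norm]
  rw [← ENNReal.ofReal_mul (norm_nonneg _)]
  exact ENNReal.ofReal_le_ofReal (norm_inner_le_norm x y)

/-- By symmetry κ(Q − θ) moves onto the coherent vector; Cauchy–Schwarz and the averaged second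
moment finish. -/
theorem enorm_sqrt_gaussianState_positionPMap_sq_le {N : ℝ} (hN : 0 < N) (κ θ : ℝ)
    (φ : (positionPMap κ θ).domain) :
    ‖opSqrt (gaussianState N θ) (positionPMap κ θ φ)‖ₑ ^ 2 ≤
      ENNReal.ofReal (κ ^ 2 * ((N + 1 / 2) / 2)) * ‖(φ : HilbertL2 ℝ)‖ₑ ^ 2 := by
  rw [enorm_sqrt_gaussianState_sq hN, ← lintegral_enorm_positionPMap_coherentVec_sq hN,
    ← lintegral_mul_const' _ _ (by finiteness)]
  refine lintegral_mono fun α => ?_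
  rw [inner_coherentVec_positionPMap, ← mul_pow]
  exact pow_le_pow_left' (enorm_inner_le _ _) 2

theorem norm_sqrt_gaussianState_positionPMap_le {N : ℝ} (hN : 0 < N) (κ θ : ℝ)
    (φ : (positionPMap κ θ).domain) :
    ‖opSqrt (gaussianState N θ) (positionPMap κ θ φ)‖ ≤
      √(κ ^ 2 * ((N + 1 / 2) / 2)) * ‖(φ : HilbertL2 ℝ)‖ := by
  have h := enorm_sqrt_gaussianState_positionPMap_sq_le hN κ θ φ
  rw [← ofReal_norm, ← ofReal_norm, ← ENNReal.ofReal_pow (norm_nonneg _),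
    ← ENNReal.ofReal_pow (norm_nonneg _), ← ENNReal.ofReal_mul (by positivity),
    ENNReal.ofReal_le_ofReal_iff (by positivity)] at h
  refine le_of_sq_le_sq ?_ (by positivity)
  rw [mul_pow, Real.sq_sqrt (by positivity)]
  exact h

/-- With L = κ(Q − θ), the functional φ ↦ ⟨√ρ ψ, Lφ⟩ = ⟨ψ, √ρ Lφ⟩ is bounded by the previous
estimate. So √ρ ψ lies in the domain of L*, which is L. -/
theorem sqrt_gaussianState_mem_domain {N : ℝ} (hN : 0 < N) (κ θ : ℝ) (ψ : HilbertL2 ℝ) :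
    opSqrt (gaussianState N θ) ψ ∈ (positionPMap κ θ).domain := by
  have hsa := isSelfAdjoint_positionPMap κ θ
  rw [← LinearPMap.isSelfAdjoint_def.1 hsa, LinearPMap.mem_adjoint_domain_iff]
  refine AddMonoidHomClass.continuous_of_bound _ (‖ψ‖ * √(κ ^ 2 * ((N + 1 / 2) / 2))) fun φ => ?_
  change ‖⟪opSqrt (gaussianState N θ) ψ, positionPMap κ θ φ⟫_ℂ‖ ≤ _
  rw [inner_sqrt_left, mul_assoc]
  refine (norm_inner_le_norm _ _).trans ?_
  gcongr
  exact norm_sqrt_gaussianState_positionPMap_le hN κ θ φ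

theorem gaussianState_nonneg {N : ℝ} (hN : 0 < N) (θ : ℂ) : 0 ≤ gaussianState N θ := by
  have := isFiniteMeasure_amplitudeMeasure hN θ
  rw [gaussianState_eq_mixedState hN]
  exact mixedState_nonneg (aestronglyMeasurable_coherentVec _) norm_coherentVec

theorem gaussianState_mem_domain {N : ℝ} (hN : 0 < N) (κ θ : ℝ) (ψ : HilbertL2 ℝ) :
    gaussianState N θ ψ ∈ (positionPMap κ θ).domain := by
  rw [← sqrt_sqrt_apply (gaussianState_nonneg hN θ)]
  exact sqrt_gaussianState_mem_domain hN κ θ _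

/-- The squared Hilbert-Schmidt norm of `κ (Q - θ) √ρ_θ`. -/
theorem tsum_enorm_positionPMap_sqrt_sq {N : ℝ} (hN : 0 < N) (κ θ : ℝ) {ι : Type*}
    (b : HilbertBasis ι ℂ (HilbertL2 ℝ)) :
    ∑' i, ‖positionPMap κ θ ⟨opSqrt (gaussianState N θ) (b i),
      sqrt_gaussianState_mem_domain hN κ θ (b i)⟩‖ₑ ^ 2 =
      ENNReal.ofReal (κ ^ 2 * ((N + 1 / 2) / 2)) := by
  obtain ⟨X, hX⟩ := (isSelfAdjoint_positionPMap κ θ).isClosed.exists_comp_eq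
    (opSqrt (gaussianState N θ)) (sqrt_gaussianState_mem_domain hN κ θ)
  -- The Hilbert–Schmidt norm is computed from X* = (L√ρ)* in the number basis: number vectors lie
  -- in the domain of L, so X*|k⟩ = √ρ L|k⟩. The squared norms are integrals of |⟨Lα, k⟩|², and
  -- Parseval sums them to ∫ ‖Lα‖².
  have hXk : ∀ k, ContinuousLinearMap.adjoint X (numberBasis k) =
      opSqrt (gaussianState N θ)
        (positionPMap κ θ ⟨numberVec k, numberVec_mem_domain κ θ k⟩) := by
    intro k
    refine ext_inner_right ℂ fun ψ => ?_
    rw [ContinuousLinearMap.adjoint_inner_left, hX, inner_sqrt_left, numberBasis_apply]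
    exact (LinearPMap.inner_apply_of_isSelfAdjoint (isSelfAdjoint_positionPMap κ θ)
      ⟨numberVec k, numberVec_mem_domain κ θ k⟩ ⟨_, sqrt_gaussianState_mem_domain hN κ θ ψ⟩).symm
  simp only [← hX]
  rw [b.tsum_enorm_apply_sq numberBasis X]
  simp only [hXk, enorm_sqrt_gaussianState_sq hN]
  rw [← lintegral_tsum, ← lintegral_enorm_positionPMap_coherentVec_sq hN]
  · refine lintegral_congr fun α => ?_
    rw [← numberBasis.tsum_enorm_inner_sq]
    refine tsum_congr fun k => ?_
    rw [inner_coherentVec_positionPMap, numberBasis_apply, ← ofReal_norm, norm_inner_symm,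
      ofReal_norm]
  · intro k
    have hc : Continuous fun α => ⟪coherentVec α,
        positionPMap κ θ ⟨numberVec k, numberVec_mem_domain κ θ k⟩⟫_ℂ :=
      continuous_coherentVec.inner continuous_const
    exact (hc.enorm.measurable.pow_const 2).aemeasurable

/-- If ρψ = 0, then |⟨α, ψ⟩|² has integral 0 against a strictly positive density. By continuity
every overlap vanishes, and coherent vectors are total. -/
theorem eq_zero_of_gaussianState_apply_eq_zero {N : ℝ} (hN : 0 < N) (θ : ℝ) {ψ : HilbertL2 ℝ}
    (h : gaussianState N θ ψ = 0) : ψ = 0 := by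
  have hc : Continuous fun α => ⟪coherentVec α, ψ⟫_ℂ :=
    continuous_coherentVec.inner continuous_const
  have h1 : opSqrt (gaussianState N θ) ψ = 0 := by
    rw [← inner_self_eq_zero (𝕜 := ℂ), inner_sqrt_left, sqrt_sqrt_apply (gaussianState_nonneg hN θ),
      h, inner_zero_right]
  have h2 := enorm_sqrt_gaussianState_sq hN θ ψ
  have hd : Measurable fun α : ℂ => ENNReal.ofReal (amplitudeDensity N θ α) :=
    (continuous_amplitudeDensity N θ).measurable.ennreal_ofReal
  have hm : Measurable fun α : ℂ => ‖⟪coherentVec α, ψ⟫_ℂ‖ₑ ^ 2 := hc.enorm.measurable.pow_const 2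
  rw [h1, enorm_zero, zero_pow two_ne_zero, amplitudeMeasure,
    lintegral_withDensity_eq_lintegral_mul _ hd hm, eq_comm, lintegral_eq_zero_iff (hd.mul hm)]
    at h2
  have h3 : (fun α => ⟪coherentVec α, ψ⟫_ℂ) =ᵐ[volume] fun _ => 0 := by
    filter_upwards [h2] with α hα
    have hpos : 0 < amplitudeDensity N θ α := by
      unfold amplitudeDensity
      positivity
    have h4 := (mul_eq_zero.1 hα).resolve_left (ENNReal.ofReal_pos.2 hpos).ne'
    simpa using h4
  exact eq_zero_of_inner_coherentVec fun α =>
    congrFun ((hc.ae_eq_iff_eq volume continuous_const).1 h3) α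

/-! ## The derivative of the Gaussian family -/

theorem amplitudeDensity_ofReal (N t : ℝ) (α : ℂ) : amplitudeDensity N t α =
    1 / (Real.pi * N) * Real.exp (-((α.re - t) ^ 2 + α.im ^ 2) / N) := by
  rw [amplitudeDensity, ← Complex.normSq_eq_norm_sq, Complex.normSq_apply, Complex.sub_re,
    Complex.sub_im, Complex.ofReal_re, Complex.ofReal_im]
  ring_nf

theorem hasDerivAt_amplitudeDensity (N t : ℝ) (α : ℂ) :
    HasDerivAt (fun t : ℝ => amplitudeDensity N t α)
      (2 * (α.re - t) / N * amplitudeDensity N t α) t := by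
  simp only [amplitudeDensity_ofReal]
  have h1 : HasDerivAt (fun t : ℝ => α.re - t) (-1) t := (hasDerivAt_id' t).const_sub _
  have h2 := (((((h1.pow 2).add_const (α.im ^ 2)).neg).div_const N).exp).const_mul
    (1 / (Real.pi * N))
  refine h2.congr_deriv ?_
  simp only [Pi.neg_apply, Pi.pow_apply]
  ring

theorem integrable_abs_add_one_mul_exp {b : ℝ} (hb : 0 < b) (θ : ℝ) :
    Integrable fun u : ℝ => (|u - θ| + 1) * Real.exp (-b * (u - θ) ^ 2) := by
  have h : Integrable fun u : ℝ => (|u| + 1) * Real.exp (-b * u ^ 2) := by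
    refine ((integrable_mul_exp_neg_mul_sq hb).norm.add (integrable_exp_neg_mul_sq hb)).congr
      (ae_of_all _ fun u => ?_)
    simp only [Pi.add_apply, norm_mul, Real.norm_eq_abs, Real.abs_exp]
    ring
  exact h.comp_sub_right θ

/-- Giving up half of the exponent in `Re α` yields a Gaussian bound independent of `t`, as needed
to differentiate under the integral. -/
theorem amplitudeDensity_le {N : ℝ} (hN : 0 < N) {θ t : ℝ} (ht : |t - θ| < 1) (α : ℂ) :
    amplitudeDensity N t α ≤ 1 / (Real.pi * N) * Real.exp (1 / N) *
      (Real.exp (-(1 / (2 * N)) * (α.re - θ) ^ 2) * Real.exp (-(1 / N) * α.im ^ 2)) := by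
  rw [amplitudeDensity_ofReal, mul_assoc, ← Real.exp_add, ← Real.exp_add]
  gcongr
  have h1 : (t - θ) ^ 2 < 1 := (sq_lt_one_iff_abs_lt_one _).2 ht
  have h2 : (α.re - θ) ^ 2 / 2 - 1 ≤ (α.re - t) ^ 2 := by
    nlinarith [sq_nonneg (α.re - θ - 2 * (t - θ))]
  have e : 1 / N + (-(1 / (2 * N)) * (α.re - θ) ^ 2 + -(1 / N) * α.im ^ 2) =
      -(((α.re - θ) ^ 2 / 2 - 1) + α.im ^ 2) / N := by
    field_simp
    ring
  rw [e]
  gcongr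

/-- The dominated derivative of a Gaussian mixture of unit vectors with respect to the mean. -/
theorem hasDerivAt_gaussianState {N : ℝ} (hN : 0 < N) (θ : ℝ) :
    Integrable (fun α : ℂ => (2 * (α.re - θ) / N * amplitudeDensity N θ α) •
      InnerProductSpace.rankOne ℂ (coherentVec α) (coherentVec α)) ∧
    HasDerivAt (fun t : ℝ => gaussianState N t)
      (∫ α : ℂ, (2 * (α.re - θ) / N * amplitudeDensity N θ α) •
        InnerProductSpace.rankOne ℂ (coherentVec α) (coherentVec α)) θ := by
  have e : (fun t : ℝ => gaussianState N t) = fun t : ℝ => ∫ α, amplitudeDensity N t α •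
      InnerProductSpace.rankOne ℂ (coherentVec α) (coherentVec α) := by
    funext t
    rw [gaussianState_eq_mixedState hN, mixedState, integral_amplitudeMeasure hN]
    rfl
  have hP : AEStronglyMeasurable
      (fun α : ℂ => InnerProductSpace.rankOne ℂ (coherentVec α) (coherentVec α)) volume :=
    continuous_rankOne_self.comp_aestronglyMeasurable (aestronglyMeasurable_coherentVec _)
  -- The projections have norm 1 and do not depend on `t`, so a scalar bound on the density gives
  -- the derivative in operator norm.
  have hP1 : ∀ α : ℂ, ‖InnerProductSpace.rankOne ℂ (coherentVec α) (coherentVec α)‖ = 1 :=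
    fun α => by simp [norm_coherentVec]
  have hw : ∀ t : ℝ, AEStronglyMeasurable (amplitudeDensity N t) volume := fun t =>
    (continuous_amplitudeDensity N t).aestronglyMeasurable
  rw [e]
  refine hasDerivAt_integral_of_dominated_loc_of_deriv_le
    (F := fun (t : ℝ) (α : ℂ) => amplitudeDensity N t α •
      InnerProductSpace.rankOne ℂ (coherentVec α) (coherentVec α))
    (F' := fun (t : ℝ) (α : ℂ) => (2 * (α.re - t) / N * amplitudeDensity N t α) •
      InnerProductSpace.rankOne ℂ (coherentVec α) (coherentVec α))
    (bound := fun α : ℂ => 2 / N * (1 / (Real.pi * N) * Real.exp (1 / N)) *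
      (((|α.re - θ| + 1) * Real.exp (-(1 / (2 * N)) * (α.re - θ) ^ 2)) *
        Real.exp (-(1 / N) * α.im ^ 2)))
    (s := Metric.ball θ 1) (Metric.ball_mem_nhds θ one_pos)
    (Eventually.of_forall fun t => (hw t).smul hP) ?_ ?_ ?_ ?_ ?_
  · refine ((integrable_amplitudeDensity hN θ).norm).mono ((hw θ).smul hP) (ae_of_all _ fun α => ?_)
    rw [norm_smul, hP1, mul_one, norm_norm]
  · have hc : Continuous fun α : ℂ => 2 * (α.re - θ) / N := by fun_prop
    exact (hc.aestronglyMeasurable.mul (hw θ)).smul hP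
  · refine ae_of_all _ fun α t ht => ?_
    rw [Metric.mem_ball, Real.dist_eq] at ht
    have h1 : |α.re - t| ≤ |α.re - θ| + 1 := by
      calc |α.re - t| = |(α.re - θ) - (t - θ)| := by ring_nf
        _ ≤ |α.re - θ| + |t - θ| := abs_sub _ _
        _ ≤ _ := by gcongr
    rw [norm_smul, hP1, mul_one, norm_mul, Real.norm_of_nonneg (amplitudeDensity_nonneg hN _ _),
      Real.norm_eq_abs, abs_div, abs_mul, abs_two, abs_of_pos hN]
    calc 2 * |α.re - t| / N * amplitudeDensity N t α
        ≤ 2 * (|α.re - θ| + 1) / N * (1 / (Real.pi * N) * Real.exp (1 / N) *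
          (Real.exp (-(1 / (2 * N)) * (α.re - θ) ^ 2) * Real.exp (-(1 / N) * α.im ^ 2))) := by
          have := amplitudeDensity_le hN ht α
          have := amplitudeDensity_nonneg hN t α
          gcongr
      _ = _ := by ring
  · exact (integrable_complex_mul (integrable_abs_add_one_mul_exp (by positivity) θ)
      (integrable_exp_neg_mul_sq (by positivity))).const_mul _
  · refine ae_of_all _ fun α t _ => ?_
    exact (hasDerivAt_amplitudeDensity N t α).smul_const _

/-! ## Integration by parts in the coherent representation -/

/-- Integration by parts against the constant function 1. -/
theorem integral_eq_zero_of_hasLineDerivAt {f f' : ℂ → ℂ} (v : ℂ) (hf : Integrable f)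
    (hf' : Integrable f') (h : ∀ α, HasLineDerivAt ℝ f (f' α) α v) : ∫ α, f' α = 0 := by
  have := integral_bilinear_hasLineDerivAt_right_eq_neg_left_of_integrable (μ := volume)
    (B := ContinuousLinearMap.mul ℝ ℂ) (f := fun _ : ℂ => (1 : ℂ)) (f' := fun _ => 0) (g := f)
    (g' := f') (v := v) (by simp) (by simpa using hf') (by simpa using hf)
    (fun x _ => (hasFDerivAt_const (1 : ℂ) x).hasLineDerivAt v) (fun x _ => h x)
  simpa using this

/-- The direction `1` is that of `Re α`. The function is a single exponential of a quadratic in `Re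
α` and `Im α`, and the first factor is the derivative of its exponent. -/
theorem hasLineDerivAt_amplitudeDensity_mul_inner (N θ : ℝ) (β γ α : ℂ) :
    HasLineDerivAt ℝ (fun α : ℂ => (amplitudeDensity N θ α : ℂ) *
        (⟪coherentVec β, coherentVec α⟫_ℂ * ⟪coherentVec α, coherentVec γ⟫_ℂ))
      ((starRingEnd ℂ β + γ - 2 * α.re - 2 * (α.re - θ) / N) * ((amplitudeDensity N θ α : ℂ) *
        (⟪coherentVec β, coherentVec α⟫_ℂ * ⟪coherentVec α, coherentVec γ⟫_ℂ))) α 1 := by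
  have e : ∀ α : ℂ, (amplitudeDensity N θ α : ℂ) *
      (⟪coherentVec β, coherentVec α⟫_ℂ * ⟪coherentVec α, coherentVec γ⟫_ℂ) =
      (1 / (Real.pi * N) : ℝ) * Complex.exp (-(‖γ‖ ^ 2 : ℝ) / 2 - (‖β‖ ^ 2 : ℝ) / 2 -
        (α.re ^ 2 + α.im ^ 2) - ((α.re - θ) ^ 2 + α.im ^ 2) / N +
        (starRingEnd ℂ β * (α.re + α.im * Complex.I) +
          (α.re - α.im * Complex.I) * γ)) := by
    intro α
    have h1 : ((‖α‖ ^ 2 : ℝ) : ℂ) = α.re ^ 2 + α.im ^ 2 := by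
      rw [← Complex.normSq_eq_norm_sq, Complex.normSq_apply]
      push_cast
      ring
    have h2 : starRingEnd ℂ α = α.re - α.im * Complex.I := by
      apply Complex.ext <;> simp
    rw [inner_coherentVec, inner_coherentVec, amplitudeDensity_ofReal, ← Complex.exp_add,
      Complex.ofReal_mul, Complex.ofReal_exp, mul_assoc, ← Complex.exp_add, h1, h2]
    congr 2
    conv_lhs => rw [← Complex.re_add_im α]
    simp only [Complex.add_re, Complex.add_im, Complex.ofReal_re, Complex.ofReal_im,
      Complex.mul_re, Complex.mul_im, Complex.I_re, Complex.I_im]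
    push_cast
    ring
  simp only [e]
  rw [HasLineDerivAt]
  simp only [Complex.add_re, Complex.add_im, Complex.smul_re, Complex.smul_im, Complex.one_re,
    Complex.one_im, smul_eq_mul, mul_one, mul_zero, add_zero, Complex.ofReal_add]
  have h1 : HasDerivAt (fun t : ℝ => (α.re : ℂ) + (t : ℂ)) 1 0 :=
    (Complex.ofRealCLM.hasDerivAt (x := (0 : ℝ))).const_add _
  have h2 := (((((h1.pow 2).add_const ((α.im : ℂ) ^ 2)).const_sub
    (-((‖γ‖ ^ 2 : ℝ) : ℂ) / 2 - (‖β‖ ^ 2 : ℝ) / 2)).sub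
      ((((h1.sub_const (θ : ℂ)).pow 2).add_const ((α.im : ℂ) ^ 2)).div_const (N : ℂ))).add
    (((h1.add_const (α.im * Complex.I)).const_mul (starRingEnd ℂ β)).add
      ((h1.sub_const (α.im * Complex.I)).mul_const γ))).cexp.const_mul
        ((1 / (Real.pi * N) : ℝ) : ℂ)
  refine h2.congr_deriv ?_
  simp only [Pi.add_apply, Pi.sub_apply, Pi.pow_apply, Complex.ofReal_zero, add_zero]
  push_cast
  ring

/-! ## The symmetric logarithmic derivative -/

theorem inner_gaussianState {N : ℝ} (hN : 0 < N) (θ : ℂ) (f g : HilbertL2 ℝ) :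
    ⟪f, gaussianState N θ g⟫_ℂ = ∫ α, (amplitudeDensity N θ α : ℂ) *
      (⟪f, coherentVec α⟫_ℂ * ⟪coherentVec α, g⟫_ℂ) := by
  have := isFiniteMeasure_amplitudeMeasure hN θ
  rw [gaussianState_eq_mixedState hN,
    inner_mixedState (aestronglyMeasurable_coherentVec _) norm_coherentVec,
    integral_amplitudeMeasure hN]
  simp only [Complex.real_smul]

theorem integrable_amplitudeDensity_mul_inner {N : ℝ} (hN : 0 < N) (θ : ℂ) (f g : HilbertL2 ℝ) :
    Integrable fun α => (amplitudeDensity N θ α : ℂ) *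
      (⟪f, coherentVec α⟫_ℂ * ⟪coherentVec α, g⟫_ℂ) := by
  have := isFiniteMeasure_amplitudeMeasure hN θ
  have h := integrable_inner_mul_inner
    (aestronglyMeasurable_coherentVec (amplitudeMeasure N θ)) norm_coherentVec f g
  rw [amplitudeMeasure, integrable_withDensity_iff_integrable_smul'
    (continuous_amplitudeDensity N θ).measurable.ennreal_ofReal
    (ae_of_all _ fun _ => ENNReal.ofReal_lt_top)] at h
  simpa only [ENNReal.toReal_ofReal (amplitudeDensity_nonneg hN θ _), Complex.real_smul] using h

/-- Totality of the coherent vectors is used twice, on the left directly and on the right through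
the adjoint. -/
theorem clm_eq_of_inner_coherentVec {S T : HilbertL2 ℝ →L[ℂ] HilbertL2 ℝ}
    (h : ∀ β γ, ⟪coherentVec β, S (coherentVec γ)⟫_ℂ = ⟪coherentVec β, T (coherentVec γ)⟫_ℂ) :
    S = T := by
  have h1 : ∀ γ, (S - T) (coherentVec γ) = 0 := fun γ =>
    eq_zero_of_inner_coherentVec fun β => by
      rw [sub_apply, inner_sub_right, h, sub_self]
  have h2 : ∀ f, ContinuousLinearMap.adjoint (S - T) f = 0 := fun f =>
    eq_zero_of_inner_coherentVec fun γ => by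
      rw [ContinuousLinearMap.adjoint_inner_right, h1, inner_zero_left]
  have h3 : ContinuousLinearMap.adjoint (S - T) = 0 := ContinuousLinearMap.ext h2
  exact sub_eq_zero.1 ((map_eq_zero_iff _ ContinuousLinearMap.adjoint.injective).1 h3)

theorem inner_positionPMap_left (κ θ : ℝ) (β α : ℂ) :
    ⟪positionPMap κ θ ⟨coherentVec β, coherentVec_mem_domain κ θ β⟩, coherentVec α⟫_ℂ =
      κ * ((starRingEnd ℂ β + α) / 2 - θ) * ⟪coherentVec β, coherentVec α⟫_ℂ := by
  rw [← inner_positionPMap_coherentVec]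
  exact LinearPMap.inner_apply_of_isSelfAdjoint (isSelfAdjoint_positionPMap κ θ)
    ⟨_, coherentVec_mem_domain κ θ β⟩ ⟨_, coherentVec_mem_domain κ θ α⟩

/-- The position operator, centred and scaled, solves the equation of the symmetric logarithmic
derivative. -/
theorem integral_symmetrized_eq {N : ℝ} (hN : 0 < N) (θ : ℝ) (β γ : ℂ) {κ : ℝ}
    (hκ : κ = 2 / (N + 1 / 2)) {G : ℂ → ℂ}
    (hG : G = fun α => (amplitudeDensity N θ α : ℂ) *
      (⟪coherentVec β, coherentVec α⟫_ℂ * ⟪coherentVec α, coherentVec γ⟫_ℂ))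
    (h1 : Integrable fun α : ℂ => κ * ((starRingEnd ℂ β + α) / 2 - θ) * G α)
    (h2 : Integrable fun α : ℂ => κ * ((starRingEnd ℂ α + γ) / 2 - θ) * G α)
    (h3 : Integrable fun α : ℂ => 2 * (α.re - θ) / N * G α) :
    1 / 2 * ((∫ α : ℂ, κ * ((starRingEnd ℂ β + α) / 2 - θ) * G α) +
      ∫ α : ℂ, κ * ((starRingEnd ℂ α + γ) / 2 - θ) * G α) =
    ∫ α : ℂ, 2 * (α.re - θ) / N * G α := by
  have hN1 : (N : ℂ) ≠ 0 := Complex.ofReal_ne_zero.2 hN.ne'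
  have hN2 : (2 * N + 1 : ℂ) ≠ 0 := by exact_mod_cast (by positivity : 2 * N + 1 ≠ 0)
  have hκ2 : (κ : ℂ) = 4 / (2 * N + 1) := by
    rw [hκ]
    push_cast
    rw [show (N : ℂ) + 1 / 2 = (2 * N + 1) / 2 by ring]
    field_simp
    ring
  -- Since α + ᾱ = 2 `Re α`, the integrands of the two sides differ, for this value of `κ`, by 1/(2N
  -- + 1) times the derivative of `G` in `Re α`. Integrability of that derivative is also read off
  -- from this identity.
  have e : ∀ α : ℂ, 1 / 2 * (κ * ((starRingEnd ℂ β + α) / 2 - θ) * G α +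
      κ * ((starRingEnd ℂ α + γ) / 2 - θ) * G α) - 2 * (α.re - θ) / N * G α =
      1 / (2 * N + 1) *
        ((starRingEnd ℂ β + γ - 2 * α.re - 2 * (α.re - θ) / N) * G α) := by
    intro α
    have h4 : starRingEnd ℂ α = 2 * α.re - α := by
      rw [eq_sub_iff_add_eq, add_comm]
      exact_mod_cast Complex.add_conj α
    rw [hκ2, h4]
    field_simp
    ring
  have h12 : Integrable fun α : ℂ => 1 / 2 * (κ * ((starRingEnd ℂ β + α) / 2 - θ) * G α +
      κ * ((starRingEnd ℂ α + γ) / 2 - θ) * G α) := (h1.add h2).const_mul (1 / 2)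
  have h5 := h12.sub h3
  have h6 : Integrable fun α : ℂ =>
      (starRingEnd ℂ β + γ - 2 * α.re - 2 * (α.re - θ) / N) * G α := by
    refine (h5.const_mul (2 * N + 1)).congr (ae_of_all _ fun α => ?_)
    simp only [Pi.sub_apply]
    rw [e, ← mul_assoc, mul_one_div_cancel hN2, one_mul]
  have h7 : ∫ α : ℂ, (starRingEnd ℂ β + γ - 2 * α.re - 2 * (α.re - θ) / N) * G α = 0 := by
    refine integral_eq_zero_of_hasLineDerivAt (f := G) 1 ?_ h6 fun α => ?_
    · rw [hG]
      exact integrable_amplitudeDensity_mul_inner hN θ _ _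
    · rw [hG]
      exact hasLineDerivAt_amplitudeDensity_mul_inner N θ β γ α
  rw [← integral_add h1 h2, ← integral_const_mul, ← sub_eq_zero,
    ← integral_sub h12 h3]
  simp only [e]
  rw [integral_const_mul, h7, mul_zero]

/-- Both sides of the SLD equation are bounded operators, so they are compared between coherent
vectors. There Lρ puts `L` on the left vector and its adjoint puts it on the right one. -/
theorem isSLD_positionPMap {N : ℝ} (hN : 0 < N) (θ : ℝ) :
    IsSLD (fun t : ℝ => gaussianState N t) θ (positionPMap (2 / (N + 1 / 2)) θ) where
  isSelfAdjoint := isSelfAdjoint_positionPMap _ θ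
  sqrt_mem := sqrt_gaussianState_mem_domain hN _ θ
  mem := gaussianState_mem_domain hN _ θ
  hasDerivAt := by
    set κ : ℝ := 2 / (N + 1 / 2) with hκ
    obtain ⟨Y, hY⟩ := (isSelfAdjoint_positionPMap κ θ).isClosed.exists_comp_eq
      (gaussianState N θ) (gaussianState_mem_domain hN κ θ)
    obtain ⟨hi, hd⟩ := hasDerivAt_gaussianState hN θ
    refine ⟨Y, hY, hd.congr_deriv (clm_eq_of_inner_coherentVec fun β γ => ?_)⟩
    set G : ℂ → ℂ := fun α => (amplitudeDensity N θ α : ℂ) *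
      (⟪coherentVec β, coherentVec α⟫_ℂ * ⟪coherentVec α, coherentVec γ⟫_ℂ) with hG
    have hβ := coherentVec_mem_domain κ θ β
    have hγ := coherentVec_mem_domain κ θ γ
    have e1 : ∀ α, (amplitudeDensity N θ α : ℂ) *
        (⟪positionPMap κ θ ⟨coherentVec β, hβ⟩, coherentVec α⟫_ℂ *
          ⟪coherentVec α, coherentVec γ⟫_ℂ) =
        κ * ((starRingEnd ℂ β + α) / 2 - θ) * G α := fun α => by
      rw [inner_positionPMap_left, hG]
      ring
    have e2 : ∀ α, (amplitudeDensity N θ α : ℂ) * (⟪coherentVec β, coherentVec α⟫_ℂ *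
          ⟪coherentVec α, positionPMap κ θ ⟨coherentVec γ, hγ⟩⟫_ℂ) =
        κ * ((starRingEnd ℂ α + γ) / 2 - θ) * G α := fun α => by
      rw [inner_positionPMap_coherentVec, hG]
      ring
    -- Keeping L|β⟩ as a vector of the Hilbert space makes integrability an instance of the general
    -- lemma, with no estimate of the linear factor in α.
    have h1 := integrable_amplitudeDensity_mul_inner hN θ
      (positionPMap κ θ ⟨coherentVec β, hβ⟩) (coherentVec γ)
    have h2 := integrable_amplitudeDensity_mul_inner hN θ (coherentVec β)
      (positionPMap κ θ ⟨coherentVec γ, hγ⟩)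
    simp only [e1] at h1
    simp only [e2] at h2
    have hiγ := hi.apply_continuousLinearMap (coherentVec γ)
    have e3 : ∀ α : ℂ, ⟪coherentVec β, ((2 * (α.re - θ) / N * amplitudeDensity N θ α) •
        InnerProductSpace.rankOne ℂ (coherentVec α) (coherentVec α)) (coherentVec γ)⟫_ℂ =
        2 * (α.re - θ) / N * G α := fun α => by
      change ⟪coherentVec β, (2 * (α.re - θ) / N * amplitudeDensity N θ α) •
        (⟪coherentVec α, coherentVec γ⟫_ℂ • coherentVec α)⟫_ℂ = _
      rw [inner_smul_right_eq_smul, inner_smul_right, Complex.real_smul, hG]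
      push_cast
      ring
    have h3 := hiγ.const_inner (𝕜 := ℂ) (coherentVec β)
    simp only [e3] at h3
    have hY1 : ⟪coherentVec β, Y (coherentVec γ)⟫_ℂ =
        ∫ α : ℂ, κ * ((starRingEnd ℂ β + α) / 2 - θ) * G α := by
      simp only [← e1]
      rw [hY, ← inner_gaussianState hN]
      exact (LinearPMap.inner_apply_of_isSelfAdjoint (isSelfAdjoint_positionPMap κ θ)
        ⟨_, hβ⟩ ⟨_, gaussianState_mem_domain hN κ θ _⟩).symm
    have hY2 : ⟪coherentVec β, ContinuousLinearMap.adjoint Y (coherentVec γ)⟫_ℂ =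
        ∫ α : ℂ, κ * ((starRingEnd ℂ α + γ) / 2 - θ) * G α := by
      simp only [← e2]
      rw [ContinuousLinearMap.adjoint_inner_right, hY, ← inner_gaussianState hN]
      refine (LinearPMap.inner_apply_of_isSelfAdjoint (isSelfAdjoint_positionPMap κ θ)
        ⟨_, gaussianState_mem_domain hN κ θ _⟩ ⟨_, hγ⟩).trans ?_
      have hsa := IsSelfAdjoint.of_nonneg (gaussianState_nonneg hN θ)
      exact ((ContinuousLinearMap.isSelfAdjoint_iff_isSymmetric.1 hsa) _ _)
    rw [ContinuousLinearMap.integral_apply hi, ← integral_inner hiγ]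
    simp only [e3]
    rw [smul_apply, add_apply, inner_smul_right,
      inner_add_right, hY1, hY2]
    exact (integral_symmetrized_eq hN θ β γ hκ hG h1 h2 h3).symm

theorem hasSLDFisherInformation_gaussianState {N : ℝ} (hN : 0 < N) (θ : ℝ) :
    HasSLDFisherInformation (fun t : ℝ => gaussianState N t) θ (2 / (N + 1 / 2)) := by
  refine ⟨⟨_, isSLD_positionPMap hN θ⟩, fun L h => ?_⟩
  have h0 := IsSLD.fisherInformation_eq (ρ := fun t : ℝ => gaussianState N t)
    (gaussianState_nonneg hN θ)
    (fun ψ hψ => eq_zero_of_gaussianState_apply_eq_zero hN θ hψ) h (isSLD_positionPMap hN θ)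
  rw [h0, IsSLD.fisherInformation]
  have h1 := tsum_enorm_positionPMap_sqrt_sq hN (2 / (N + 1 / 2)) θ
    (exists_hilbertBasis ℂ (HilbertL2 ℝ)).choose_spec.choose
  refine h1.trans ?_
  -- With κ = 2/(N + 1/2), the value κ² (N + 1/2)/2 is κ itself.
  congr 1
  field_simp

end

theorem mainTheorem9 (N : ℝ) (hN : 0 < N) :
    StronglyConsistentOn (fun t : ℝ => gaussianState N (t : ℂ)) positionMeanEstimator Set.univ ∧
      ∀ θ : ℝ, ∃ J : ℝ,
        HasSLDFisherInformation (fun t : ℝ => gaussianState N (t : ℂ)) θ J ∧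
        alphaUpper (fun t : ℝ => gaussianState N (t : ℂ)) positionMeanEstimator θ =
          ((J / 2 : ℝ) : EReal) ∧
        alphaLower (fun t : ℝ => gaussianState N (t : ℂ)) positionMeanEstimator θ =
          ((J / 2 : ℝ) : EReal) ∧
        J / 2 = 1 / (N + 1 / 2) := by
  have hJ : 2 / (N + 1 / 2) / 2 = 1 / (N + 1 / 2) := by ring
  refine ⟨stronglyConsistentOn_positionMeanEstimator hN, fun θ => ⟨2 / (N + 1 / 2),
    hasSLDFisherInformation_gaussianState hN θ, ?_, ?_, hJ⟩⟩
  · rw [hJ]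
    exact alphaUpper_positionMeanEstimator hN θ
  · rw [hJ]
    exact alphaLower_positionMeanEstimator hN θ
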